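/- Let $\tilde h(\vec k)=\int_{\mathbb R^3} h(\vec x)e^{i\vec k\cdot\vec x}\,d^3x$. Let $f,g:\mathbb{R}^3\to\mathbb{R}$ be compactly supported and square integrable with $\int|\vec k|\,|\tilde g(\vec k)|^2d^3k<\infty$, normalised by $\int fg=1$, and suppose that $f$ has non-vanishing average, $\int f\neq0$. Let $\vec d\in\mathbb{R}^3$ and put $f_A=f$, $g_A=g$, $f_B=f(\cdot-\vec d)$, $g_B=g(\cdot-\vec d)$; assume that the regions $\{f_A\ne0\}\cup\{g_A\neq0\}$ and $\{f_B\ne0\}\cup\{g_B\ne0\}$ are disjoint. For $H>0$ and $m\geq 0$ consider the free real scalar field of mass $m$ in the cosmological patch $ds^2=a(\eta)^2(-d\eta^2+d\vec x^2)$, $a(\eta)=-1/(H\eta)$, of de Sitter spacetime, in the Bunch--Davies vacuum, i.e. the Fock vacuum of the mode functions $e_k(\eta)=\sqrt{-\pi\eta/(4a(\eta)^2)}\,H^{(1)}_\nu(-k\eta)$ with $\nu=\sqrt{9/4-m^2/H^2}$. On the slice $a(\eta_0)=1$ let $\hat\Phi$ and $\hat\Pi=a^2\partial_\eta\hat\phi$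 be the field and its conjugate momentum, and let $A$ and $B$ be the single-mode subsystems generated by $(\hat\Phi[f_A],\hat\Pi[g_A])$ and $(\hat\Phi[f_B],\hat\Pi[g_B])$. Let $\sigma_{AB}=\begin{pmatrix}\sigma_A&C\\C^T&\sigma_B\end{pmatrix}$ be the matrix of the expectation values $\langle\{\hat O_i,\hat O_j\}\rangle$ of these four operators, let $\tilde\Delta=\det\sigma_A+\det\sigma_B-2\det C$, $\tilde\nu_-^2=\tfrac12\big(\tilde\Delta-\sqrt{\tilde\Delta^2-4\det\sigma_{AB}}\big)$, and let $\mathrm{LN}=\max\{0,-\log_2\tilde\nu_-\}$ be the logarithmic negativity. Write $\mathrm{LN}_r(H)$ for its value when $m=rH$, and let $\mathrm{LN}_r(0)$ be its value for the massless field in the Minkowski vacuum, where $\langle\{\hat\Phi[f],\hat\Phi[f']\}\rangle=\mathrm{Re}\int\frac{d^3k}{(2\pi)^3}|\vec k|^{-1}\tilde f\tilde f'^*$, $\langle\{\hat\Pi[g],\hat\Pi[g']\}\rangle=\mathrm{Re}\int\frac{d^3k}{(2\pi)^3}|\vec k|\tilde g\tilde g'^*$ and $\langle\{\hat\Phi[f],\hat\Pi[g]\}\rangle=0$.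 Then, for a light field, the entanglement between $A$ and $B$ decreases monotonically with $H\geq0$, in the following sense. 1. For every $H\ge0$ the limit $L(H)=\lim_{r\to0^+}\mathrm{LN}_r(H)$ exists and is finite; $L$ is non-increasing on $[0,\infty)$ and strictly decreasing on $\{H\ge0: L(H)>0\}$. 2. For all $0<H_0\leq H_1$ there is $r_0>0$ such that for every $r\in(0,r_0)$ the function $\mathrm{LN}_r$ is non-increasing on $[H_0,H_1]$ and strictly decreasing on $\{H\in[H_0,H_1]:\mathrm{LN}_r(H)>0\}$. 3. For every $H_1\ge0$ there are $C\in\mathbb{R}$ and $r_0>0$ such that $\mathrm{LN}_r(H')\le \mathrm{LN}_r(H)+C\,r^2$ for all $r\in(0,r_0)$ and all $0\le H\le H'\le H_1$. -/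

import Mathlib

open MeasureTheory Set Filter Topology

noncomputable section

namespace DeSitter

/-- Flat (comoving) space `ℝ³`, also used as momentum space. -/
abbrev Space : Type := EuclideanSpace ℝ (Fin 3)

/-- Elements `γ = (g, f)` of the classical phase space; `γ` labels the linear observable
`O_γ = Φ[f] - Π[g]`. -/
abbrev PhaseSpace : Type := (Space → ℝ) × (Space → ℝ)

/-- Fourier transform with the convention `h̃(k) = ∫ d³x h(x) e^{i k·x}`. -/
def ft (h : Space → ℝ) (k : Space) : ℂ :=
  ∫ x, Complex.exp (Complex.I * ((inner ℝ k x : ℝ) : ℂ)) * ((h x : ℝ) : ℂ)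

/-- Homogeneous Sobolev product `(f, g)_s = ∫ d³k/(2π)³ |k|^{2s} f̃(k) g̃(k)^*`. -/
def sobolev (s : ℝ) (f g : Space → ℝ) : ℂ :=
  ∫ k, ((‖k‖ ^ (2 * s) / (2 * Real.pi) ^ 3 : ℝ) : ℂ) *
    (ft f k * (starRingEnd ℂ) (ft g k))

/-- Covariance metric of the vacuum of the massless field in Minkowski spacetime. -/
def minkCov (γ γ' : PhaseSpace) : ℝ :=
  (sobolev (1 / 2) γ.1 γ'.1).re + (sobolev (-1 / 2) γ.2 γ'.2).re

/-- Hankel function of the first kind `H_ν^{(1)}(x)`, for `ν > -1/2` and `x > 0`, by Hankel's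
integral
`H_ν^{(1)}(x) = √(2/(πx)) e^{i(x - νπ/2 - π/4)} / Γ(ν+1/2) · ∫₀^∞ e^{-u} u^{ν-1/2} (1 + iu/(2x))^{ν-1/2} du`
(principal branch of the power); in this range it is the function
`(J_{-ν}(x) - e^{-iπν} J_ν(x)) / (i sin πν)`. -/
def hankel1 (ν x : ℝ) : ℂ :=
  ((Real.sqrt (2 / (Real.pi * x)) : ℝ) : ℂ) *
    Complex.exp (Complex.I * ((x - ν * Real.pi / 2 - Real.pi / 4 : ℝ) : ℂ)) /
    ((Real.Gamma (ν + 1 / 2) : ℝ) : ℂ) *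
    ∫ u in Ioi (0 : ℝ), ((Real.exp (-u) * u ^ (ν - 1 / 2) : ℝ) : ℂ) *
      (1 + Complex.I * ((u / (2 * x) : ℝ) : ℂ)) ^ ((ν - 1 / 2 : ℝ) : ℂ)

/-- Scale factor of the cosmological patch in conformal time, `a(η) = -1/(Hη)`, `η < 0`. -/
def scaleFactor (H η : ℝ) : ℝ := -1 / (H * η)

/-- Index of the Bunch-Davies mode functions, `ν = √(9/4 - m²/H²)`. -/
def bdIndex (m H : ℝ) : ℝ := Real.sqrt (9 / 4 - m ^ 2 / H ^ 2)

/-- Bunch-Davies mode function `e_k(η) = √(-πη / (4 a(η)²)) H_ν^{(1)}(-kη)`. -/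
def bdMode (m H k η : ℝ) : ℂ :=
  ((Real.sqrt (-Real.pi * η / (4 * scaleFactor H η ^ 2)) : ℝ) : ℂ) *
    hankel1 (bdIndex m H) (-k * η)

/-- The instant at which the subsystems are defined: `a(η₀) = 1`, i.e. `η₀ = -1/H`. -/
def eta0 (H : ℝ) : ℝ := -1 / H

/-- Mode function of the conjugate momentum at `η₀`: since `Π = √h nᵃ∇ₐφ = a² ∂_η φ`, it is
`a(η₀)² e_k'(η₀)`. -/
def bdMomentumMode (m H k : ℝ) : ℂ :=
  ((scaleFactor H (eta0 H) ^ 2 : ℝ) : ℂ) * deriv (bdMode m H k) (eta0 H)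

/-- Coefficient of the annihilation operator `A_k` in `O_γ = Φ[f] - Π[g]`, where
`φ(η,x) = ∫ d³k/(2π)³ e^{ik·x} (e_k A_k + e_k^* A_{-k}^†)`. -/
def bdAmp (m H : ℝ) (γ : PhaseSpace) (k : Space) : ℂ :=
  ft γ.2 k * bdMode m H ‖k‖ (eta0 H) - ft γ.1 k * bdMomentumMode m H ‖k‖

/-- Covariance metric of the Bunch-Davies vacuum of a field of mass `m`,
`σ(γ,γ') = ⟨0|{O_γ, O_γ'}|0⟩`, with `[A_k, A_{k'}^†] = (2π)³ δ(k - k')`. -/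
def bdCov (m H : ℝ) (γ γ' : PhaseSpace) : ℝ :=
  ∫ k, 2 * (bdAmp m H γ k * (starRingEnd ℂ) (bdAmp m H γ' k)).re / (2 * Real.pi) ^ 3

/-- The block of matrix elements of `σ` between two pairs of phase space vectors. -/
def covBlock (σ : PhaseSpace → PhaseSpace → ℝ) (a b : Fin 2 → PhaseSpace) :
    Matrix (Fin 2) (Fin 2) ℝ :=
  Matrix.of fun i j => σ (a i) (b j)

/-- `ν̃₋²`, from `Δ̃ = det σ_A + det σ_B - 2 det C` and `det σ_AB`; `a` and `b` are Darboux bases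
of the two single-mode subsystems. -/
def nuTildeMinusSq (σ : PhaseSpace → PhaseSpace → ℝ) (a b : Fin 2 → PhaseSpace) : ℝ :=
  let A := covBlock σ a a
  let B := covBlock σ b b
  let C := covBlock σ a b
  let Δ := A.det + B.det - 2 * C.det
  (Δ - Real.sqrt (Δ ^ 2 - 4 * (Matrix.fromBlocks A C C.transpose B).det)) / 2

/-- Logarithmic negativity `max{0, -log₂ ν̃₋}` of two single modes in a Gaussian state with
covariance metric `σ`. -/
def logNeg (σ : PhaseSpace → PhaseSpace → ℝ) (a b : Fin 2 → PhaseSpace) : ℝ :=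
  max 0 (-Real.logb 2 (Real.sqrt (nuTildeMinusSq σ a b)))

/-- Spatial translation by `d`. -/
def translate (d : Space) (h : Space → ℝ) : Space → ℝ := fun x => h (x - d)

/-- The basis `γ⁽¹⁾ = (0, f)`, `γ⁽²⁾ = (-g, 0)`, with observables `(Φ[f], Π[g])`. -/
def pureMode (f g : Space → ℝ) : Fin 2 → PhaseSpace :=
  ![(0, f), (-g, 0)]

/-- Logarithmic negativity between the single-mode subsystem generated by `(Φ[f], Π[g])` and its
translate by `d`, for a field with mass-to-Hubble ratio `m/H = r` in the Bunch-Davies vacuum with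
Hubble rate `H`; at `H = 0` the spacetime is Minkowski and the field is massless. -/
def entanglement (f g : Space → ℝ) (d : Space) (r H : ℝ) : ℝ :=
  logNeg (if H = 0 then minkCov else bdCov (r * H) H)
    (pureMode f g) (pureMode (translate d f) (translate d g))

end DeSitter

end

/-! Fixing r = m/H fixes the Bunch-Davies index ν = 3/2 - ε, with r²/3 ≤ ε ≤ 2r²/3, so the
light-field limit is ε → 0⁺ with H free. On the slice a = 1, up to a common phase and powers of k,
the field and momentum modes are functions G and N of the single variable y = H/k (`bdMode_eta0`,
`bdMomentumMode_eq`). All covariances are momentum integrals of spectra of f and g against |G|²,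
Re(G N*) and |N|². For ε = 0 these are 1 + y², y and 1. Writing Hankel's integral as an average over
a Gamma distribution gives explicit bounds, uniform in ε and y, on the deviation of their increments
from this limit.

Since B is a translate of A, sums and differences of the two regions bring ν̃₋² to the form of a
two-level problem: it is the smaller root λ of (α - λ)(β - λ) = ρ with ρ ≥ 0 (`nuTildeMinusSq_eq`,
`rhoH_nonneg`). The three coefficients behave very differently as H grows.

The branch α contains the field correlator of the sum, with weight |f̃|²(1 + cos k·d). Its formal H²
coefficient is an integral against k⁻³, which diverges logarithmically at k = 0 because f̃(0) ≠ 0.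
The mass regulates it at exponentially small k, so α grows at least like (c/ε) H² (`entU_wXp_incr`,
`alpha_incr`).

The branch β contains the field correlator of the difference, whose weight |f̃|²(1 - cos k·d) is
O(k²). It is infrared finite and satisfies β = b₀ + K H² up to O(ε H²) (`quadAsymp_beta`). The slope
K is a Schur complement of a Gram matrix. It is positive because the f̃ part of the Gram vector
vanishes to first order at k = 0 along d and the g̃ part to second order (`slope_pos`).

The coupling ρ is bounded and Lipschitz in H², uniformly in ε (`lipSqAsymp_rho`).

For H ≥ H₀ > 0 the gap α - β is of order 1/ε, so λ follows β: it converges to b₀ + K H² and is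
strictly increasing for small ε (`Branches.tendsto_lam`, `Branches.lam_lt`). Near H = 0 the branches
may cross and level repulsion may push λ down, but the fast growth of α limits the loss to O(ε) =
O(r²) (`Branches.lam_sub_le`). As the logarithmic negativity is a decreasing function of λ, the
three claims follow. -/

noncomputable section
namespace DeSitter
open ProbabilityTheory

/-! ### The Gamma distribution -/

/-- The Gamma distribution of shape `a` and rate one. -/
def gam (a : ℝ) : Measure ℝ := gammaMeasure a 1

theorem gam_isProbabilityMeasure {a : ℝ} (ha : 0 < a) : IsProbabilityMeasure (gam a) :=
  isProbabilityMeasure_gammaMeasure ha one_pos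

theorem gam_eq (a : ℝ) : gam a = (volume.restrict (Ioi (0 : ℝ))).withDensity
    (fun u => ENNReal.ofReal ((Real.Gamma a)⁻¹ * (Real.exp (-u) * u ^ (a - 1)))) := by
  rw [gam, gammaMeasure, ← withDensity_indicator measurableSet_Ioi]
  refine withDensity_congr_ae ?_
  -- The two densities can disagree at u = 0 only, a null set.
  have h0 : ∀ᵐ u : ℝ, u ≠ 0 := by simp [ae_iff, measure_singleton]
  filter_upwards [h0] with u hu
  rcases lt_or_gt_of_ne hu with h | h
  · rw [gammaPDF_of_neg h, indicator_of_notMem (by simp [h.le])]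
  · rw [gammaPDF_of_nonneg h.le, indicator_of_mem (by exact h)]
    congr 1
    simp
    ring

theorem gam_density_nonneg {a u : ℝ} (ha : 0 < a) (hu : 0 < u) :
    0 ≤ (Real.Gamma a)⁻¹ * (Real.exp (-u) * u ^ (a - 1)) := by
  have := Real.Gamma_pos_of_pos ha
  positivity

theorem integrable_gam_iff {E : Type*} [NormedAddCommGroup E] [NormedSpace ℝ E] {a : ℝ}
    (ha : 0 < a) (φ : ℝ → E) : Integrable φ (gam a) ↔
      IntegrableOn (fun u => (Real.exp (-u) * u ^ (a - 1)) • φ u) (Ioi 0) := by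
  have hG := Real.Gamma_pos_of_pos ha
  rw [gam_eq, integrable_withDensity_iff_integrable_smul' (by fun_prop) (by simp), IntegrableOn]
  have : (fun u => (ENNReal.ofReal ((Real.Gamma a)⁻¹ * (Real.exp (-u) * u ^ (a - 1)))).toReal • φ u)
      =ᵐ[volume.restrict (Ioi (0 : ℝ))]
      fun u => (Real.Gamma a)⁻¹ • ((Real.exp (-u) * u ^ (a - 1)) • φ u) := by
    filter_upwards [ae_restrict_mem measurableSet_Ioi] with u hu
    rw [ENNReal.toReal_ofReal (gam_density_nonneg ha hu), smul_smul]
  rw [integrable_congr this]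
  exact integrable_smul_iff (inv_ne_zero hG.ne') _

theorem integral_gam {E : Type*} [NormedAddCommGroup E] [NormedSpace ℝ E] {a : ℝ}
    (ha : 0 < a) (φ : ℝ → E) : ∫ u, φ u ∂(gam a) =
      (Real.Gamma a)⁻¹ • ∫ u in Ioi (0 : ℝ), (Real.exp (-u) * u ^ (a - 1)) • φ u := by
  rw [gam_eq, integral_withDensity_eq_integral_toReal_smul (by fun_prop) (by simp), ← integral_smul]
  refine setIntegral_congr_fun measurableSet_Ioi fun u hu => ?_
  rw [ENNReal.toReal_ofReal (gam_density_nonneg ha hu), smul_smul]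

theorem gam_ae_pos (a : ℝ) : ∀ᵐ u ∂(gam a), 0 < u := by
  rw [gam_eq]
  exact (withDensity_absolutelyContinuous _ _).ae_le (ae_restrict_mem measurableSet_Ioi)

theorem gam_integrable_pow {a : ℝ} (ha : 0 < a) (n : ℕ) : Integrable (fun u : ℝ => u ^ n) (gam a) := by
  rw [integrable_gam_iff ha]
  refine (Real.GammaIntegral_convergent (s := a + n) (by positivity)).congr_fun ?_ measurableSet_Ioi
  intro u hu
  simp only [smul_eq_mul]
  rw [mul_assoc, ← Real.rpow_natCast u n, ← Real.rpow_add hu]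
  ring_nf

theorem gam_integral_pow {a : ℝ} (ha : 0 < a) (n : ℕ) :
    ∫ u, u ^ n ∂(gam a) = (Real.Gamma a)⁻¹ * Real.Gamma (a + n) := by
  rw [integral_gam ha, Real.Gamma_eq_integral (by positivity : 0 < a + n), smul_eq_mul]
  congr 1
  refine setIntegral_congr_fun measurableSet_Ioi fun u hu => ?_
  simp only [smul_eq_mul]
  rw [mul_assoc, ← Real.rpow_natCast u n, ← Real.rpow_add hu]
  ring_nf

theorem gam_integral_id {a : ℝ} (ha : 0 < a) : ∫ u, u ∂(gam a) = a := by
  have := gam_integral_pow ha 1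
  have hG := Real.Gamma_pos_of_pos ha
  simp only [pow_one, Nat.cast_one, Real.Gamma_add_one ha.ne'] at this
  rw [this]
  field_simp

theorem gam_integral_sq {a : ℝ} (ha : 0 < a) : ∫ u, u ^ 2 ∂(gam a) = a * (a + 1) := by
  have hG := Real.Gamma_pos_of_pos ha
  rw [gam_integral_pow ha 2, show a + ((2 : ℕ) : ℝ) = (a + 1) + 1 by push_cast; ring,
    Real.Gamma_add_one (by positivity), Real.Gamma_add_one ha.ne']
  field_simp

theorem gam_integrable_id {a : ℝ} (ha : 0 < a) : Integrable (fun u : ℝ => u) (gam a) := by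
  simpa using gam_integrable_pow ha 1

/-! ### Powers of `1 + i t` -/

/-- The base `1 + i u y / 2` of the power in Hankel's integral. -/
def hbase (y u : ℝ) : ℂ := 1 + Complex.I * ((u * y / 2 : ℝ) : ℂ)

theorem one_add_I_mul_slit (t : ℝ) : 1 + Complex.I * (t : ℂ) ∈ Complex.slitPlane := by
  left; simp

theorem one_add_I_mul_ne_zero (t : ℝ) : 1 + Complex.I * (t : ℂ) ≠ 0 :=
  Complex.slitPlane_ne_zero (one_add_I_mul_slit t)

theorem norm_one_add_I_mul_sq (t : ℝ) : ‖1 + Complex.I * (t : ℂ)‖ ^ 2 = 1 + t ^ 2 := by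
  rw [← Complex.normSq_eq_norm_sq, Complex.normSq_apply]; simp; ring

theorem one_le_norm_one_add_I_mul (t : ℝ) : 1 ≤ ‖1 + Complex.I * (t : ℂ)‖ := by
  have := norm_one_add_I_mul_sq t
  nlinarith [norm_nonneg (1 + Complex.I * (t : ℂ)), sq_nonneg t]

theorem le_norm_one_add_I_mul (t : ℝ) : t ≤ ‖1 + Complex.I * (t : ℂ)‖ := by
  have := norm_one_add_I_mul_sq t
  nlinarith [norm_nonneg (1 + Complex.I * (t : ℂ)), sq_nonneg t]

theorem norm_one_add_I_mul_le {t : ℝ} (ht : 0 ≤ t) : ‖1 + Complex.I * (t : ℂ)‖ ≤ 1 + t := by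
  have := norm_one_add_I_mul_sq t
  nlinarith [norm_nonneg (1 + Complex.I * (t : ℂ)), sq_nonneg t]

theorem arg_one_add_I_mul (t : ℝ) : (1 + Complex.I * (t : ℂ)).arg = Real.arctan t := by
  rw [Complex.arg_of_re_nonneg (by simp), Real.arctan_eq_arcsin]
  congr 2
  · simp
  · rw [← norm_one_add_I_mul_sq t, Real.sqrt_sq (norm_nonneg _)] 

theorem arg_one_add_I_mul_nonneg {t : ℝ} (ht : 0 ≤ t) : 0 ≤ (1 + Complex.I * (t : ℂ)).arg := by
  rw [arg_one_add_I_mul]; exact Real.arctan_nonneg.2 ht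

theorem arg_one_add_I_mul_le_pi_div_two (t : ℝ) : (1 + Complex.I * (t : ℂ)).arg ≤ Real.pi / 2 := by
  rw [arg_one_add_I_mul]; exact (Real.arctan_lt_pi_div_two t).le

theorem arg_one_add_I_mul_le {t : ℝ} (ht : 0 ≤ t) : (1 + Complex.I * (t : ℂ)).arg ≤ t := by
  rw [arg_one_add_I_mul]
  simpa [Real.tan_arctan] using
    Real.le_tan (Real.arctan_nonneg.2 ht) (Real.arctan_lt_pi_div_two t)

theorem cpow_ofReal_re_im (z : ℂ) (hz : z ≠ 0) (s : ℝ) :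
    (z ^ (s : ℂ)).re = ‖z‖ ^ s * Real.cos (s * z.arg) ∧
    (z ^ (s : ℂ)).im = ‖z‖ ^ s * Real.sin (s * z.arg) := by
  rw [Complex.cpow_def_of_ne_zero hz, Complex.exp_re, Complex.exp_im,
    Real.rpow_def_of_pos (norm_pos_iff.2 hz)]
  have h1 : (Complex.log z * (s : ℂ)).re = Real.log ‖z‖ * s := by simp [Complex.log_re]
  have h2 : (Complex.log z * (s : ℂ)).im = s * z.arg := by simp [Complex.log_im, mul_comm]
  rw [h1, h2]; exact ⟨rfl, rfl⟩

theorem norm_cpow_ofReal (z : ℂ) (hz : z ≠ 0) (s : ℝ) : ‖z ^ (s : ℂ)‖ = ‖z‖ ^ s := by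
  rw [Complex.norm_cpow_of_ne_zero hz]; simp

theorem norm_log_one_add_I_mul_le {t : ℝ} (ht : 0 ≤ t) :
    ‖Complex.log (1 + Complex.I * (t : ℂ))‖ ≤ Real.log (1 + t) + Real.pi / 2 := by
  refine (Complex.norm_le_abs_re_add_abs_im _).trans ?_
  rw [Complex.log_re, Complex.log_im, abs_of_nonneg (Real.log_nonneg (one_le_norm_one_add_I_mul t)),
    abs_of_nonneg (arg_one_add_I_mul_nonneg ht)]
  exact add_le_add (Real.log_le_log (by linarith [one_le_norm_one_add_I_mul t])
    (norm_one_add_I_mul_le ht)) (arg_one_add_I_mul_le_pi_div_two t)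

/-- Mean value inequality in the exponent: x ↦ exp(-x log c) has derivative of norm at most |log c|,
since Re log c = log |c| ≥ 0. The loss is only logarithmic in t, which is what later allows control
down to momenta exponentially small in 1/ε. -/
theorem norm_one_add_I_mul_cpow_neg_sub_one_le (t : ℝ) {s : ℝ} (hs : 0 ≤ s) :
    ‖(1 + Complex.I * (t : ℂ)) ^ ((-s : ℝ) : ℂ) - 1‖ ≤
      s * ‖Complex.log (1 + Complex.I * (t : ℂ))‖ := by
  set c := 1 + Complex.I * (t : ℂ)
  rw [Complex.cpow_def_of_ne_zero (one_add_I_mul_ne_zero t)]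
  set w : ℂ := Complex.log c
  have hw : 0 ≤ w.re := by
    rw [Complex.log_re]; exact Real.log_nonneg (one_le_norm_one_add_I_mul t)
  have key : ∀ x ∈ Icc (0 : ℝ) s, ‖Complex.exp (w * ((-x : ℝ) : ℂ)) - Complex.exp (w * ((-0 : ℝ) : ℂ))‖
      ≤ ‖w‖ * (x - 0) := by
    refine norm_image_sub_le_of_norm_deriv_le_segment'
      (f' := fun x => Complex.exp (w * ((-x : ℝ) : ℂ)) * (w * (-1))) (fun x hx => ?_) (fun x hx => ?_)
    · refine HasDerivAt.hasDerivWithinAt ?_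
      refine HasDerivAt.cexp ?_
      refine HasDerivAt.const_mul w ?_
      exact (hasDerivAt_neg x).ofReal_comp.congr_deriv (by simp)
    · rw [norm_mul, norm_mul, norm_neg, norm_one, mul_one, Complex.norm_exp]
      have : (w * ((-x : ℝ) : ℂ)).re = - (w.re * x) := by simp
      rw [this]
      have h1 : Real.exp (-(w.re * x)) ≤ 1 := by
        rw [Real.exp_le_one_iff]; have := mul_nonneg hw hx.1; linarith
      exact mul_le_of_le_one_left (norm_nonneg _) h1
  have := key s (right_mem_Icc.2 hs)
  simpa [mul_comm] using this

/-- The modulus is at most 1 and the angle is at most s·t. This bound is linear in t and so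
complements the logarithmic one: it vanishes at t = 0. -/
theorem abs_im_one_add_I_mul_cpow_neg_le {t s : ℝ} (ht : 0 ≤ t) (hs : 0 ≤ s) :
    |((1 + Complex.I * (t : ℂ)) ^ ((-s : ℝ) : ℂ)).im| ≤ s * t := by
  rw [(cpow_ofReal_re_im _ (one_add_I_mul_ne_zero t) _).2, abs_mul]
  have h1 : |‖1 + Complex.I * (t : ℂ)‖ ^ (-s)| ≤ 1 := by
    rw [abs_of_nonneg (by positivity)]
    exact Real.rpow_le_one_of_one_le_of_nonpos (one_le_norm_one_add_I_mul t) (by linarith)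
  have h2 : |Real.sin (-s * (1 + Complex.I * (t : ℂ)).arg)| ≤ s * t := by
    refine Real.abs_sin_le_abs.trans ?_
    rw [abs_mul, abs_neg, abs_of_nonneg hs, abs_of_nonneg (arg_one_add_I_mul_nonneg ht)]
    exact mul_le_mul_of_nonneg_left (arg_one_add_I_mul_le ht) hs
  calc _ ≤ 1 * (s * t) := mul_le_mul h1 h2 (abs_nonneg _) zero_le_one
    _ = s * t := one_mul _

/-- The argument of 1 + it lies in [0, π/2), and multiplying it by s ≤ 1 stays in the first
quadrant. These signs, and the mirrored ones for exponent -s, make |G|² increasing in y. -/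
theorem one_add_I_mul_cpow_re_im_nonneg {t s : ℝ} (ht : 0 ≤ t) (hs : 0 ≤ s) (hs1 : s ≤ 1) :
    0 ≤ ((1 + Complex.I * (t : ℂ)) ^ (s : ℂ)).re ∧ 0 ≤ ((1 + Complex.I * (t : ℂ)) ^ (s : ℂ)).im := by
  obtain ⟨h1, h2⟩ := cpow_ofReal_re_im _ (one_add_I_mul_ne_zero t) s
  rw [h1, h2]
  have ha := arg_one_add_I_mul_nonneg ht
  have hb := arg_one_add_I_mul_le_pi_div_two t
  have hc : s * (1 + Complex.I * (t : ℂ)).arg ≤ Real.pi / 2 := by nlinarith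
  have hd : 0 ≤ s * (1 + Complex.I * (t : ℂ)).arg := by positivity
  constructor
  · exact mul_nonneg (by positivity) (Real.cos_nonneg_of_neg_pi_div_two_le_of_le (by linarith [Real.pi_pos]) hc)
  · exact mul_nonneg (by positivity) (Real.sin_nonneg_of_nonneg_of_le_pi hd (by linarith [Real.pi_pos]))

theorem one_add_I_mul_cpow_neg_re_im {t s : ℝ} (ht : 0 ≤ t) (hs : 0 ≤ s) (hs1 : s ≤ 1) :
    0 ≤ ((1 + Complex.I * (t : ℂ)) ^ ((-s : ℝ) : ℂ)).re ∧
      ((1 + Complex.I * (t : ℂ)) ^ ((-s : ℝ) : ℂ)).im ≤ 0 := by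
  obtain ⟨h1, h2⟩ := cpow_ofReal_re_im _ (one_add_I_mul_ne_zero t) (-s)
  rw [h1, h2]
  have ha := arg_one_add_I_mul_nonneg ht
  have hb := arg_one_add_I_mul_le_pi_div_two t
  have hc : s * (1 + Complex.I * (t : ℂ)).arg ≤ Real.pi / 2 := by nlinarith
  have hd : 0 ≤ s * (1 + Complex.I * (t : ℂ)).arg := by positivity
  rw [neg_mul, Real.cos_neg, Real.sin_neg]
  constructor
  · exact mul_nonneg (by positivity) (Real.cos_nonneg_of_neg_pi_div_two_le_of_le (by linarith [Real.pi_pos]) hc)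
  · have := mul_nonneg (by positivity : 0 ≤ ‖1 + Complex.I * (t : ℂ)‖ ^ (-s))
      (Real.sin_nonneg_of_nonneg_of_le_pi hd (by linarith [Real.pi_pos]))
    linarith

end DeSitter
end

noncomputable section
namespace DeSitter
open ProbabilityTheory

/-! ### Hankel's integrals as Gamma averages -/

theorem continuous_hbase_cpow (y : ℝ) (s : ℂ) : Continuous fun u => hbase y u ^ s := by
  unfold hbase
  exact Continuous.cpow (by fun_prop) continuous_const fun u => one_add_I_mul_slit _

theorem norm_hbase_cpow (y u s : ℝ) : ‖hbase y u ^ (s : ℂ)‖ = ‖hbase y u‖ ^ s :=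
  norm_cpow_ofReal _ (one_add_I_mul_ne_zero _) s

theorem norm_hbase_cpow_le_one (y u : ℝ) {s : ℝ} (hs : s ≤ 0) : ‖hbase y u ^ (s : ℂ)‖ ≤ 1 := by
  rw [hbase, norm_cpow_ofReal _ (one_add_I_mul_ne_zero _)]
  exact Real.rpow_le_one_of_one_le_of_nonpos (one_le_norm_one_add_I_mul _) hs

theorem norm_hbase_cpow_le (y u : ℝ) {s : ℝ} (hs : s ≤ 1) :
    ‖hbase y u ^ (s : ℂ)‖ ≤ 1 + |u| * |y| := by
  rw [hbase, norm_cpow_ofReal _ (one_add_I_mul_ne_zero _)]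
  refine (Real.rpow_le_rpow_of_exponent_le (one_le_norm_one_add_I_mul _) hs).trans ?_
  rw [Real.rpow_one]
  refine (norm_add_le _ _).trans ?_
  rw [norm_one, norm_mul, Complex.norm_I, Complex.norm_real, Real.norm_eq_abs, abs_div, abs_mul]
  have := mul_nonneg (abs_nonneg u) (abs_nonneg y)
  norm_num
  linarith

theorem hasDerivAt_hbase_cpow (s : ℝ) (y u : ℝ) : HasDerivAt (fun y => hbase y u ^ (s : ℂ))
    ((s : ℂ) * (Complex.I / 2) * ((u : ℂ) * hbase y u ^ ((s - 1 : ℝ) : ℂ))) y := by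
  have h1 : HasDerivAt (fun y => hbase y u) (Complex.I * ((u / 2 : ℝ) : ℂ)) y := by
    unfold hbase
    refine HasDerivAt.const_add _ (HasDerivAt.const_mul _ ?_)
    refine HasDerivAt.ofReal_comp ?_
    exact (((hasDerivAt_id y).const_mul u).div_const 2).congr_deriv (by simp)
  have h2 : HasDerivAt (fun z : ℂ => z ^ (s : ℂ)) ((s : ℂ) * hbase y u ^ ((s : ℂ) - 1)) (hbase y u) :=
    (Complex.hasStrictDerivAt_cpow_const (one_add_I_mul_slit _)).hasDerivAt
  refine (h2.comp y h1).congr_deriv ?_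
  push_cast
  ring

/-- The reduced Hankel function: `e_k(η₀) = (phase) G(H/k) / √(2k)`, where `ν = 3/2 - ε`. -/
def Gf (ε y : ℝ) : ℂ := ∫ u, hbase y u ^ ((1 - ε : ℝ) : ℂ) ∂(gam (2 - ε))

/-- The reduced Hankel function of index `ν - 1 = 1/2 - ε`. -/
def Jf (ε y : ℝ) : ℂ := ∫ u, hbase y u ^ ((-ε : ℝ) : ℂ) ∂(gam (1 - ε))

/-- The average proportional to the derivative of `Gf`. -/
def Kf (ε y : ℝ) : ℂ := ∫ u, (u : ℂ) * hbase y u ^ ((-ε : ℝ) : ℂ) ∂(gam (2 - ε))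

/-- The average proportional to the derivative of `Jf`. -/
def Lf (ε y : ℝ) : ℂ := ∫ u, (u : ℂ) * hbase y u ^ ((-ε - 1 : ℝ) : ℂ) ∂(gam (1 - ε))

theorem integrable_hbase_cpow {a : ℝ} (ha : 0 < a) (y : ℝ) {s : ℝ} (hs : s ≤ 1) :
    Integrable (fun u => hbase y u ^ (s : ℂ)) (gam a) := by
  have := gam_isProbabilityMeasure ha
  refine Integrable.mono' (g := fun u => 1 + |u| * |y|)
    ((integrable_const _).add ((gam_integrable_id ha).abs.mul_const _))
    (continuous_hbase_cpow _ _).aestronglyMeasurable ?_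
  exact Eventually.of_forall fun u => norm_hbase_cpow_le y u hs

theorem norm_mul_hbase_cpow_le (y u : ℝ) {s : ℝ} (hs : s ≤ 0) :
    ‖(u : ℂ) * hbase y u ^ (s : ℂ)‖ ≤ |u| := by
  rw [norm_mul, Complex.norm_real, Real.norm_eq_abs]
  exact mul_le_of_le_one_right (abs_nonneg _) (norm_hbase_cpow_le_one y u hs)

theorem integrable_mul_hbase_cpow {a : ℝ} (ha : 0 < a) (y : ℝ) {s : ℝ} (hs : s ≤ 0) :
    Integrable (fun u : ℝ => (u : ℂ) * hbase y u ^ (s : ℂ)) (gam a) := by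
  refine Integrable.mono' (gam_integrable_id ha).abs
    (Continuous.mul (by fun_prop) (continuous_hbase_cpow _ _)).aestronglyMeasurable ?_
  exact Eventually.of_forall fun u => norm_mul_hbase_cpow_le y u hs

/-- Differentiation lowers the exponent to s - 1 ≤ 0, where the power has modulus at most 1. Hence a
constant times |u|, integrable for the Gamma law, dominates for all y at once. -/
theorem hasDerivAt_integral_hbase_cpow {a : ℝ} (ha : 0 < a) (y : ℝ) {s : ℝ} (hs : s ≤ 1) :
    HasDerivAt (fun y => ∫ u, hbase y u ^ (s : ℂ) ∂(gam a))
      ((s : ℂ) * (Complex.I / 2) * ∫ u, (u : ℂ) * hbase y u ^ ((s - 1 : ℝ) : ℂ) ∂(gam a)) y := by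
  rw [← integral_const_mul]
  refine (hasDerivAt_integral_of_dominated_loc_of_deriv_le (s := univ)
    (F := fun y u => hbase y u ^ (s : ℂ))
    (F' := fun y u => (s : ℂ) * (Complex.I / 2) * ((u : ℂ) * hbase y u ^ ((s - 1 : ℝ) : ℂ)))
    (bound := fun u => ‖(s : ℂ) * (Complex.I / 2)‖ * |u|) univ_mem
    (Eventually.of_forall fun y => (continuous_hbase_cpow _ _).aestronglyMeasurable)
    (integrable_hbase_cpow ha y hs)
    (((integrable_mul_hbase_cpow ha y (by linarith)).aestronglyMeasurable).const_mul _)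
    (Eventually.of_forall fun u y _ => ?_) ((gam_integrable_id ha).abs.const_mul _)
    (Eventually.of_forall fun u y _ => hasDerivAt_hbase_cpow s y u)).2
  rw [norm_mul]
  exact mul_le_mul_of_nonneg_left (norm_mul_hbase_cpow_le y u (by linarith)) (norm_nonneg _)

theorem hasDerivAt_Gf {ε : ℝ} (h0 : 0 ≤ ε) (h1 : ε < 1) (y : ℝ) :
    HasDerivAt (Gf ε) (((1 - ε : ℝ) : ℂ) * (Complex.I / 2) * Kf ε y) y := by
  have := hasDerivAt_integral_hbase_cpow (a := 2 - ε) (by linarith) y (s := 1 - ε) (by linarith)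
  rwa [show 1 - ε - 1 = -ε by ring] at this

theorem hasDerivAt_Jf {ε : ℝ} (h0 : 0 ≤ ε) (h1 : ε < 1) (y : ℝ) :
    HasDerivAt (Jf ε) (((-ε : ℝ) : ℂ) * (Complex.I / 2) * Lf ε y) y :=
  hasDerivAt_integral_hbase_cpow (a := 1 - ε) (by linarith) y (s := -ε) (by linarith)

theorem hbase_zero (u : ℝ) : hbase 0 u = 1 := by simp [hbase]

theorem Gf_zero {ε : ℝ} (h1 : ε < 1) : Gf ε 0 = 1 := by
  have := gam_isProbabilityMeasure (a := 2 - ε) (by linarith)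
  simp [Gf, hbase_zero]

theorem Jf_zero {ε : ℝ} (h1 : ε < 1) : Jf ε 0 = 1 := by
  have := gam_isProbabilityMeasure (a := 1 - ε) (by linarith)
  simp [Jf, hbase_zero]

/-! ### Pointwise bounds -/

/-- Combine |h| ≥ 1, taken u times, with |h| ≥ uy/2, taken twice. -/
theorem le_norm_hbase {y u : ℝ} (hu : 0 < u) : (1 + y) * u ≤ (u + 2) * ‖hbase y u‖ := by
  have h1 := one_le_norm_one_add_I_mul (u * y / 2)
  have h2 := le_norm_one_add_I_mul (u * y / 2)
  rw [hbase]
  nlinarith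

/-- The spare factor u pays for small u: (u/(u+2))^(-ε) ≤ (u+2)/u as ε ≤ 1. The decay (1 + y)^(-ε)
is thus kept with constants independent of ε. -/
theorem mul_norm_hbase_rpow_neg_le {ε y u : ℝ} (h0 : 0 ≤ ε) (h1 : ε ≤ 1) (hy : 0 ≤ y) (hu : 0 < u) :
    u * ‖hbase y u‖ ^ (-ε) ≤ (u + 2) * (1 + y) ^ (-ε) := by
  have h3 : (1 + y) * (u / (u + 2)) ≤ ‖hbase y u‖ := by
    rw [← mul_div_assoc, div_le_iff₀ (by linarith)]; linarith [le_norm_hbase (y := y) hu]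
  have h4 : ‖hbase y u‖ ^ (-ε) ≤ ((1 + y) * (u / (u + 2))) ^ (-ε) :=
    Real.rpow_le_rpow_of_nonpos (by positivity) h3 (by linarith)
  rw [Real.mul_rpow (by linarith) (by positivity)] at h4
  have h5 : (u / (u + 2)) ^ (-ε) ≤ (u / (u + 2)) ^ (-1 : ℝ) := by
    refine Real.rpow_le_rpow_of_exponent_ge (by positivity) ?_ (by linarith)
    rw [div_le_one (by linarith)]; linarith
  rw [Real.rpow_neg_one, inv_div] at h5
  have h6 : 0 ≤ (1 + y) ^ (-ε) := by positivity
  calc u * ‖hbase y u‖ ^ (-ε) ≤ u * ((1 + y) ^ (-ε) * ((u + 2) / u)) := by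
        refine mul_le_mul_of_nonneg_left (h4.trans ?_) hu.le
        exact mul_le_mul_of_nonneg_left h5 h6
    _ = (u + 2) * (1 + y) ^ (-ε) := by field_simp

theorem norm_log_hbase_le {y u : ℝ} (hy : 0 ≤ y) (hu : 0 < u) :
    ‖Complex.log (hbase y u)‖ ≤ u + Real.log (1 + y) + 2 := by
  refine (norm_log_one_add_I_mul_le (by positivity : 0 ≤ u * y / 2)).trans ?_
  have h1 : Real.log (1 + u * y / 2) ≤ Real.log ((1 + u) * (1 + y)) :=
    Real.log_le_log (by positivity) (by nlinarith [mul_pos hu hu, mul_nonneg hu.le hy])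
  rw [Real.log_mul (by positivity) (by positivity)] at h1
  have h2 := Real.log_le_sub_one_of_pos (by positivity : 0 < 1 + u)
  linarith [Real.pi_le_four]

theorem integral_re' {μ : Measure ℝ} {φ : ℝ → ℂ} (h : Integrable φ μ) :
    (∫ u, φ u ∂μ).re = ∫ u, (φ u).re ∂μ := (integral_re h).symm

theorem integral_im' {μ : Measure ℝ} {φ : ℝ → ℂ} (h : Integrable φ μ) :
    (∫ u, φ u ∂μ).im = ∫ u, (φ u).im ∂μ := (integral_im h).symm

section bounds

variable {ε y : ℝ}

theorem Gf_re_im_nonneg (h0 : 0 ≤ ε) (h1 : ε < 1) (hy : 0 ≤ y) :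
    0 ≤ (Gf ε y).re ∧ 0 ≤ (Gf ε y).im := by
  have hi := integrable_hbase_cpow (a := 2 - ε) (by linarith) y (s := 1 - ε) (by linarith)
  have key : ∀ u : ℝ, 0 < u → _ := fun u hu =>
    one_add_I_mul_cpow_re_im_nonneg (t := u * y / 2) (s := 1 - ε) (by positivity)
      (by linarith) (by linarith)
  rw [Gf, integral_re' hi, integral_im' hi]
  constructor <;> refine integral_nonneg_of_ae ?_ <;> filter_upwards [gam_ae_pos (2 - ε)] with u hu
  · exact (key u hu).1
  · exact (key u hu).2

theorem Kf_re_im (h0 : 0 ≤ ε) (h1 : ε < 1) (hy : 0 ≤ y) :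
    0 ≤ (Kf ε y).re ∧ (Kf ε y).im ≤ 0 := by
  have hi := integrable_mul_hbase_cpow (a := 2 - ε) (by linarith) y (s := -ε) (by linarith)
  have key : ∀ u : ℝ, 0 < u → _ := fun u hu =>
    one_add_I_mul_cpow_neg_re_im (t := u * y / 2) (s := ε) (by positivity) h0 h1.le
  rw [Kf, integral_re' hi, integral_im' hi]
  constructor
  · refine integral_nonneg_of_ae ?_
    filter_upwards [gam_ae_pos (2 - ε)] with u hu
    rw [Complex.re_ofReal_mul]
    exact mul_nonneg hu.le (key u hu).1
  · refine integral_nonpos_of_ae ?_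
    filter_upwards [gam_ae_pos (2 - ε)] with u hu
    rw [Complex.im_ofReal_mul]
    exact mul_nonpos_of_nonneg_of_nonpos hu.le (key u hu).2

/-- Pointwise |h| ≤ (1 + u)(1 + y), and u has mean 2 - ε. The exact power 1 - ε must be kept: it is
what makes |G|²/k integrable at k = 0. -/
theorem norm_Gf_le (h0 : 0 ≤ ε) (h1 : ε < 1) (hy : 0 ≤ y) :
    ‖Gf ε y‖ ≤ 3 * (1 + y) ^ (1 - ε) := by
  have hp := gam_isProbabilityMeasure (a := 2 - ε) (by linarith)
  have hid := gam_integrable_id (a := 2 - ε) (by linarith)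
  have : ‖Gf ε y‖ ≤ ∫ u, (1 + u) * (1 + y) ^ (1 - ε) ∂(gam (2 - ε)) := by
    refine norm_integral_le_of_norm_le (((integrable_const _).add hid).mul_const _) ?_
    filter_upwards [gam_ae_pos (2 - ε)] with u hu
    rw [hbase, norm_cpow_ofReal _ (one_add_I_mul_ne_zero _)]
    have h3 : ‖1 + Complex.I * ((u * y / 2 : ℝ) : ℂ)‖ ≤ (1 + u) * (1 + y) :=
      (norm_one_add_I_mul_le (by positivity)).trans (by nlinarith [mul_nonneg hu.le hy])
    calc _ ≤ ((1 + u) * (1 + y)) ^ (1 - ε) :=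
          Real.rpow_le_rpow (norm_nonneg _) h3 (by linarith)
      _ = (1 + u) ^ (1 - ε) * (1 + y) ^ (1 - ε) := Real.mul_rpow (by linarith) (by linarith)
      _ ≤ (1 + u) * (1 + y) ^ (1 - ε) := by
          refine mul_le_mul_of_nonneg_right ?_ (by positivity)
          calc (1 + u) ^ (1 - ε) ≤ (1 + u) ^ (1 : ℝ) :=
                Real.rpow_le_rpow_of_exponent_le (by linarith) (by linarith)
            _ = 1 + u := Real.rpow_one _
  refine this.trans ?_
  rw [integral_mul_const, integral_add (integrable_const _) hid, gam_integral_id (by linarith)]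
  simp only [integral_const, probReal_univ, smul_eq_mul, mul_one]
  refine mul_le_mul_of_nonneg_right (by linarith) (by positivity)

theorem norm_Jf_le (h0 : 0 ≤ ε) (h1 : ε < 1) : ‖Jf ε y‖ ≤ 1 := by
  have hp := gam_isProbabilityMeasure (a := 1 - ε) (by linarith)
  have := norm_integral_le_of_norm_le_const (μ := gam (1 - ε))
    (Eventually.of_forall fun u => norm_hbase_cpow_le_one y u (s := -ε) (by linarith))
  simpa [Jf] using this

theorem norm_Kf_le_two (h0 : 0 ≤ ε) (h1 : ε < 1) : ‖Kf ε y‖ ≤ 2 := by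
  have hid := gam_integrable_id (a := 2 - ε) (by linarith)
  have : ‖Kf ε y‖ ≤ ∫ u, u ∂(gam (2 - ε)) := by
    refine norm_integral_le_of_norm_le hid ?_
    filter_upwards [gam_ae_pos (2 - ε)] with u hu
    refine (norm_mul_hbase_cpow_le y u (by linarith)).trans (abs_of_pos hu).le
  rw [gam_integral_id (by linarith)] at this
  linarith

theorem norm_Kf_le (h0 : 0 ≤ ε) (h1 : ε < 1) (hy : 0 ≤ y) :
    ‖Kf ε y‖ ≤ 4 * (1 + y) ^ (-ε) := by
  have hp := gam_isProbabilityMeasure (a := 2 - ε) (by linarith)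
  have hid := gam_integrable_id (a := 2 - ε) (by linarith)
  have : ‖Kf ε y‖ ≤ ∫ u, (u + 2) * (1 + y) ^ (-ε) ∂(gam (2 - ε)) := by
    refine norm_integral_le_of_norm_le ((hid.add (integrable_const _)).mul_const _) ?_
    filter_upwards [gam_ae_pos (2 - ε)] with u hu
    rw [norm_mul, Complex.norm_real, Real.norm_of_nonneg hu.le,
      norm_hbase_cpow]
    exact mul_norm_hbase_rpow_neg_le h0 h1.le hy hu
  refine this.trans ?_
  rw [integral_mul_const, integral_add hid (integrable_const _), gam_integral_id (by linarith)]
  simp only [integral_const, probReal_univ, smul_eq_mul, one_mul]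
  refine mul_le_mul_of_nonneg_right (by linarith) (by positivity)

theorem norm_Lf_le (h0 : 0 ≤ ε) (h1 : ε < 1) (hy : 0 ≤ y) : ‖Lf ε y‖ ≤ 3 / (1 + y) := by
  have hp := gam_isProbabilityMeasure (a := 1 - ε) (by linarith)
  have hid := gam_integrable_id (a := 1 - ε) (by linarith)
  have : ‖Lf ε y‖ ≤ ∫ u, (u + 2) / (1 + y) ∂(gam (1 - ε)) := by
    refine norm_integral_le_of_norm_le ((hid.add (integrable_const _)).div_const _) ?_
    filter_upwards [gam_ae_pos (1 - ε)] with u hu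
    rw [norm_mul, Complex.norm_real, Real.norm_of_nonneg hu.le,
      norm_hbase_cpow]
    have h2 := one_le_norm_one_add_I_mul (u * y / 2)
    have h3 : ‖hbase y u‖ ^ (-ε - 1) ≤ ‖hbase y u‖ ^ (-1 : ℝ) :=
      Real.rpow_le_rpow_of_exponent_le h2 (by linarith)
    rw [Real.rpow_neg_one] at h3
    refine (mul_le_mul_of_nonneg_left h3 hu.le).trans ?_
    rw [← div_eq_mul_inv, div_le_div_iff₀ (by rw [hbase]; linarith) (by linarith)]
    linarith [le_norm_hbase (y := y) hu]
  refine this.trans ?_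
  rw [integral_div, integral_add hid (integrable_const _), gam_integral_id (by linarith)]
  simp only [integral_const, probReal_univ, smul_eq_mul, one_mul]
  exact div_le_div_of_nonneg_right (by linarith) (by linarith)

/-- At ε = 0 the average is the mean 2 of the Gamma law, so the deviation is the average of u times
h^(-ε) - 1, of order ε up to a logarithm. -/
theorem norm_Kf_sub_le (h0 : 0 ≤ ε) (h1 : ε < 1) (hy : 0 ≤ y) :
    ‖Kf ε y - ((2 - ε : ℝ) : ℂ)‖ ≤ 10 * ε * (1 + Real.log (1 + y)) := by
  have hp := gam_isProbabilityMeasure (a := 2 - ε) (by linarith)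
  have hid := gam_integrable_id (a := 2 - ε) (by linarith)
  have hsq := gam_integrable_pow (a := 2 - ε) (by linarith) 2
  have hi := integrable_mul_hbase_cpow (a := 2 - ε) (by linarith) y (s := -ε) (by linarith)
  have hlog := Real.log_nonneg (by linarith : 1 ≤ 1 + y)
  have e1 : ((2 - ε : ℝ) : ℂ) = ∫ u : ℝ, (u : ℂ) ∂(gam (2 - ε)) := by
    rw [integral_complex_ofReal, gam_integral_id (by linarith)]
  have hid' : Integrable (fun u : ℝ => (u : ℂ)) (gam (2 - ε)) := hid.ofReal
  rw [e1, Kf, ← integral_sub hi hid']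
  have : ‖∫ u : ℝ, ((u : ℂ) * hbase y u ^ ((-ε : ℝ) : ℂ) - (u : ℂ)) ∂(gam (2 - ε))‖ ≤
      ∫ u, ε * (u ^ 2 + (Real.log (1 + y) + 2) * u) ∂(gam (2 - ε)) := by
    refine norm_integral_le_of_norm_le ((hsq.add (hid.const_mul _)).const_mul _) ?_
    filter_upwards [gam_ae_pos (2 - ε)] with u hu
    have h2 := norm_one_add_I_mul_cpow_neg_sub_one_le (u * y / 2) h0
    have h3 := norm_log_hbase_le hy hu
    rw [show (u : ℂ) * hbase y u ^ ((-ε : ℝ) : ℂ) - (u : ℂ) =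
      (u : ℂ) * (hbase y u ^ ((-ε : ℝ) : ℂ) - 1) by ring, norm_mul, Complex.norm_real,
      Real.norm_of_nonneg hu.le]
    calc _ ≤ u * (ε * (u + Real.log (1 + y) + 2)) :=
          mul_le_mul_of_nonneg_left (h2.trans (mul_le_mul_of_nonneg_left h3 h0)) hu.le
      _ = _ := by ring
  refine this.trans ?_
  rw [integral_const_mul, integral_add hsq (hid.const_mul _), integral_const_mul,
    gam_integral_id (by linarith), gam_integral_sq (by linarith)]
  have : (2 - ε) * (2 - ε + 1) + (Real.log (1 + y) + 2) * (2 - ε) ≤ 10 * (1 + Real.log (1 + y)) := by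
    nlinarith [mul_nonneg h0 hlog]
  nlinarith

theorem abs_Kf_im_le (h0 : 0 ≤ ε) (h1 : ε < 1) (hy : 0 ≤ y) : |(Kf ε y).im| ≤ 3 * ε * y := by
  have hsq := gam_integrable_pow (a := 2 - ε) (by linarith) 2
  have hi := integrable_mul_hbase_cpow (a := 2 - ε) (by linarith) y (s := -ε) (by linarith)
  rw [Kf, integral_im' hi]
  have : ‖∫ u : ℝ, ((u : ℂ) * hbase y u ^ ((-ε : ℝ) : ℂ)).im ∂(gam (2 - ε))‖ ≤
      ∫ u, (ε * y / 2) * u ^ 2 ∂(gam (2 - ε)) := by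
    refine norm_integral_le_of_norm_le (hsq.const_mul _) ?_
    filter_upwards [gam_ae_pos (2 - ε)] with u hu
    rw [Complex.im_ofReal_mul, Real.norm_eq_abs, abs_mul, abs_of_pos hu]
    have := abs_im_one_add_I_mul_cpow_neg_le (t := u * y / 2) (by positivity) h0
    calc _ ≤ u * (ε * (u * y / 2)) := mul_le_mul_of_nonneg_left this hu.le
      _ = _ := by ring
  refine this.trans ?_
  rw [integral_const_mul, gam_integral_sq (by linarith)]
  have : (2 - ε) * (2 - ε + 1) ≤ 6 := by nlinarith
  nlinarith [mul_nonneg h0 hy]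

theorem abs_Lf_im_le (h0 : 0 ≤ ε) (h1 : ε < 1) (hy : 0 ≤ y) : |(Lf ε y).im| ≤ 2 * y := by
  have hsq := gam_integrable_pow (a := 1 - ε) (by linarith) 2
  have hi := integrable_mul_hbase_cpow (a := 1 - ε) (by linarith) y (s := -ε - 1) (by linarith)
  rw [Lf, integral_im' hi]
  have : ‖∫ u : ℝ, ((u : ℂ) * hbase y u ^ ((-ε - 1 : ℝ) : ℂ)).im ∂(gam (1 - ε))‖ ≤
      ∫ u, y * u ^ 2 ∂(gam (1 - ε)) := by
    refine norm_integral_le_of_norm_le (hsq.const_mul _) ?_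
    filter_upwards [gam_ae_pos (1 - ε)] with u hu
    rw [Complex.im_ofReal_mul, Real.norm_eq_abs, abs_mul, abs_of_pos hu]
    have := abs_im_one_add_I_mul_cpow_neg_le (t := u * y / 2) (s := ε + 1) (by positivity)
      (by linarith)
    rw [show -(ε + 1) = -ε - 1 by ring] at this
    have h3 : (ε + 1) * (u * y / 2) ≤ u * y := by nlinarith [mul_nonneg hu.le hy]
    calc _ ≤ u * (u * y) := mul_le_mul_of_nonneg_left (this.trans h3) hu.le
      _ = _ := by ring
  refine this.trans ?_
  rw [integral_const_mul, gam_integral_sq (by linarith)]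
  have : (1 - ε) * (1 - ε + 1) ≤ 2 := by nlinarith
  nlinarith

theorem abs_Jf_im_le (h0 : 0 ≤ ε) (h1 : ε < 1) (hy : 0 ≤ y) : |(Jf ε y).im| ≤ ε * y := by
  have hid := gam_integrable_id (a := 1 - ε) (by linarith)
  have hi := integrable_hbase_cpow (a := 1 - ε) (by linarith) y (s := -ε) (by linarith)
  rw [Jf, integral_im' hi]
  have : ‖∫ u : ℝ, (hbase y u ^ ((-ε : ℝ) : ℂ)).im ∂(gam (1 - ε))‖ ≤
      ∫ u, (ε * y / 2) * u ∂(gam (1 - ε)) := by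
    refine norm_integral_le_of_norm_le (hid.const_mul _) ?_
    filter_upwards [gam_ae_pos (1 - ε)] with u hu
    have := abs_im_one_add_I_mul_cpow_neg_le (t := u * y / 2) (by positivity) h0
    rw [Real.norm_eq_abs]
    exact this.trans_eq (by ring)
  refine this.trans ?_
  rw [integral_const_mul, gam_integral_id (by linarith)]
  nlinarith [mul_nonneg h0 hy]

theorem norm_Jf_sub_one_le (h0 : 0 ≤ ε) (h1 : ε < 1) (hy : 0 ≤ y) :
    ‖Jf ε y - 1‖ ≤ 3 * ε * (1 + Real.log (1 + y)) := by
  have hp := gam_isProbabilityMeasure (a := 1 - ε) (by linarith)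
  have hid := gam_integrable_id (a := 1 - ε) (by linarith)
  have hi := integrable_hbase_cpow (a := 1 - ε) (by linarith) y (s := -ε) (by linarith)
  have hlog := Real.log_nonneg (by linarith : 1 ≤ 1 + y)
  have e1 : (1 : ℂ) = ∫ u : ℝ, (1 : ℂ) ∂(gam (1 - ε)) := by simp
  rw [e1, Jf, ← integral_sub hi (integrable_const _)]
  have : ‖∫ u : ℝ, (hbase y u ^ ((-ε : ℝ) : ℂ) - 1) ∂(gam (1 - ε))‖ ≤
      ∫ u, ε * (u + (Real.log (1 + y) + 2)) ∂(gam (1 - ε)) := by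
    refine norm_integral_le_of_norm_le ((hid.add (integrable_const _)).const_mul _) ?_
    filter_upwards [gam_ae_pos (1 - ε)] with u hu
    have h2 := norm_one_add_I_mul_cpow_neg_sub_one_le (u * y / 2) h0
    exact h2.trans (mul_le_mul_of_nonneg_left ((norm_log_hbase_le hy hu).trans_eq (by ring)) h0)
  refine this.trans ?_
  rw [integral_const_mul, integral_add hid (integrable_const _), gam_integral_id (by linarith)]
  simp only [integral_const, probReal_univ, smul_eq_mul, one_mul]
  nlinarith [mul_nonneg h0 hlog]

end bounds

end DeSitter
end

noncomputable section
namespace DeSitter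

/-! ### The quadratic expressions in the mode functions -/

/-- Both ψ - φ and ψ + φ are nondecreasing. This integrates every derivative bound below without
forming an integral in y. -/
theorem abs_sub_le_of_abs_deriv_le {φ φ' ψ ψ' : ℝ → ℝ} {Y : ℝ} (hφ : ∀ t, HasDerivAt φ (φ' t) t)
    (hψ : ∀ t, HasDerivAt ψ (ψ' t) t) (h : ∀ t, 0 ≤ t → t ≤ Y → |φ' t| ≤ ψ' t)
    {y y' : ℝ} (hy : 0 ≤ y) (hyy : y ≤ y') (hY : y' ≤ Y) : |φ y' - φ y| ≤ ψ y' - ψ y := by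
  have key : ∀ σ : ℝ, |σ| = 1 → σ * (φ y' - φ y) ≤ ψ y' - ψ y := by
    intro σ hσ
    have hd : ∀ t, HasDerivAt (fun t => ψ t - σ * φ t) (ψ' t - σ * φ' t) t := fun t =>
      (hψ t).sub ((hφ t).const_mul σ)
    have hm : MonotoneOn (fun t => ψ t - σ * φ t) (Icc 0 Y) := by
      refine monotoneOn_of_deriv_nonneg (convex_Icc 0 Y)
        (fun t _ => (hd t).continuousAt.continuousWithinAt)
        (fun t _ => (hd t).differentiableAt.differentiableWithinAt) fun t ht => ?_
      rw [interior_Icc] at ht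
      rw [(hd t).deriv]
      have h1 := h t ht.1.le ht.2.le
      have h2 : σ * φ' t ≤ |φ' t| := by
        calc σ * φ' t ≤ |σ * φ' t| := le_abs_self _
          _ = |φ' t| := by rw [abs_mul, hσ, one_mul]
      linarith
    have := hm ⟨hy, hyy.trans hY⟩ ⟨hy.trans hyy, hY⟩ hyy
    simp only at this
    linarith
  rw [abs_le]
  have h1 := key 1 (by simp)
  have h2 := key (-1) (by simp)
  constructor <;> linarith

/-- `|G|²`. -/
def uf (ε y : ℝ) : ℝ := (Gf ε y).re ^ 2 + (Gf ε y).im ^ 2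

/-- `Im (G J^*)`. -/
def bf (ε y : ℝ) : ℝ := (Gf ε y).im * (Jf ε y).re - (Gf ε y).re * (Jf ε y).im

/-- The reduced momentum mode `i J + ε y G`. -/
def Nt (ε y : ℝ) : ℂ := Complex.I * Jf ε y + ((ε * y : ℝ) : ℂ) * Gf ε y

/-- `Re (G Nt^*)`. -/
def vf (ε y : ℝ) : ℝ := bf ε y + ε * (y * uf ε y)

/-- `|Nt|²`. -/
def Nf (ε y : ℝ) : ℝ :=
  (Jf ε y).re ^ 2 + (Jf ε y).im ^ 2 + ε ^ 2 * (y ^ 2 * uf ε y) + 2 * ε * (y * bf ε y)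

theorem uf_eq_norm (ε y : ℝ) : uf ε y = ‖Gf ε y‖ ^ 2 := by
  rw [← Complex.normSq_eq_norm_sq, Complex.normSq_apply, uf]; ring

theorem Nf_eq_norm (ε y : ℝ) : Nf ε y = ‖Nt ε y‖ ^ 2 := by
  rw [← Complex.normSq_eq_norm_sq, Complex.normSq_apply, Nf, Nt, uf, bf]; simp; ring

theorem vf_eq_re (ε y : ℝ) : vf ε y = (Gf ε y * (starRingEnd ℂ) (Nt ε y)).re := by
  rw [vf, Nt, uf, bf]; simp; ring

theorem uf_nonneg (ε y : ℝ) : 0 ≤ uf ε y := by rw [uf]; positivity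

theorem Nf_nonneg (ε y : ℝ) : 0 ≤ Nf ε y := by rw [Nf_eq_norm]; positivity

theorem abs_vf_le (ε y : ℝ) : |vf ε y| ≤ Real.sqrt (uf ε y) * Real.sqrt (Nf ε y) := by
  rw [vf_eq_re, uf_eq_norm, Nf_eq_norm, Real.sqrt_sq (norm_nonneg _), Real.sqrt_sq (norm_nonneg _)]
  refine (Complex.abs_re_le_norm _).trans ?_
  rw [norm_mul, RCLike.norm_conj]

theorem uf_zero {ε : ℝ} (h1 : ε < 1) : uf ε 0 = 1 := by simp [uf, Gf_zero h1]
theorem vf_zero {ε : ℝ} (h1 : ε < 1) : vf ε 0 = 0 := by simp [vf, bf, Gf_zero h1, Jf_zero h1]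
theorem Nf_zero {ε : ℝ} (h1 : ε < 1) : Nf ε 0 = 1 := by simp [Nf, Jf_zero h1]
-- Derivatives and increments in y of |G|², Re(G N*) and |N|²
section bounds

variable {ε y y' : ℝ}

theorem hasDerivAt_re {φ : ℝ → ℂ} {φ' : ℂ} {t : ℝ} (h : HasDerivAt φ φ' t) :
    HasDerivAt (fun t => (φ t).re) φ'.re t :=
  Complex.reCLM.hasFDerivAt.comp_hasDerivAt t h

theorem hasDerivAt_im {φ : ℝ → ℂ} {φ' : ℂ} {t : ℝ} (h : HasDerivAt φ φ' t) :
    HasDerivAt (fun t => (φ t).im) φ'.im t :=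
  Complex.imCLM.hasFDerivAt.comp_hasDerivAt t h

theorem hasDerivAt_Gf_re (h0 : 0 ≤ ε) (h1 : ε < 1) (y : ℝ) :
    HasDerivAt (fun y => (Gf ε y).re) (-((1 - ε) / 2 * (Kf ε y).im)) y :=
  (hasDerivAt_re (hasDerivAt_Gf h0 h1 y)).congr_deriv (by
    rw [show ((1 - ε : ℝ) : ℂ) * (Complex.I / 2) * Kf ε y =
      (((1 - ε) / 2 : ℝ) : ℂ) * (Complex.I * Kf ε y) by push_cast; ring, Complex.re_ofReal_mul]
    simp)

theorem hasDerivAt_Gf_im (h0 : 0 ≤ ε) (h1 : ε < 1) (y : ℝ) :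
    HasDerivAt (fun y => (Gf ε y).im) ((1 - ε) / 2 * (Kf ε y).re) y :=
  (hasDerivAt_im (hasDerivAt_Gf h0 h1 y)).congr_deriv (by
    rw [show ((1 - ε : ℝ) : ℂ) * (Complex.I / 2) * Kf ε y =
      (((1 - ε) / 2 : ℝ) : ℂ) * (Complex.I * Kf ε y) by push_cast; ring, Complex.im_ofReal_mul]
    simp)

theorem hasDerivAt_Jf_re (h0 : 0 ≤ ε) (h1 : ε < 1) (y : ℝ) :
    HasDerivAt (fun y => (Jf ε y).re) (ε / 2 * (Lf ε y).im) y :=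
  (hasDerivAt_re (hasDerivAt_Jf h0 h1 y)).congr_deriv (by
    rw [show ((-ε : ℝ) : ℂ) * (Complex.I / 2) * Lf ε y =
      ((-ε / 2 : ℝ) : ℂ) * (Complex.I * Lf ε y) by push_cast; ring, Complex.re_ofReal_mul]
    simp; ring)

theorem hasDerivAt_Jf_im (h0 : 0 ≤ ε) (h1 : ε < 1) (y : ℝ) :
    HasDerivAt (fun y => (Jf ε y).im) (-(ε / 2 * (Lf ε y).re)) y :=
  (hasDerivAt_im (hasDerivAt_Jf h0 h1 y)).congr_deriv (by
    rw [show ((-ε : ℝ) : ℂ) * (Complex.I / 2) * Lf ε y =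
      ((-ε / 2 : ℝ) : ℂ) * (Complex.I * Lf ε y) by push_cast; ring, Complex.im_ofReal_mul]
    simp; ring)

/-- Derivative of `uf`. -/
def uf' (ε y : ℝ) : ℝ :=
  (1 - ε) * ((Gf ε y).im * (Kf ε y).re - (Gf ε y).re * (Kf ε y).im)

/-- Derivative of `bf`. -/
def bf' (ε y : ℝ) : ℝ :=
  (1 - ε) / 2 * ((Kf ε y).re * (Jf ε y).re + (Kf ε y).im * (Jf ε y).im) +
    ε / 2 * ((Gf ε y).im * (Lf ε y).im + (Gf ε y).re * (Lf ε y).re)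

theorem hasDerivAt_uf (h0 : 0 ≤ ε) (h1 : ε < 1) (y : ℝ) : HasDerivAt (uf ε) (uf' ε y) y :=
  (((hasDerivAt_Gf_re h0 h1 y).pow 2).add ((hasDerivAt_Gf_im h0 h1 y).pow 2)).congr_deriv (by
    rw [uf']; push_cast; ring)

theorem hasDerivAt_bf (h0 : 0 ≤ ε) (h1 : ε < 1) (y : ℝ) : HasDerivAt (bf ε) (bf' ε y) y :=
  (((hasDerivAt_Gf_im h0 h1 y).mul (hasDerivAt_Jf_re h0 h1 y)).sub
    ((hasDerivAt_Gf_re h0 h1 y).mul (hasDerivAt_Jf_im h0 h1 y))).congr_deriv (by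
    rw [bf']; ring)

theorem hasDerivAt_vf (h0 : 0 ≤ ε) (h1 : ε < 1) (y : ℝ) :
    HasDerivAt (vf ε) (bf' ε y + ε * (uf ε y + y * uf' ε y)) y :=
  ((hasDerivAt_bf h0 h1 y).add
    (((hasDerivAt_id y).mul (hasDerivAt_uf h0 h1 y)).const_mul ε)).congr_deriv (by simp)

theorem hasDerivAt_Nf (h0 : 0 ≤ ε) (h1 : ε < 1) (y : ℝ) :
    HasDerivAt (Nf ε) (ε * ((Jf ε y).re * (Lf ε y).im - (Jf ε y).im * (Lf ε y).re) +
      ε ^ 2 * (2 * y * uf ε y + y ^ 2 * uf' ε y) + 2 * ε * (bf ε y + y * bf' ε y)) y :=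
  (((((hasDerivAt_Jf_re h0 h1 y).pow 2).add ((hasDerivAt_Jf_im h0 h1 y).pow 2)).add
    ((((hasDerivAt_id y).pow 2).mul (hasDerivAt_uf h0 h1 y)).const_mul (ε ^ 2))).add
    (((hasDerivAt_id y).mul (hasDerivAt_bf h0 h1 y)).const_mul (2 * ε))).congr_deriv (by
    simp; ring)

theorem continuous_uf (h0 : 0 ≤ ε) (h1 : ε < 1) : Continuous (uf ε) :=
  continuous_iff_continuousAt.2 fun y => (hasDerivAt_uf h0 h1 y).continuousAt

theorem continuous_vf (h0 : 0 ≤ ε) (h1 : ε < 1) : Continuous (vf ε) :=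
  continuous_iff_continuousAt.2 fun y => (hasDerivAt_vf h0 h1 y).continuousAt

theorem continuous_Nf (h0 : 0 ≤ ε) (h1 : ε < 1) : Continuous (Nf ε) :=
  continuous_iff_continuousAt.2 fun y => (hasDerivAt_Nf h0 h1 y).continuousAt

theorem continuous_Gf (h0 : 0 ≤ ε) (h1 : ε < 1) : Continuous (Gf ε) :=
  continuous_iff_continuousAt.2 fun y => (hasDerivAt_Gf h0 h1 y).continuousAt

theorem continuous_Jf (h0 : 0 ≤ ε) (h1 : ε < 1) : Continuous (Jf ε) :=
  continuous_iff_continuousAt.2 fun y => (hasDerivAt_Jf h0 h1 y).continuousAt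

theorem uf'_nonneg (h0 : 0 ≤ ε) (h1 : ε < 1) (hy : 0 ≤ y) : 0 ≤ uf' ε y := by
  obtain ⟨a, b⟩ := Gf_re_im_nonneg h0 h1 hy
  obtain ⟨c, d⟩ := Kf_re_im h0 h1 hy
  have := mul_nonneg b c
  have := mul_nonpos_of_nonneg_of_nonpos a d
  rw [uf']
  exact mul_nonneg (by linarith) (by linarith)

/-- The comparison lemma with φ = ψ: a nonnegative derivative dominates its own absolute value. -/
theorem uf_mono (h0 : 0 ≤ ε) (h1 : ε < 1) (hy : 0 ≤ y) (hyy : y ≤ y') : uf ε y ≤ uf ε y' := by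
  have := abs_sub_le_of_abs_deriv_le (hasDerivAt_uf h0 h1) (hasDerivAt_uf h0 h1)
    (fun t ht _ => (abs_of_nonneg (uf'_nonneg h0 h1 ht)).le) hy hyy le_rfl
  linarith [(abs_nonneg _).trans this]

theorem abs_mul_sub_mul_le_norm (z w : ℂ) : |z.im * w.re - z.re * w.im| ≤ ‖z‖ * ‖w‖ := by
  have : z.im * w.re - z.re * w.im = (z * (starRingEnd ℂ) w).im := by simp; ring
  rw [this, ← RCLike.norm_conj w, ← norm_mul]
  exact Complex.abs_im_le_norm _

theorem abs_mul_add_mul_le_norm (z w : ℂ) : |z.re * w.re + z.im * w.im| ≤ ‖z‖ * ‖w‖ := by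
  have : z.re * w.re + z.im * w.im = (z * (starRingEnd ℂ) w).re := by simp
  rw [this, ← RCLike.norm_conj w, ← norm_mul]
  exact Complex.abs_re_le_norm _

theorem uf_le (h0 : 0 ≤ ε) (h1 : ε < 1) (hy : 0 ≤ y) : uf ε y ≤ 9 * (1 + y) ^ (2 - 2 * ε) := by
  have h := norm_Gf_le h0 h1 hy
  have e : (1 + y) ^ (2 - 2 * ε) = (1 + y) ^ (1 - ε) * (1 + y) ^ (1 - ε) := by
    rw [← Real.rpow_add (by linarith)]; ring_nf
  rw [uf_eq_norm, e]
  nlinarith [norm_nonneg (Gf ε y)]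

/-- The derivative pairs G, of size (1 + y)^(1-ε), with `Kf`, of size (1 + y)^(-ε), so multiplying
by y restores the growth of |G|² itself. -/
theorem mul_uf'_le (h0 : 0 ≤ ε) (h1 : ε < 1) (hy : 0 ≤ y) :
    y * uf' ε y ≤ 12 * (1 + y) ^ (2 - 2 * ε) := by
  have h := norm_Gf_le h0 h1 hy
  have h' := norm_Kf_le h0 h1 hy
  have e : (1 + y) ^ (2 - 2 * ε) = (1 + y) * ((1 + y) ^ (1 - ε) * (1 + y) ^ (-ε)) := by
    rw [← Real.rpow_add (by linarith), ← Real.rpow_one_add' (by linarith) (by linarith)]; ring_nf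
  have h3 : uf' ε y ≤ 12 * ((1 + y) ^ (1 - ε) * (1 + y) ^ (-ε)) := by
    rw [uf']
    have h4 := (le_abs_self _).trans (abs_mul_sub_mul_le_norm (Gf ε y) (Kf ε y))
    have h5 := mul_le_mul h h' (norm_nonneg _) (by positivity)
    have h6 : 0 ≤ ‖Gf ε y‖ * ‖Kf ε y‖ := by positivity
    calc _ ≤ (1 - ε) * (‖Gf ε y‖ * ‖Kf ε y‖) := mul_le_mul_of_nonneg_left h4 (by linarith)
      _ ≤ ‖Gf ε y‖ * ‖Kf ε y‖ := by nlinarith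
      _ ≤ _ := h5.trans_eq (by ring)
  rw [e]
  have h7 : 0 ≤ (1 + y) ^ (1 - ε) * (1 + y) ^ (-ε) := by positivity
  calc _ ≤ y * (12 * ((1 + y) ^ (1 - ε) * (1 + y) ^ (-ε))) := mul_le_mul_of_nonneg_left h3 hy
    _ ≤ _ := by nlinarith

/-- The logarithmic weight `1 + log (1 + y)`. -/
def ell (y : ℝ) : ℝ := 1 + Real.log (1 + y)

theorem one_le_ell (hy : 0 ≤ y) : 1 ≤ ell y := by
  have := Real.log_nonneg (by linarith : 1 ≤ 1 + y)
  rw [ell]; linarith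

theorem ell_mono (hy : 0 ≤ y) (hyy : y ≤ y') : ell y ≤ ell y' := by
  have := Real.log_le_log (by linarith : 0 < 1 + y) (by linarith : 1 + y ≤ 1 + y')
  rw [ell, ell]; linarith

theorem ell_le (hy : 0 ≤ y) : ell y ≤ 1 + y := by
  have := Real.log_le_sub_one_of_pos (by linarith : 0 < 1 + y)
  rw [ell]; linarith

theorem abs_half_Kf_re_sub_one_le (h0 : 0 ≤ ε) (h1 : ε < 1) (hy : 0 ≤ y) :
    |(1 - ε) / 2 * (Kf ε y).re - 1| ≤ 7 * ε * ell y := by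
  have h := (Complex.abs_re_le_norm _).trans (norm_Kf_sub_le h0 h1 hy)
  have hl := one_le_ell hy
  rw [← ell] at h
  simp only [Complex.sub_re, Complex.ofReal_re] at h
  -- Centring at the mean 2 - ε leaves (1-ε)(2-ε)/2 - 1 = ε²/2 - 3ε/2.
  have e : (1 - ε) / 2 * (Kf ε y).re - 1 =
      (1 - ε) / 2 * ((Kf ε y).re - (2 - ε)) + (ε ^ 2 / 2 - 3 * ε / 2) := by ring
  rw [e]
  refine (abs_add_le _ _).trans ?_
  rw [abs_mul, abs_of_nonneg (by linarith : 0 ≤ (1 - ε) / 2)]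
  have h2 : |ε ^ 2 / 2 - 3 * ε / 2| ≤ 2 * ε := by rw [abs_le]; constructor <;> nlinarith
  have h3 : (1 - ε) / 2 * |(Kf ε y).re - (2 - ε)| ≤ 1 / 2 * (10 * ε * ell y) :=
    mul_le_mul (by linarith) h (abs_nonneg _) (by norm_num)
  nlinarith

theorem abs_Gf_re_sub_one_le (h0 : 0 ≤ ε) (h1 : ε < 1) (hy : 0 ≤ y) :
    |(Gf ε y).re - 1| ≤ y := by
  have := abs_sub_le_of_abs_deriv_le (hasDerivAt_Gf_re h0 h1)
    (fun t => hasDerivAt_id t) (Y := y) (fun t ht _ => by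
      have := (Complex.abs_im_le_norm _).trans (norm_Kf_le_two (y := t) h0 h1)
      rw [abs_neg, abs_mul, abs_of_nonneg (by linarith : 0 ≤ (1 - ε) / 2)]
      have h2 : (1 - ε) / 2 * |(Kf ε t).im| ≤ 1 / 2 * 2 :=
        mul_le_mul (by linarith) this (abs_nonneg _) (by norm_num)
      linarith) le_rfl hy le_rfl
  simpa [Gf_zero h1] using this

theorem abs_Gf_im_sub_le (h0 : 0 ≤ ε) (h1 : ε < 1) (hy : 0 ≤ y) :
    |(Gf ε y).im - y| ≤ 7 * ε * ell y * y := by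
  have := abs_sub_le_of_abs_deriv_le (fun t => (hasDerivAt_Gf_im h0 h1 t).sub (hasDerivAt_id t))
    (fun t => (hasDerivAt_id t).const_mul (7 * ε * ell y)) (Y := y) (fun t ht hty => by
      refine (abs_half_Kf_re_sub_one_le h0 h1 ht).trans ?_
      rw [mul_one]
      exact mul_le_mul_of_nonneg_left (ell_mono ht hty) (by positivity)) le_rfl hy le_rfl
  simpa [Gf_zero h1] using this

/-- Perturbation of G = 1 + iy, for which |G|² has derivative 2y. The error must carry both a factor
ε and a factor y, with at most a logarithm beyond that, so that it can be integrated to a relative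
error of the increment. -/
theorem abs_uf'_sub_le (h0 : 0 ≤ ε) (h1 : ε < 1) (hy : 0 ≤ y) :
    |uf' ε y - 2 * y| ≤ 50 * ε * ell y * y := by
  have hl := one_le_ell hy
  have a1 := abs_half_Kf_re_sub_one_le h0 h1 hy
  have a2 := abs_Kf_im_le h0 h1 hy
  have a3 := abs_Gf_im_sub_le h0 h1 hy
  have a4 := abs_Gf_re_sub_one_le h0 h1 hy
  have a6 := (Complex.abs_re_le_norm _).trans (norm_Kf_le_two (y := y) h0 h1)
  set p := (1 - ε) / 2 * (Kf ε y).re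
  set q := (1 - ε) / 2 * (Kf ε y).im with hq
  have hq1 : |q| ≤ 2 * ε * y := by
    rw [hq, abs_mul, abs_of_nonneg (by linarith : 0 ≤ (1 - ε) / 2)]
    have : (1 - ε) / 2 * |(Kf ε y).im| ≤ 1 / 2 * (3 * ε * y) :=
      mul_le_mul (by linarith) a2 (abs_nonneg _) (by norm_num)
    nlinarith [mul_nonneg h0 hy]
  have hp1 : |p| ≤ 1 := by
    rw [abs_mul, abs_of_nonneg (by linarith : 0 ≤ (1 - ε) / 2)]
    have : (1 - ε) / 2 * |(Kf ε y).re| ≤ 1 / 2 * 2 :=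
      mul_le_mul (by linarith) a6 (abs_nonneg _) (by norm_num)
    linarith
  have e : uf' ε y - 2 * y = 2 * (p * ((Gf ε y).im - y) + (p - 1) * y
      - q * ((Gf ε y).re - 1) - q) := by rw [uf']; ring
  have b1 : |p * ((Gf ε y).im - y)| ≤ 7 * ε * ell y * y := by
    rw [abs_mul]; exact (mul_le_of_le_one_left (abs_nonneg _) hp1).trans a3
  have b2 : |(p - 1) * y| ≤ 7 * ε * ell y * y := by
    rw [abs_mul, abs_of_nonneg hy]; exact mul_le_mul_of_nonneg_right a1 hy
  -- Here Re G - 1 already supplies the factor y, so Im `Kf` is estimated by the logarithmic bound.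
  -- The linear bound `hq1` would give y² and is kept for the bare term q.
  have b3 : |q * ((Gf ε y).re - 1)| ≤ 5 * ε * ell y * y := by
    have a7 := (Complex.abs_im_le_norm _).trans (norm_Kf_sub_le h0 h1 hy)
    simp only [Complex.sub_im, Complex.ofReal_im, sub_zero] at a7
    rw [← ell] at a7
    rw [abs_mul]
    refine mul_le_mul ?_ a4 (abs_nonneg _) (by positivity)
    rw [hq, abs_mul, abs_of_nonneg (by linarith : 0 ≤ (1 - ε) / 2)]
    have : (1 - ε) / 2 * |(Kf ε y).im| ≤ 1 / 2 * (10 * ε * ell y) :=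
      mul_le_mul (by linarith) a7 (abs_nonneg _) (by norm_num)
    linarith
  have b4 : |q| ≤ 2 * ε * ell y * y := by nlinarith [mul_nonneg h0 hy]
  rw [e, abs_mul, abs_two]
  have : |p * ((Gf ε y).im - y) + (p - 1) * y - q * ((Gf ε y).re - 1) - q| ≤
      |p * ((Gf ε y).im - y)| + |(p - 1) * y| + |q * ((Gf ε y).re - 1)| + |q| := by
    refine (abs_sub _ _).trans (add_le_add_left ((abs_sub _ _).trans
      (add_le_add_left (abs_add_le _ _) _)) _)
  nlinarith [mul_nonneg (mul_nonneg h0 hy) (by linarith : 0 ≤ ell y)]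

/-- For ε = 0 the increment is exactly y'² - y². The relative error ε(1 + log(1 + y')) remains small
as long as log y' is small compared with 1/ε. -/
theorem abs_uf_sub_le (h0 : 0 ≤ ε) (h1 : ε < 1) (hy : 0 ≤ y) (hyy : y ≤ y') :
    |uf ε y' - uf ε y - (y' ^ 2 - y ^ 2)| ≤ 25 * ε * ell y' * (y' ^ 2 - y ^ 2) := by
  have := abs_sub_le_of_abs_deriv_le (Y := y')
    (fun t => (hasDerivAt_uf h0 h1 t).sub ((hasDerivAt_id t).pow 2))
    (fun t => ((hasDerivAt_id t).pow 2).const_mul (25 * ε * ell y')) (fun t ht hty => by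
      have h := abs_uf'_sub_le h0 h1 ht
      have h2 : 50 * ε * ell t * t ≤ 50 * ε * ell y' * t :=
        mul_le_mul_of_nonneg_right (mul_le_mul_of_nonneg_left (ell_mono ht hty) (by positivity)) ht
      simp only [id, Nat.cast_ofNat, mul_one]
      norm_num
      linarith) hy hyy le_rfl
  simp only [id, Pi.sub_apply, Pi.pow_apply] at this
  calc _ = |uf ε y' - y' ^ 2 - (uf ε y - y ^ 2)| := by ring_nf
    _ ≤ _ := this.trans_eq (by ring)

theorem abs_GL_le (h0 : 0 ≤ ε) (h1 : ε < 1) (hy : 0 ≤ y) :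
    |ε / 2 * ((Gf ε y).im * (Lf ε y).im + (Gf ε y).re * (Lf ε y).re)| ≤ 5 * ε := by
  have h := (abs_mul_add_mul_le_norm (Gf ε y) (Lf ε y)).trans
    (mul_le_mul (norm_Gf_le h0 h1 hy) (norm_Lf_le h0 h1 hy) (norm_nonneg _) (by positivity))
  have h2 : (1 + y) ^ (1 - ε) ≤ 1 + y := by
    conv_rhs => rw [← Real.rpow_one (1 + y)]
    exact Real.rpow_le_rpow_of_exponent_le (by linarith) (by linarith)
  have h3 : 3 * (1 + y) ^ (1 - ε) * (3 / (1 + y)) ≤ 9 := by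
    calc _ ≤ 3 * (1 + y) * (3 / (1 + y)) := by gcongr
      _ = 9 := by field_simp; norm_num
  rw [abs_mul, abs_of_nonneg (by linarith : 0 ≤ ε / 2), add_comm]
  nlinarith

theorem abs_bf'_le (h0 : 0 ≤ ε) (h1 : ε < 1) (hy : 0 ≤ y) : |bf' ε y| ≤ 6 := by
  have h2 := abs_GL_le h0 h1 hy
  have h3 := (abs_mul_add_mul_le_norm (Kf ε y) (Jf ε y)).trans
    (mul_le_mul (norm_Kf_le_two h0 h1) (norm_Jf_le h0 h1) (norm_nonneg _) (by norm_num))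
  rw [bf']
  refine (abs_add_le _ _).trans ?_
  rw [abs_mul, abs_of_nonneg (by linarith : 0 ≤ (1 - ε) / 2)]
  have h4 : (1 - ε) / 2 * |(Kf ε y).re * (Jf ε y).re + (Kf ε y).im * (Jf ε y).im| ≤ 1 / 2 * 2 :=
    mul_le_mul (by linarith) (by linarith) (abs_nonneg _) (by norm_num)
  linarith

theorem abs_bf'_sub_one_le (h0 : 0 ≤ ε) (h1 : ε < 1) (hy : 0 ≤ y) :
    |bf' ε y - 1| ≤ 20 * ε * ell y := by
  have hl := one_le_ell hy
  have h2 := abs_GL_le h0 h1 hy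
  have a1 := abs_half_Kf_re_sub_one_le h0 h1 hy
  have a2 := (Complex.abs_im_le_norm _).trans (norm_Kf_sub_le h0 h1 hy)
  have a3 := (Complex.abs_re_le_norm _).trans (norm_Jf_sub_one_le h0 h1 hy)
  have a4 := (Complex.abs_im_le_norm _).trans (norm_Jf_le (y := y) h0 h1)
  have a5 := (Complex.abs_re_le_norm _).trans (norm_Jf_le (y := y) h0 h1)
  simp only [Complex.sub_im, Complex.sub_re, Complex.ofReal_im, sub_zero, Complex.one_re] at a2 a3
  rw [← ell] at a2 a3
  have e : bf' ε y - 1 = ((1 - ε) / 2 * (Kf ε y).re - 1) * (Jf ε y).re + ((Jf ε y).re - 1) +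
      (1 - ε) / 2 * ((Kf ε y).im * (Jf ε y).im) +
      ε / 2 * ((Gf ε y).im * (Lf ε y).im + (Gf ε y).re * (Lf ε y).re) := by rw [bf']; ring
  have b1 : |((1 - ε) / 2 * (Kf ε y).re - 1) * (Jf ε y).re| ≤ 7 * ε * ell y := by
    rw [abs_mul]; exact (mul_le_of_le_one_right (abs_nonneg _) a5).trans a1
  have b2 : |(1 - ε) / 2 * ((Kf ε y).im * (Jf ε y).im)| ≤ 5 * ε * ell y := by
    rw [abs_mul, abs_mul, abs_of_nonneg (by linarith : 0 ≤ (1 - ε) / 2)]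
    have := (mul_le_of_le_one_right (abs_nonneg _) a4).trans a2
    have : (1 - ε) / 2 * (|(Kf ε y).im| * |(Jf ε y).im|) ≤ 1 / 2 * (10 * ε * ell y) :=
      mul_le_mul (by linarith) this (by positivity) (by norm_num)
    linarith
  rw [e]
  have := abs_add_le (((1 - ε) / 2 * (Kf ε y).re - 1) * (Jf ε y).re + ((Jf ε y).re - 1) +
      (1 - ε) / 2 * ((Kf ε y).im * (Jf ε y).im))
      (ε / 2 * ((Gf ε y).im * (Lf ε y).im + (Gf ε y).re * (Lf ε y).re))
  have := abs_add_le (((1 - ε) / 2 * (Kf ε y).re - 1) * (Jf ε y).re + ((Jf ε y).re - 1))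
      ((1 - ε) / 2 * ((Kf ε y).im * (Jf ε y).im))
  have := abs_add_le (((1 - ε) / 2 * (Kf ε y).re - 1) * (Jf ε y).re) ((Jf ε y).re - 1)
  nlinarith

theorem abs_bf_le (h0 : 0 ≤ ε) (h1 : ε < 1) (hy : 0 ≤ y) : |bf ε y| ≤ 6 * y := by
  have := abs_sub_le_of_abs_deriv_le (hasDerivAt_bf h0 h1)
    (fun t => (hasDerivAt_id t).const_mul 6) (Y := y) (fun t ht _ => by
      simpa using abs_bf'_le h0 h1 ht) le_rfl hy le_rfl
  simpa [bf, Gf_zero h1, Jf_zero h1] using this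

theorem abs_uf_add_mul_uf'_le (h0 : 0 ≤ ε) (h1 : ε < 1) (hy : 0 ≤ y) :
    |ε * (uf ε y + y * uf' ε y)| ≤ 21 * ε * (1 + y) ^ (2 - 2 * ε) := by
  have h2 := uf_le h0 h1 hy
  have h3 := mul_uf'_le h0 h1 hy
  have h4 := mul_nonneg hy (uf'_nonneg h0 h1 hy)
  rw [abs_of_nonneg (mul_nonneg h0 (add_nonneg (uf_nonneg _ _) h4))]
  nlinarith

theorem one_add_rpow_le_sq (h0 : 0 ≤ ε) (hy : 0 ≤ y) : (1 + y) ^ (2 - 2 * ε) ≤ (1 + y) ^ 2 := by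
  rw [← Real.rpow_natCast]
  exact Real.rpow_le_rpow_of_exponent_le (by linarith) (by push_cast; linarith)

/-- The part of the derivative that grows like (1 + y)^(2-2ε) carries a factor ε. After momentum
integration this factor cancels the 1/ε of the infrared singularity, leaving a bound uniform in ε.
-/
theorem abs_vf_sub_le (h0 : 0 ≤ ε) (h1 : ε < 1) (hy : 0 ≤ y) (hyy : y ≤ y') :
    |vf ε y' - vf ε y| ≤ (6 + 21 * ε * (1 + y') ^ (2 - 2 * ε)) * (y' - y) := by
  have := abs_sub_le_of_abs_deriv_le (Y := y') (hasDerivAt_vf h0 h1)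
    (fun t => (hasDerivAt_id t).const_mul (6 + 21 * ε * (1 + y') ^ (2 - 2 * ε))) (fun t ht hty => by
      have h2 : 21 * ε * (1 + t) ^ (2 - 2 * ε) ≤ 21 * ε * (1 + y') ^ (2 - 2 * ε) :=
        mul_le_mul_of_nonneg_left
          (Real.rpow_le_rpow (by linarith) (by linarith) (by linarith)) (by linarith)
      rw [mul_one]
      exact (abs_add_le _ _).trans (add_le_add (abs_bf'_le h0 h1 ht)
        ((abs_uf_add_mul_uf'_le h0 h1 ht).trans h2))) hy hyy le_rfl
  simp only [id] at this
  linarith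

/-- For ε = 0 the function is y. The cruder growth (1 + y')² is affordable because this bound is
used only with weights that vanish at k = 0. -/
theorem abs_vf_sub_sub_le (h0 : 0 ≤ ε) (h1 : ε < 1) (hy : 0 ≤ y) (hyy : y ≤ y') :
    |vf ε y' - vf ε y - (y' - y)| ≤ 41 * ε * (1 + y') ^ 2 * (y' - y) := by
  have := abs_sub_le_of_abs_deriv_le (Y := y')
    (fun t => (hasDerivAt_vf h0 h1 t).sub (hasDerivAt_id t))
    (fun t => (hasDerivAt_id t).const_mul (41 * ε * (1 + y') ^ 2)) (fun t ht hty => by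
      have h2 : (1 + t) ^ 2 ≤ (1 + y') ^ 2 := by gcongr
      have h3 := one_add_rpow_le_sq h0 ht
      have h4 : ell t ≤ (1 + t) ^ 2 := by nlinarith [ell_le ht]
      have h5 := abs_bf'_sub_one_le h0 h1 ht
      have h6 := abs_uf_add_mul_uf'_le h0 h1 ht
      have h7 := abs_add_le (bf' ε t - 1) (ε * (uf ε t + t * uf' ε t))
      rw [mul_one, show bf' ε t + ε * (uf ε t + t * uf' ε t) - 1 =
        bf' ε t - 1 + ε * (uf ε t + t * uf' ε t) by ring]
      have h8 : 20 * ε * ell t ≤ 20 * ε * (1 + y') ^ 2 :=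
        mul_le_mul_of_nonneg_left (h4.trans h2) (by linarith)
      have h9 : 21 * ε * (1 + t) ^ (2 - 2 * ε) ≤ 21 * ε * (1 + y') ^ 2 :=
        mul_le_mul_of_nonneg_left (h3.trans h2) (by linarith)
      linarith) hy hyy le_rfl
  simp only [id, Pi.sub_apply] at this
  calc _ = |vf ε y' - y' - (vf ε y - y)| := by ring_nf
    _ ≤ _ := this.trans_eq (by ring)

/-- For ε = 0 the reduced momentum mode is the constant i, and every term of the derivative carries
a factor ε. The infrared singular part even carries ε², so a factor ε survives the momentum
integral. -/
theorem abs_Nf_sub_le (h0 : 0 ≤ ε) (h1 : ε < 1) (hy : 0 ≤ y) (hyy : y ≤ y') :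
    |Nf ε y' - Nf ε y| ≤ ε * (15 + 15 * ε * (1 + y') ^ (2 - 2 * ε)) * (y' ^ 2 - y ^ 2) := by
  have := abs_sub_le_of_abs_deriv_le (Y := y') (hasDerivAt_Nf h0 h1)
    (fun t => ((hasDerivAt_id t).pow 2).const_mul (ε * (15 + 15 * ε * (1 + y') ^ (2 - 2 * ε))))
    (fun t ht hty => by
      have h2 : (1 + t) ^ (2 - 2 * ε) ≤ (1 + y') ^ (2 - 2 * ε) :=
        Real.rpow_le_rpow (by linarith) (by linarith) (by linarith)
      have a1 : |(Jf ε t).re * (Lf ε t).im| ≤ 2 * t := by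
        rw [abs_mul]
        exact (mul_le_of_le_one_left (abs_nonneg _)
          ((Complex.abs_re_le_norm _).trans (norm_Jf_le h0 h1))).trans (abs_Lf_im_le h0 h1 ht)
      have a2 : |(Jf ε t).im * (Lf ε t).re| ≤ 3 * t := by
        have h3 : ‖Lf ε t‖ ≤ 3 := (norm_Lf_le h0 h1 ht).trans
          (div_le_self (by norm_num) (by linarith))
        rw [abs_mul]
        have := mul_le_mul (abs_Jf_im_le h0 h1 ht) ((Complex.abs_re_le_norm _).trans h3)
          (abs_nonneg _) (by positivity)
        nlinarith
      have a3 := abs_sub ((Jf ε t).re * (Lf ε t).im) ((Jf ε t).im * (Lf ε t).re)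
      have a4 : |ε * ((Jf ε t).re * (Lf ε t).im - (Jf ε t).im * (Lf ε t).re)| ≤ ε * (5 * t) := by
        rw [abs_mul, abs_of_nonneg h0]
        exact mul_le_mul_of_nonneg_left (by linarith) h0
      have a5 : |ε ^ 2 * (2 * t * uf ε t + t ^ 2 * uf' ε t)| ≤
          ε ^ 2 * (30 * t * (1 + y') ^ (2 - 2 * ε)) := by
        have b1 := uf_le h0 h1 ht
        have b2 := mul_uf'_le h0 h1 ht
        have b3 := mul_nonneg ht (uf'_nonneg h0 h1 ht)
        have b4 := uf_nonneg ε t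
        rw [abs_mul, abs_of_nonneg (by positivity : 0 ≤ ε ^ 2)]
        refine mul_le_mul_of_nonneg_left ?_ (by positivity)
        rw [show 2 * t * uf ε t + t ^ 2 * uf' ε t = t * (2 * uf ε t + t * uf' ε t) by ring,
          abs_of_nonneg (mul_nonneg ht (by linarith))]
        calc _ ≤ t * (30 * (1 + y') ^ (2 - 2 * ε)) := mul_le_mul_of_nonneg_left (by linarith) ht
          _ = _ := by ring
      have a6 : |2 * ε * (bf ε t + t * bf' ε t)| ≤ 2 * ε * (12 * t) := by
        rw [abs_mul, abs_of_nonneg (by positivity : 0 ≤ 2 * ε)]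
        refine mul_le_mul_of_nonneg_left ?_ (by positivity)
        refine (abs_add_le _ _).trans ?_
        rw [abs_mul, abs_of_nonneg ht]
        have := abs_bf_le h0 h1 ht
        have := mul_le_mul_of_nonneg_left (abs_bf'_le h0 h1 ht) ht
        linarith
      have a7 := abs_add_le (ε * ((Jf ε t).re * (Lf ε t).im - (Jf ε t).im * (Lf ε t).re) +
        ε ^ 2 * (2 * t * uf ε t + t ^ 2 * uf' ε t)) (2 * ε * (bf ε t + t * bf' ε t))
      have a8 := abs_add_le (ε * ((Jf ε t).re * (Lf ε t).im - (Jf ε t).im * (Lf ε t).re))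
        (ε ^ 2 * (2 * t * uf ε t + t ^ 2 * uf' ε t))
      simp only [id, Nat.cast_ofNat, mul_one]
      norm_num
      nlinarith [mul_nonneg h0 ht]) hy hyy le_rfl
  simp only [id, Pi.pow_apply] at this
  linarith

end bounds
end DeSitter
end

noncomputable section
namespace DeSitter

/-! ### The Bunch-Davies modes -/

/-- The normalisation Γ(ν + 1/2) = Γ(2 - ε) in Hankel's formula is that of the Gamma law of shape 2
- ε, so the integral is an expectation. -/
theorem hankel1_eq {ε x : ℝ} (h1 : ε < 1) : hankel1 (3 / 2 - ε) x =
    ((Real.sqrt (2 / (Real.pi * x)) : ℝ) : ℂ) *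
    Complex.exp (Complex.I * ((x - (3 / 2 - ε) * Real.pi / 2 - Real.pi / 4 : ℝ) : ℂ)) *
      Gf ε (1 / x) := by
  rw [hankel1, Gf, integral_gam (by linarith)]
  have e1 : 3 / 2 - ε + 1 / 2 = 2 - ε := by ring
  have e2 : 3 / 2 - ε - 1 / 2 = 1 - ε := by ring
  have e3 : 2 - ε - 1 = 1 - ε := by ring
  rw [e1, e2, e3, Complex.real_smul, Complex.ofReal_inv, div_eq_mul_inv, mul_assoc _ _ (∫ _ in _, _)]
  congr 2
  refine setIntegral_congr_fun measurableSet_Ioi fun u _ => ?_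
  simp only [Complex.real_smul, hbase]
  rw [show u * (1 / x) / 2 = u / (2 * x) by ring]

/-- Pointwise this is (h - 1) h^(-ε) = h^(1-ε) - h^(-ε), with h - 1 = iuy/2. -/
theorem half_mul_Kf {ε : ℝ} (h0 : 0 ≤ ε) (h1 : ε < 1) (y : ℝ) :
    (y : ℂ) * (Complex.I / 2) * Kf ε y =
      Gf ε y - ∫ u, hbase y u ^ ((-ε : ℝ) : ℂ) ∂(gam (2 - ε)) := by
  rw [Kf, Gf, ← integral_const_mul, ← integral_sub
    (integrable_hbase_cpow (by linarith) y (by linarith))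
    (integrable_hbase_cpow (by linarith) y (by linarith))]
  congr 1
  ext u
  have hne : hbase y u ≠ 0 := one_add_I_mul_ne_zero _
  have : hbase y u ^ ((1 - ε : ℝ) : ℂ) = hbase y u * hbase y u ^ ((-ε : ℝ) : ℂ) := by
    rw [show ((1 - ε : ℝ) : ℂ) = 1 + ((-ε : ℝ) : ℂ) by push_cast; ring, Complex.cpow_add _ _ hne,
      Complex.cpow_one]
  rw [this]
  have h : hbase y u = 1 + Complex.I * ((u * y / 2 : ℝ) : ℂ) := rfl
  rw [show hbase y u * hbase y u ^ ((-ε : ℝ) : ℂ) - hbase y u ^ ((-ε : ℝ) : ℂ) =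
    (hbase y u - 1) * hbase y u ^ ((-ε : ℝ) : ℂ) by ring]
  nth_rw 2 [h]
  push_cast
  ring

theorem hbase_comm (y u : ℝ) : hbase y u = hbase u y := by rw [hbase, hbase, mul_comm u y]

theorem integrableOn_gam {a : ℝ} (ha : 0 < a) {φ : ℝ → ℂ} (h : Integrable φ (gam a)) :
    IntegrableOn (fun u => ((Real.exp (-u) * u ^ (a - 1) : ℝ) : ℂ) * φ u) (Ioi 0) := by
  have := (integrable_gam_iff ha φ).1 h
  simpa only [Complex.real_smul] using this

theorem setIntegral_gam {a : ℝ} (ha : 0 < a) (φ : ℝ → ℂ) :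
    ∫ u in Ioi (0 : ℝ), ((Real.exp (-u) * u ^ (a - 1) : ℝ) : ℂ) * φ u =
      (Real.Gamma a : ℂ) * ∫ u, φ u ∂(gam a) := by
  have hG : (Real.Gamma a : ℂ) ≠ 0 := Complex.ofReal_ne_zero.2 (Real.Gamma_pos_of_pos ha).ne'
  rw [integral_gam ha, Complex.real_smul, Complex.ofReal_inv, mul_inv_cancel_left₀ hG]
  simp only [Complex.real_smul]

theorem integral_neg_add_add {μ : Measure ℝ} {f₁ f₂ f₃ : ℝ → ℂ} (h₁ : Integrable f₁ μ)
    (h₂ : Integrable f₂ μ) (h₃ : Integrable f₃ μ) (c d : ℂ) :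
    Integrable (fun u => -f₁ u + c * f₂ u + d * f₃ u) μ ∧
    ∫ u, (-f₁ u + c * f₂ u + d * f₃ u) ∂μ =
      -∫ u, f₁ u ∂μ + c * ∫ u, f₂ u ∂μ + d * ∫ u, f₃ u ∂μ := by
  have h12 : Integrable (fun u => -f₁ u + c * f₂ u) μ := h₁.neg.add (h₂.const_mul c)
  refine ⟨h12.add (h₃.const_mul d), ?_⟩
  have e := integral_add h₁.neg (h₂.const_mul c)
  simp only [Pi.neg_apply] at e
  rw [integral_add h12 (h₃.const_mul d), e, integral_neg, integral_const_mul, integral_const_mul]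

/-- Integration by parts of the derivative of e^(-u) u^(1-ε) h^(1-ε) over (0, ∞), whose boundary
values vanish, followed by Γ(2-ε) = (1-ε) Γ(1-ε). It plays the part of the recurrence between Hankel
functions of index ν and ν - 1. -/
theorem Gf_eq_Jf_add {ε : ℝ} (h0 : 0 ≤ ε) (h1 : ε < 1) (y : ℝ) : Gf ε y = Jf ε y +
    Complex.I * y * (1 - ε) * ∫ u, hbase y u ^ ((-ε : ℝ) : ℂ) ∂(gam (2 - ε)) := by
  have i1 := integrable_hbase_cpow (a := 2 - ε) (by linarith) y (s := 1 - ε) (by linarith)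
  have i2 := integrable_hbase_cpow (a := 2 - ε) (by linarith) y (s := -ε) (by linarith)
  have i3 := integrable_hbase_cpow (a := 1 - ε) (by linarith) y (s := -ε) (by linarith)
  have j1 := integrableOn_gam (by linarith) i1
  have j2 := integrableOn_gam (by linarith) i2
  have j3 := integrableOn_gam (by linarith) i3
  have k1 := setIntegral_gam (a := 2 - ε) (by linarith) fun u => hbase y u ^ ((1 - ε : ℝ) : ℂ)
  have k2 := setIntegral_gam (a := 2 - ε) (by linarith) fun u => hbase y u ^ ((-ε : ℝ) : ℂ)
  have k3 := setIntegral_gam (a := 1 - ε) (by linarith) fun u => hbase y u ^ ((-ε : ℝ) : ℂ)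
  set M0 := ∫ u, hbase y u ^ ((-ε : ℝ) : ℂ) ∂(gam (2 - ε))
  have e2 : 2 - ε - 1 = 1 - ε := by ring
  have e3 : 1 - ε - 1 = -ε := by ring
  rw [e2] at j1 j2 k1 k2
  rw [e3] at j3 k3
  obtain ⟨hint, hval⟩ := integral_neg_add_add j1 j3 j2 ((1 - ε : ℝ) : ℂ)
    (((1 - ε : ℝ) : ℂ) * (Complex.I * y))
  have hderiv : ∀ u ∈ Ioi (0 : ℝ), HasDerivAt
      (fun u : ℝ => ((Real.exp (-u) * u ^ (1 - ε) : ℝ) : ℂ) * hbase y u ^ ((1 - ε : ℝ) : ℂ))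
      ((-(((Real.exp (-u) * u ^ (1 - ε) : ℝ) : ℂ) * hbase y u ^ ((1 - ε : ℝ) : ℂ)) +
        ((1 - ε : ℝ) : ℂ) * (((Real.exp (-u) * u ^ (-ε) : ℝ) : ℂ) * hbase y u ^ ((-ε : ℝ) : ℂ))) +
        ((1 - ε : ℝ) : ℂ) * (Complex.I * y) *
          (((Real.exp (-u) * u ^ (1 - ε) : ℝ) : ℂ) * hbase y u ^ ((-ε : ℝ) : ℂ))) u := by
    intro u hu
    have d1 : HasDerivAt (fun u : ℝ => Real.exp (-u) * u ^ (1 - ε))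
        (-(Real.exp (-u) * u ^ (1 - ε)) + Real.exp (-u) * ((1 - ε) * u ^ (-ε))) u := by
      refine (((hasDerivAt_neg u).exp).mul
        (Real.hasDerivAt_rpow_const (p := 1 - ε) (Or.inl hu.ne'))).congr_deriv ?_
      rw [e3]; ring
    -- The base is symmetric in y and u, so the derivative formula in y also gives the derivative in
    -- u.
    have d2 := hasDerivAt_hbase_cpow (1 - ε) u y
    simp only [hbase_comm _ y] at d2
    rw [e3] at d2
    refine (d1.ofReal_comp.mul d2).congr_deriv ?_
    have hne : hbase y u ≠ 0 := one_add_I_mul_ne_zero _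
    have h2 : hbase y u ^ ((1 - ε : ℝ) : ℂ) = hbase y u * hbase y u ^ ((-ε : ℝ) : ℂ) := by
      rw [show ((1 - ε : ℝ) : ℂ) = 1 + ((-ε : ℝ) : ℂ) by push_cast; ring, Complex.cpow_add _ _ hne,
        Complex.cpow_one]
    have h3 : u ^ (1 - ε) = u * u ^ (-ε) := by
      rw [show 1 - ε = 1 + -ε by ring, Real.rpow_add hu, Real.rpow_one]
    have h : hbase y u = 1 + Complex.I * ((u * y / 2 : ℝ) : ℂ) := rfl
    rw [h2, h3]
    generalize hbase y u ^ ((-ε : ℝ) : ℂ) = C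
    rw [h]
    push_cast
    ring
  have hF0 : ((Real.exp (-0) * (0 : ℝ) ^ (1 - ε) : ℝ) : ℂ) * hbase y 0 ^ ((1 - ε : ℝ) : ℂ) = 0 := by
    rw [Real.zero_rpow (by linarith)]; simp
  have hcont : ContinuousWithinAt
      (fun u : ℝ => ((Real.exp (-u) * u ^ (1 - ε) : ℝ) : ℂ) * hbase y u ^ ((1 - ε : ℝ) : ℂ))
      (Ici 0) 0 := by
    refine Continuous.continuousWithinAt (Continuous.mul ?_ (continuous_hbase_cpow _ _))
    exact Complex.continuous_ofReal.comp ((by fun_prop : Continuous fun u : ℝ => Real.exp (-u)).mul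
      (Real.continuous_rpow_const (by linarith)))
  have htend : Tendsto
      (fun u : ℝ => ((Real.exp (-u) * u ^ (1 - ε) : ℝ) : ℂ) * hbase y u ^ ((1 - ε : ℝ) : ℂ))
      atTop (𝓝 0) := by
    have t1 := tendsto_rpow_mul_exp_neg_mul_atTop_nhds_zero (1 - ε) 1 one_pos
    have t2 := tendsto_rpow_mul_exp_neg_mul_atTop_nhds_zero (2 - ε) 1 one_pos
    have t3 := t1.add (t2.mul_const |y|)
    rw [zero_mul, add_zero] at t3
    refine squeeze_zero_norm' ?_ t3
    filter_upwards [eventually_gt_atTop (0 : ℝ)] with u hu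
    rw [norm_mul, Complex.norm_real, Real.norm_of_nonneg (by positivity)]
    have h3 : u ^ (2 - ε) = u * u ^ (1 - ε) := by
      rw [show 2 - ε = 1 + (1 - ε) by ring, Real.rpow_add hu, Real.rpow_one]
    rw [h3]
    have h4 := norm_hbase_cpow_le y u (s := 1 - ε) (by linarith)
    rw [abs_of_pos hu] at h4
    calc _ ≤ Real.exp (-u) * u ^ (1 - ε) * (1 + u * |y|) :=
          mul_le_mul_of_nonneg_left h4 (by positivity)
      _ = _ := by simp only [neg_mul, one_mul]; ring
  have key := integral_Ioi_of_hasDerivAt_of_tendsto hcont hderiv hint htend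
  rw [hF0, sub_zero] at key
  rw [hval, k1, k2, k3] at key
  have hGam : Real.Gamma (2 - ε) = (1 - ε) * Real.Gamma (1 - ε) := by
    rw [show 2 - ε = (1 - ε) + 1 by ring, Real.Gamma_add_one (by linarith)]
  rw [hGam] at key
  have hG : (Real.Gamma (1 - ε) : ℂ) ≠ 0 :=
    Complex.ofReal_ne_zero.2 (Real.Gamma_pos_of_pos (by linarith)).ne'
  have hne : ((1 - ε : ℝ) : ℂ) ≠ 0 := Complex.ofReal_ne_zero.2 (by linarith)
  have hG' : Gf ε y = ∫ u, hbase y u ^ ((1 - ε : ℝ) : ℂ) ∂(gam (2 - ε)) := rfl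
  have hJ' : Jf ε y = ∫ u, hbase y u ^ ((-ε : ℝ) : ℂ) ∂(gam (1 - ε)) := rfl
  rw [← hG', ← hJ'] at key
  refine mul_left_cancel₀ (mul_ne_zero hne hG) ?_
  push_cast at key ⊢
  linear_combination -key

/-- The right side is what differentiating the mode in η produces. The terms of growing order in y
cancel in it: for G = 1 + iy it equals i. The form iJ + εyG makes this cancellation manifest. -/
theorem Nt_eq {ε : ℝ} (h0 : 0 ≤ ε) (h1 : ε < 1) (y : ℝ) : Nt ε y = y * Gf ε y + Complex.I * Gf ε y -
    y ^ 2 * (((1 - ε : ℝ) : ℂ) * (Complex.I / 2) * Kf ε y) := by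
  have h2 := half_mul_Kf h0 h1 y
  have h3 := Gf_eq_Jf_add h0 h1 y
  rw [Nt]
  push_cast
  linear_combination Complex.I * (-h3) + (y : ℂ) * (1 - ε) * h2 -
    (y : ℂ) * (1 - ε) * (∫ u, hbase y u ^ ((-ε : ℝ) : ℂ) ∂(gam (2 - ε))) * Complex.I_sq

/-- The common phase of the modes at `η₀`. -/
def modePhase (ε H k : ℝ) : ℂ :=
  Complex.exp (Complex.I * ((k / H - (3 / 2 - ε) * Real.pi / 2 - Real.pi / 4 : ℝ) : ℂ))

theorem norm_modePhase (ε H k : ℝ) : ‖modePhase ε H k‖ = 1 := by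
  rw [modePhase, mul_comm, Complex.norm_exp_ofReal_mul_I]

theorem sqrt_mul_sqrt_mode {H k η : ℝ} (hH : 0 < H) (hk : 0 < k) (hη : η < 0) :
    Real.sqrt (-Real.pi * η / (4 * scaleFactor H η ^ 2)) * Real.sqrt (2 / (Real.pi * (-k * η))) =
      -H * η / Real.sqrt (2 * k) := by
  have hp := Real.pi_pos
  rw [← Real.sqrt_mul' _ (div_nonneg zero_le_two (mul_nonneg hp.le (by nlinarith)))]
  have e : -Real.pi * η / (4 * scaleFactor H η ^ 2) * (2 / (Real.pi * (-k * η))) =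
      (-H * η) ^ 2 / (2 * k) := by
    rw [scaleFactor]
    have := hη.ne
    field_simp
    norm_num
  rw [e, Real.sqrt_div (sq_nonneg _), Real.sqrt_sq (by nlinarith)]

theorem bdMode_eq {ε m H k η : ℝ} (h1 : ε < 1) (hν : bdIndex m H = 3 / 2 - ε) (hH : 0 < H)
    (hk : 0 < k) (hη : η < 0) : bdMode m H k η = ((-H / Real.sqrt (2 * k) : ℝ) : ℂ) * η *
    Complex.exp (Complex.I * ((-k * η - (3 / 2 - ε) * Real.pi / 2 - Real.pi / 4 : ℝ) : ℂ)) *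
      Gf ε (-1 / k * η⁻¹) := by
  rw [bdMode, hν, hankel1_eq h1, ← mul_assoc, ← mul_assoc, ← Complex.ofReal_mul,
    sqrt_mul_sqrt_mode hH hk hη]
  have : 1 / (-k * η) = -1 / k * η⁻¹ := by
    have := hη.ne
    field_simp
  rw [this]
  push_cast
  ring

theorem bdMode_eta0 {ε m H k : ℝ} (h1 : ε < 1) (hν : bdIndex m H = 3 / 2 - ε) (hH : 0 < H)
    (hk : 0 < k) : bdMode m H k (eta0 H) =
      modePhase ε H k * ((1 / Real.sqrt (2 * k) : ℝ) : ℂ) * Gf ε (H / k) := by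
  have hη : eta0 H < 0 := by rw [eta0]; exact div_neg_of_neg_of_pos (by norm_num) hH
  rw [bdMode_eq h1 hν hH hk hη, modePhase, eta0]
  have e1 : -1 / k * (-1 / H)⁻¹ = H / k := by field_simp
  have e2 : -k * (-1 / H) = k / H := by ring
  have e3 : ((-H / Real.sqrt (2 * k) : ℝ) : ℂ) * ((-1 / H : ℝ) : ℂ) =
    ((1 / Real.sqrt (2 * k) : ℝ) : ℂ) := by
    rw [← Complex.ofReal_mul]
    congr 1
    field_simp
  rw [e1, e2, e3]
  ring

theorem bdMomentumMode_eq {ε m H k : ℝ} (h0 : 0 ≤ ε) (h1 : ε < 1) (hν : bdIndex m H = 3 / 2 - ε)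
    (hH : 0 < H) (hk : 0 < k) : bdMomentumMode m H k =
      -(modePhase ε H k * ((k / Real.sqrt (2 * k) : ℝ) : ℂ) * Nt ε (H / k)) := by
  have hη : eta0 H < 0 := by rw [eta0]; exact div_neg_of_neg_of_pos (by norm_num) hH
  have hs : scaleFactor H (eta0 H) = 1 := by rw [scaleFactor, eta0]; field_simp
  -- The closed form of the mode holds for η < 0 only, hence near η₀, which is enough for the
  -- derivative.
  have hev : bdMode m H k =ᶠ[𝓝 (eta0 H)] fun η => ((-H / Real.sqrt (2 * k) : ℝ) : ℂ) * η *
    Complex.exp (Complex.I * ((-k * η - (3 / 2 - ε) * Real.pi / 2 - Real.pi / 4 : ℝ) : ℂ)) *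
      Gf ε (-1 / k * η⁻¹) := by
    filter_upwards [eventually_lt_nhds hη] with η h using bdMode_eq h1 hν hH hk h
  have e1 : -1 / k * (eta0 H)⁻¹ = H / k := by rw [eta0]; field_simp
  have e2 : -k * eta0 H = k / H := by rw [eta0]; ring
  have d1 : HasDerivAt (fun η : ℝ => ((-H / Real.sqrt (2 * k) : ℝ) : ℂ) * η)
      ((-H / Real.sqrt (2 * k) : ℝ) : ℂ) (eta0 H) :=
    ((hasDerivAt_id (eta0 H)).ofReal_comp.const_mul _).congr_deriv (by simp)
  have d2 : HasDerivAt (fun η : ℝ => Complex.exp (Complex.I *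
      ((-k * η - (3 / 2 - ε) * Real.pi / 2 - Real.pi / 4 : ℝ) : ℂ)))
      (modePhase ε H k * (Complex.I * ((-k : ℝ) : ℂ))) (eta0 H) := by
    have : HasDerivAt (fun η : ℝ => -k * η - (3 / 2 - ε) * Real.pi / 2 - Real.pi / 4) (-k)
        (eta0 H) := by
      refine HasDerivAt.sub_const _ (HasDerivAt.sub_const _ ?_)
      exact ((hasDerivAt_id _).const_mul (-k)).congr_deriv (by simp)
    refine ((this.ofReal_comp.const_mul Complex.I).cexp).congr_deriv ?_
    rw [e2, modePhase]
  have d3 : HasDerivAt (fun η : ℝ => Gf ε (-1 / k * η⁻¹))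
      (((H ^ 2 / k : ℝ) : ℂ) * (((1 - ε : ℝ) : ℂ) * (Complex.I / 2) * Kf ε (H / k))) (eta0 H) := by
    have hd : HasDerivAt (fun η : ℝ => -1 / k * η⁻¹) (H ^ 2 / k) (eta0 H) :=
      ((hasDerivAt_inv hη.ne).const_mul (-1 / k)).congr_deriv (by rw [eta0]; field_simp)
    have hG := hasDerivAt_Gf h0 h1 (H / k)
    rw [← e1] at hG
    have h := HasDerivAt.scomp (eta0 H) hG hd
    rw [e1, Complex.real_smul] at h
    exact h
  have d := (d1.mul d2).mul d3
  rw [bdMomentumMode, hs, hev.deriv_eq]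
  have hd := d.deriv
  erw [hd]
  simp only [Pi.mul_apply]
  rw [e1, e2, Nt_eq h0 h1]
  rw [show Complex.exp (Complex.I * ((k / H - (3 / 2 - ε) * Real.pi / 2 - Real.pi / 4 : ℝ) : ℂ)) =
    modePhase ε H k from rfl]
  have hsq : (Real.sqrt (2 * k) : ℂ) ≠ 0 := Complex.ofReal_ne_zero.2 (by positivity)
  have hkC : (k : ℂ) ≠ 0 := Complex.ofReal_ne_zero.2 hk.ne'
  have hHC : (H : ℂ) ≠ 0 := Complex.ofReal_ne_zero.2 hH.ne'
  rw [eta0]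
  push_cast
  field_simp
  ring

/-- The pointwise covariance kernel of the Bunch-Davies vacuum. -/
theorem bdAmp_mul_conj {ε m H : ℝ} (h0 : 0 ≤ ε) (h1 : ε < 1) (hν : bdIndex m H = 3 / 2 - ε)
    (hH : 0 < H) (γ γ' : PhaseSpace) {k : Space} (hk : k ≠ 0) :
    2 * (bdAmp m H γ k * (starRingEnd ℂ) (bdAmp m H γ' k)).re =
      (ft γ.2 k * (starRingEnd ℂ) (ft γ'.2 k)).re * (uf ε (H / ‖k‖) / ‖k‖) +
      (ft γ.1 k * (starRingEnd ℂ) (ft γ'.1 k)).re * (Nf ε (H / ‖k‖) * ‖k‖) +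
      ((ft γ.2 k * (starRingEnd ℂ) (ft γ'.1 k) *
        (Gf ε (H / ‖k‖) * (starRingEnd ℂ) (Nt ε (H / ‖k‖)))).re +
       (ft γ.1 k * (starRingEnd ℂ) (ft γ'.2 k) *
        (Nt ε (H / ‖k‖) * (starRingEnd ℂ) (Gf ε (H / ‖k‖)))).re) := by
  have hk' : 0 < ‖k‖ := norm_pos_iff.2 hk
  rw [bdAmp, bdAmp, bdMode_eta0 h1 hν hH hk', bdMomentumMode_eq h0 h1 hν hH hk', uf_eq_norm,
    Nf_eq_norm]
  have hp : modePhase ε H ‖k‖ * (starRingEnd ℂ) (modePhase ε H ‖k‖) = 1 := by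
    rw [Complex.mul_conj, Complex.normSq_eq_norm_sq, norm_modePhase]; simp
  have hG : ((‖Gf ε (H / ‖k‖)‖ ^ 2 : ℝ) : ℂ) =
      Gf ε (H / ‖k‖) * (starRingEnd ℂ) (Gf ε (H / ‖k‖)) := by
    rw [Complex.mul_conj, Complex.normSq_eq_norm_sq]
  have hN : ((‖Nt ε (H / ‖k‖)‖ ^ 2 : ℝ) : ℂ) =
      Nt ε (H / ‖k‖) * (starRingEnd ℂ) (Nt ε (H / ‖k‖)) := by
    rw [Complex.mul_conj, Complex.normSq_eq_norm_sq]
  have hG' : ((‖Gf ε (H / ‖k‖)‖ ^ 2 / ‖k‖ : ℝ) : ℂ) =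
      Gf ε (H / ‖k‖) * (starRingEnd ℂ) (Gf ε (H / ‖k‖)) / ((‖k‖ : ℝ) : ℂ) := by
    rw [Complex.ofReal_div, hG]
  have hN' : ((‖Nt ε (H / ‖k‖)‖ ^ 2 * ‖k‖ : ℝ) : ℂ) =
      Nt ε (H / ‖k‖) * (starRingEnd ℂ) (Nt ε (H / ‖k‖)) * ((‖k‖ : ℝ) : ℂ) := by
    rw [Complex.ofReal_mul, hN]
  have hs : ((1 / Real.sqrt (2 * ‖k‖) : ℝ) : ℂ) * ((1 / Real.sqrt (2 * ‖k‖) : ℝ) : ℂ) =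
      1 / (2 * ((‖k‖ : ℝ) : ℂ)) := by
    rw [← Complex.ofReal_mul, div_mul_div_comm, Real.mul_self_sqrt (by positivity)]
    push_cast; ring
  have hkC : ((‖k‖ : ℝ) : ℂ) ≠ 0 := Complex.ofReal_ne_zero.2 hk'.ne'
  have r1 : ∀ (z : ℂ) (a : ℝ), z.re * a = (z * (a : ℂ)).re := fun z a => by
    rw [mul_comm z, Complex.re_ofReal_mul, mul_comm]
  rw [r1, r1, ← Complex.add_re, ← Complex.add_re, ← Complex.add_re,
    show (2 : ℝ) = ((2 : ℝ) : ℝ) from rfl, ← Complex.re_ofReal_mul]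
  congr 1
  rw [hG', hN', show ‖k‖ / Real.sqrt (2 * ‖k‖) = ‖k‖ * (1 / Real.sqrt (2 * ‖k‖)) by ring, Complex.ofReal_mul]
  simp only [map_sub, map_mul, map_neg, Complex.conj_ofReal]
  generalize ((1 / Real.sqrt (2 * ‖k‖) : ℝ) : ℂ) = q at hs ⊢
  generalize modePhase ε H ‖k‖ = p at hp ⊢
  generalize (starRingEnd ℂ) p = p' at hp ⊢
  generalize ((‖k‖ : ℝ) : ℂ) = κ at hs hkC ⊢
  generalize Gf ε (H / ‖k‖) = G
  generalize Nt ε (H / ‖k‖) = N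
  generalize (starRingEnd ℂ) G = G'
  generalize (starRingEnd ℂ) N = N'
  generalize ft γ.2 k = a
  generalize ft γ.1 k = b
  generalize (starRingEnd ℂ) (ft γ'.2 k) = a'
  generalize (starRingEnd ℂ) (ft γ'.1 k) = b'
  -- With 2κq² = 1 and unit phase, the claim is a polynomial identity in the amplitudes.
  have hq2 : 2 * κ * (q * q) = 1 := by rw [hs]; field_simp
  field_simp
  push_cast
  linear_combination (2 * κ * q * q * (a * G + b * N * κ) * (a' * G' + b' * N' * κ)) * hp +
    (a * G + b * N * κ) * (a' * G' + b' * N' * κ) * hq2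

end DeSitter
end

noncomputable section
namespace DeSitter

/-! ### The Fourier transform of the smearing functions -/

open FourierTransform in
/-- On `L¹ ∩ L²` the Fourier integral represents the `L²` Fourier transform. -/
theorem fourier_toLp_ae_eq {φ : Space → ℂ} (h1 : Integrable φ) (h2 : MemLp φ 2) :
    ((𝓕 (h2.toLp φ) : Lp ℂ 2 (volume : Measure Space)) : Space → ℂ) =ᵐ[volume] 𝓕 φ := by
  have hcont : Continuous (𝓕 φ) := by
    simpa using! VectorFourier.fourierIntegral_continuous (L := innerₗ Space)
      Real.continuous_fourierChar continuous_inner h1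
  refine ae_eq_of_integral_contDiff_smul_eq
    ((Lp.memLp _).locallyIntegrable (by norm_num)) hcont.locallyIntegrable ?_
  intro g g_smooth g_cpt
  have hg₁ : HasCompactSupport (Complex.ofRealCLM ∘ g) := g_cpt.comp_left rfl
  have hg₂ : ContDiff ℝ ((⊤ : ℕ∞) : WithTop ℕ∞) (Complex.ofRealCLM ∘ g) := by fun_prop
  set G := hg₁.toSchwartzMap hg₂ with hG
  have hGa : ∀ x, G x = (g x : ℂ) := fun x => rfl
  -- As tempered distributions the L² transform pairs with a test function by moving the transform
  -- onto the test function. The Fourier integral of an L¹ function does the same by Fubini, so the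
  -- two agree against all smooth compactly supported functions.
  have e := congrArg (fun T => T G) (Lp.fourier_toTemperedDistribution_eq (h2.toLp φ))
  simp only [TemperedDistribution.fourier_apply, Lp.toTemperedDistribution_apply] at e
  have e1 : ∫ x, g x • (𝓕 (h2.toLp φ) : Lp ℂ 2 (volume : Measure Space)) x =
      ∫ x, G x • (𝓕 (h2.toLp φ) : Lp ℂ 2 (volume : Measure Space)) x := by
    refine integral_congr_ae (Eventually.of_forall fun x => ?_)
    simp only [hGa, Complex.real_smul, smul_eq_mul]
  have e2 : ∫ x, g x • 𝓕 φ x = ∫ x, G x • 𝓕 φ x := by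
    refine integral_congr_ae (Eventually.of_forall fun x => ?_)
    simp only [hGa, Complex.real_smul, smul_eq_mul]
  rw [e1, e2, ← e]
  have e3 : ∫ x, (𝓕 G) x • (h2.toLp φ) x = ∫ x, (𝓕 G) x • φ x := by
    refine integral_congr_ae ?_
    filter_upwards [h2.coeFn_toLp] with x hx
    rw [hx]
  rw [e3]
  simpa using! VectorFourier.integral_fourierIntegral_smul_eq_flip (L := innerₗ Space)
      Real.continuous_fourierChar continuous_inner G.integrable h1

/-- Complexification of a real function. -/
def cplx (h : Space → ℝ) : Space → ℂ := fun x => ((h x : ℝ) : ℂ)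

theorem integrable_of_memLp {h : Space → ℝ} (h2 : MemLp h 2) (hc : HasCompactSupport h) :
    Integrable h := by
  have hK : (volume (tsupport h)) ≠ ⊤ := hc.isCompact.measure_lt_top.ne
  have : IsFiniteMeasure (volume.restrict (tsupport h)) := ⟨by simpa using hK.lt_top⟩
  have h3 : IntegrableOn h (tsupport h) :=
    (h2.restrict (tsupport h)).integrable (by norm_num)
  exact (integrableOn_iff_integrable_of_support_subset (subset_tsupport h)).1 h3

open FourierTransform in
-- The kernel e^{ik·x} is Mathlib's e^{-2πi ξ·x} at ξ = -k/(2π).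
theorem ft_eq_fourier (h : Space → ℝ) (k : Space) :
    ft h k = 𝓕 (cplx h) ((-(1 / (2 * Real.pi))) • k) := by
  rw [ft, Real.fourier_eq']
  congr 1
  ext x
  rw [cplx, smul_eq_mul, inner_smul_right, real_inner_comm k x]
  congr 2
  have : (Real.pi : ℂ) ≠ 0 := Complex.ofReal_ne_zero.2 Real.pi_ne_zero
  push_cast
  field_simp

open FourierTransform in
theorem continuous_ft {h : Space → ℝ} (hi : Integrable h) : Continuous (ft h) := by
  have hcont : Continuous (𝓕 (cplx h)) := by
    simpa using! VectorFourier.fourierIntegral_continuous (L := innerₗ Space)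
      Real.continuous_fourierChar continuous_inner (hi.ofReal : Integrable (cplx h))
  have : ft h = fun k => 𝓕 (cplx h) ((-(1 / (2 * Real.pi))) • k) := funext (ft_eq_fourier h)
  rw [this]
  exact hcont.comp (continuous_const_smul _)

open FourierTransform in
theorem integrable_normSq_ft {h : Space → ℝ} (hi : Integrable h) (h2 : MemLp h 2) :
    Integrable fun k => ‖ft h k‖ ^ 2 := by
  have h2' : MemLp (cplx h) 2 := h2.ofReal
  have hm : MemLp (𝓕 (cplx h)) 2 :=
    (memLp_congr_ae (fourier_toLp_ae_eq hi.ofReal h2')).1 (Lp.memLp _)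
  have h3 : Integrable fun k => ‖𝓕 (cplx h) k‖ ^ 2 := by
    simpa using hm.integrable_norm_pow (by norm_num)
  have h4 := h3.comp_smul (R := -(1 / (2 * Real.pi)))
    (neg_ne_zero.2 (one_div_ne_zero (by positivity)))
  simpa only [← ft_eq_fourier] using h4

open FourierTransform in
theorem ae_eq_zero_of_ft_eq_zero {h : Space → ℝ} (hi : Integrable h) (h2 : MemLp h 2)
    (h0 : ∀ k, ft h k = 0) : h =ᵐ[volume] 0 := by
  have h2' : MemLp (cplx h) 2 := h2.ofReal
  have hz : 𝓕 (cplx h) = 0 := by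
    ext k
    have := h0 ((-(2 * Real.pi)) • k)
    rw [ft_eq_fourier, smul_smul] at this
    rwa [show -(1 / (2 * Real.pi)) * -(2 * Real.pi) = 1 by field_simp, one_smul] at this
  have h3 := fourier_toLp_ae_eq (φ := cplx h) hi.ofReal h2'
  rw [hz] at h3
  have h4 : (𝓕 (h2'.toLp (cplx h)) : Lp ℂ 2 (volume : Measure Space)) = 0 := by
    rw [Lp.eq_zero_iff_ae_eq_zero]; exact h3
  have h5 : h2'.toLp (cplx h) = 0 := by
    rw [← norm_eq_zero, ← Lp.norm_fourier_eq, h4, norm_zero]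
  have h6 := h2'.coeFn_toLp
  rw [h5] at h6
  filter_upwards [h6, Lp.coeFn_zero ℂ 2 (volume : Measure Space)] with x hx hx0
  rw [hx0] at hx
  have : ((h x : ℝ) : ℂ) = 0 := by rw [← show cplx h x = ((h x : ℝ) : ℂ) from rfl, ← hx]; rfl
  simpa using this

/-- Reality of the smearing functions. It makes imaginary parts of cross spectra odd in k, so that
they drop out of integrals against radial kernels. -/
theorem ft_neg_arg (h : Space → ℝ) (k : Space) : ft h (-k) = (starRingEnd ℂ) (ft h k) := by
  rw [ft, ft, ← integral_conj]
  congr 1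
  ext x
  rw [map_mul, ← Complex.exp_conj]
  simp

theorem ft_neg (h : Space → ℝ) (k : Space) : ft (-h) k = -ft h k := by
  rw [ft, ft, ← integral_neg]
  congr 1
  ext x
  simp

theorem ft_zero_fun (k : Space) : ft 0 k = 0 := by simp [ft]

theorem ft_zero (h : Space → ℝ) : ft h 0 = ((∫ x, h x : ℝ) : ℂ) := by
  rw [ft, ← integral_complex_ofReal]
  simp

/-- The phase `e^{i k·d}`. -/
def phase (d k : Space) : ℂ := Complex.exp (Complex.I * ((inner ℝ k d : ℝ) : ℂ))

theorem ft_translate (d : Space) (h : Space → ℝ) (k : Space) :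
    ft (translate d h) k = phase d k * ft h k := by
  rw [ft, ft, ← integral_const_mul, ← integral_sub_right_eq_self
    (fun x => phase d k * (Complex.exp (Complex.I * ((inner ℝ k x : ℝ) : ℂ)) * ((h x : ℝ) : ℂ))) d]
  congr 1
  ext x
  rw [translate, phase, ← mul_assoc, ← Complex.exp_add]
  congr 2
  rw [inner_sub_right]
  push_cast
  ring

theorem phase_re (d k : Space) : (phase d k).re = Real.cos (inner ℝ k d) := by
  rw [phase, mul_comm, Complex.exp_ofReal_mul_I_re]

theorem phase_im (d k : Space) : (phase d k).im = Real.sin (inner ℝ k d) := by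
  rw [phase, mul_comm, Complex.exp_ofReal_mul_I_im]

/-! ### Weighted integrals in momentum space -/

theorem integrableOn_ball_rpow {p : ℝ} (hp : p < 3) :
    IntegrableOn (fun k : Space => ‖k‖ ^ (-p)) (Metric.ball 0 1) := by
  rw [integrableOn_fun_norm_addHaar volume (f := fun y => y ^ (-p))]
  have : IntegrableOn (fun y : ℝ => y ^ (2 - p)) (Ioo 0 1) :=
    (intervalIntegral.integrableOn_Ioo_rpow_iff one_pos).2 (by linarith)
  refine this.congr_fun (fun y hy => ?_) measurableSet_Ioo
  rw [show Module.finrank ℝ Space = 3 by simp]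
  simp only [smul_eq_mul]
  rw [← Real.rpow_natCast, ← Real.rpow_add hy.1]
  norm_num
  ring_nf

theorem setIntegral_ball_rpow {p : ℝ} (hp : p < 3) :
    ∫ k in Metric.ball (0 : Space) 1, ‖k‖ ^ (-p) =
      3 * volume.real (Metric.ball (0 : Space) 1) / (3 - p) := by
  have e : ∫ k in Metric.ball (0 : Space) 1, ‖k‖ ^ (-p) =
      ∫ k : Space, (Iio (1 : ℝ)).indicator (fun y => y ^ (-p)) ‖k‖ := by
    rw [← integral_indicator measurableSet_ball]
    congr 1
    ext k
    simp [indicator]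
  rw [e, integral_fun_norm_addHaar, show Module.finrank ℝ Space = 3 by simp]
  have e2 : ∫ y in Ioi (0 : ℝ), y ^ (3 - 1) • (Iio (1 : ℝ)).indicator (fun y => y ^ (-p)) y =
      ∫ y in Ioc (0 : ℝ) 1, y ^ (2 - p) := by
    rw [integral_Ioc_eq_integral_Ioo, ← integral_indicator measurableSet_Ioi,
      ← integral_indicator measurableSet_Ioo]
    congr 1
    ext y
    by_cases h0 : 0 < y
    · by_cases h1 : y < 1
      · simp only [indicator, mem_Ioi, h0, mem_Iio, h1, mem_Ioo, and_self, if_true, smul_eq_mul]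
        rw [← Real.rpow_natCast, ← Real.rpow_add h0]
        norm_num
        ring_nf
      · simp [indicator, h0, h1]
    · simp [indicator, h0]
  rw [e2, ← intervalIntegral.integral_of_le zero_le_one, integral_rpow (Or.inl (by linarith))]
  rw [Real.zero_rpow (by linarith), Real.one_rpow, show 2 - p + 1 = 3 - p by ring]
  simp only [nsmul_eq_mul, smul_eq_mul]
  push_cast
  ring

/-- Singular weights: a continuous integrable function may be divided by any power of `‖k‖` below
the third, with control of the integral as the exponent approaches three. -/
theorem exists_weight_bound {ψ : Space → ℝ} (hc : Continuous ψ) (hi : Integrable ψ)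
    (h0 : ∀ k, 0 ≤ ψ k) : ∃ C, 0 ≤ C ∧ ∀ p : ℝ, 0 ≤ p → p < 3 →
      Integrable (fun k => ψ k * ‖k‖ ^ (-p)) ∧ ∫ k, ψ k * ‖k‖ ^ (-p) ≤ C / (3 - p) := by
  obtain ⟨M, hM⟩ := (isCompact_closedBall (0 : Space) 1).exists_bound_of_continuousOn hc.continuousOn
  set V := volume.real (Metric.ball (0 : Space) 1) with hV
  have hV0 : 0 ≤ V := measureReal_nonneg
  have hM0 : 0 ≤ M := (norm_nonneg _).trans (hM 0 (Metric.mem_closedBall_self zero_le_one))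
  have hI0 : 0 ≤ ∫ k, ψ k := integral_nonneg h0
  -- The unit ball contributes 3MV/(3-p). Outside it the weight is at most 1, and 1 ≤ 3/(3-p) puts
  -- ∫ψ into the same form.
  refine ⟨3 * M * V + 3 * ∫ k, ψ k, by positivity, fun p hp0 hp3 => ?_⟩
  set B := Metric.ball (0 : Space) 1
  have hb := (integrableOn_ball_rpow hp3).const_mul M
  have hbi : Integrable (B.indicator fun k => M * ‖k‖ ^ (-p)) :=
    (integrable_indicator_iff measurableSet_ball).2 hb
  have hsum := hbi.add hi
  have hle : ∀ k, ψ k * ‖k‖ ^ (-p) ≤ (B.indicator fun k => M * ‖k‖ ^ (-p)) k + ψ k := by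
    intro k
    by_cases hk : k ∈ B
    · rw [indicator_of_mem hk]
      have h1 : ψ k ≤ M := (le_abs_self _).trans (hM k (Metric.ball_subset_closedBall hk))
      have h2 : 0 ≤ ‖k‖ ^ (-p) := by positivity
      nlinarith [h0 k]
    · rw [indicator_of_notMem hk, zero_add]
      have h1 : 1 ≤ ‖k‖ := by simpa [B] using hk
      exact mul_le_of_le_one_right (h0 k)
        (Real.rpow_le_one_of_one_le_of_nonpos h1 (by linarith))
  have hint : Integrable fun k => ψ k * ‖k‖ ^ (-p) := by
    refine hsum.mono' (hc.measurable.mul (measurable_norm.pow_const _)).aestronglyMeasurable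
      (Eventually.of_forall fun k => ?_)
    rw [Real.norm_of_nonneg (mul_nonneg (h0 k) (by positivity))]
    exact hle k
  refine ⟨hint, (integral_mono hint hsum hle).trans ?_⟩
  simp only [Pi.add_apply]
  rw [integral_add hbi hi, integral_indicator measurableSet_ball, integral_const_mul,
    setIntegral_ball_rpow hp3, ← hV, add_div]
  have h3p : 0 < 3 - p := by linarith
  refine add_le_add (le_of_eq (by ring)) ?_
  rw [le_div_iff₀ h3p]
  nlinarith

end DeSitter
end

noncomputable section
namespace DeSitter

/-! ### Symplectic eigenvalues of two identical modes -/

/-- The smaller root of `(α - λ)(β - λ) = ρ`. -/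
def lamMinus (α β ρ : ℝ) : ℝ := (α + β - Real.sqrt ((α - β) ^ 2 + 4 * ρ)) / 2

section

variable {α β ρ x : ℝ}

theorem abs_sub_le_sqrt (hρ : 0 ≤ ρ) : |α - β| ≤ Real.sqrt ((α - β) ^ 2 + 4 * ρ) := by
  rw [← Real.sqrt_sq_eq_abs]
  exact Real.sqrt_le_sqrt (by linarith)

theorem lamMinus_le_left (hρ : 0 ≤ ρ) : lamMinus α β ρ ≤ α := by
  have := abs_le.1 (abs_sub_le_sqrt (α := α) (β := β) hρ)
  rw [lamMinus]; linarith [this.1]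

theorem lamMinus_le_right (hρ : 0 ≤ ρ) : lamMinus α β ρ ≤ β := by
  have := abs_le.1 (abs_sub_le_sqrt (α := α) (β := β) hρ)
  rw [lamMinus]; linarith [this.2]

theorem lamMinus_mul (hρ : 0 ≤ ρ) :
    (α - lamMinus α β ρ) * (β - lamMinus α β ρ) = ρ := by
  have := Real.sq_sqrt (by positivity : 0 ≤ (α - β) ^ 2 + 4 * ρ)
  rw [lamMinus]
  linear_combination this / 4

/-- A point below both branches at which the characteristic polynomial (α - x)(β - x) - ρ is still
nonnegative cannot exceed the smaller root. This criterion replaces all estimates of the square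
root. -/
theorem le_lamMinus (hα : x ≤ α) (hβ : x ≤ β) (h : ρ ≤ (α - x) * (β - x)) :
    x ≤ lamMinus α β ρ := by
  have : Real.sqrt ((α - β) ^ 2 + 4 * ρ) ≤ α + β - 2 * x :=
    Real.sqrt_le_iff.2 ⟨by linarith, by nlinarith⟩
  rw [lamMinus]; linarith

theorem lt_lamMinus (hα : x ≤ α) (hβ : x < β) (h : ρ < (α - x) * (β - x)) :
    x < lamMinus α β ρ := by
  have : Real.sqrt ((α - β) ^ 2 + 4 * ρ) < α + β - 2 * x := by
    rw [Real.sqrt_lt' (by linarith)]; nlinarith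
  rw [lamMinus]; linarith

theorem lamMinus_zero : lamMinus α β 0 = min α β := by
  rw [lamMinus, mul_zero, add_zero, Real.sqrt_sq_eq_abs, min_def]
  split_ifs with h
  · rw [abs_of_nonpos (by linarith)]; ring
  · rw [abs_of_nonneg (by linarith)]; ring

variable {α' β' ρ' τ η C κ : ℝ}

/-- A fast increase of one of the two branches compensates the level repulsion. -/
theorem lamMinus_sub_le (hρ : 0 ≤ ρ) (hτ : 0 < τ) (hη : 0 ≤ η) (hC : 0 ≤ C)
    (hα : τ * η ≤ α' - α) (hβ : β ≤ β') (hρ' : ρ' - ρ ≤ C * η) :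
    lamMinus α β ρ - C / τ ≤ lamMinus α' β' ρ' := by
  have h1 := lamMinus_le_left (α := α) (β := β) hρ
  have h2 := lamMinus_le_right (α := α) (β := β) hρ
  have h3 := lamMinus_mul (α := α) (β := β) hρ
  set l := lamMinus α β ρ
  have h4 : 0 ≤ C / τ := by positivity
  have h5 : 0 ≤ τ * η := by positivity
  have h6 : τ * η * (C / τ) = C * η := by field_simp
  refine le_lamMinus (by linarith) (by linarith) ?_
  have h7 : (α - l + τ * η) * (β - l + C / τ) ≤ (α' - (l - C / τ)) * (β' - (l - C / τ)) :=
    mul_le_mul (by linarith) (by linarith) (by linarith) (by linarith)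
  nlinarith [mul_nonneg h5 (by linarith : 0 ≤ β - l), mul_nonneg h4 (by linarith : 0 ≤ α - l)]

/-- Far from the level crossing the lower branch increases strictly. -/
theorem lamMinus_lt (hρ : 0 ≤ ρ) (hη : 0 < η) (hκ : 0 < κ)
    (hα : α ≤ α') (hβ : κ * η ≤ β' - β) (hρ' : ρ' - ρ ≤ C * η) (hfar : C < κ * (α - β)) :
    lamMinus α β ρ < lamMinus α' β' ρ' := by
  have h1 := lamMinus_le_left (α := α) (β := β) hρ
  have h2 := lamMinus_le_right (α := α) (β := β) hρ
  have h3 := lamMinus_mul (α := α) (β := β) hρ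
  set l := lamMinus α β ρ
  have h5 : 0 < κ * η := by positivity
  refine lt_lamMinus (by linarith) (by linarith) ?_
  have h7 : (α - l) * (β - l + κ * η) ≤ (α' - l) * (β' - l) :=
    mul_le_mul (by linarith) (by linarith) (by linarith) (by linarith)
  have h8 : C < κ * (α - l) := hfar.trans_le (mul_le_mul_of_nonneg_left (by linarith) hκ.le)
  have h9 : C * η < κ * (α - l) * η := mul_lt_mul_of_pos_right h8 hη
  nlinarith

end

/-- The upper branch of the unperturbed partially transposed spectrum. -/
def alphaOf (Xn Qm Qn s t w : ℝ) : ℝ := Xn * Qn - s ^ 2 + t ^ 2 * Qm / Qn - 2 * t * w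

/-- The lower branch. -/
def betaOf (Xm Qm Qn s t : ℝ) : ℝ := Xm * Qm - s ^ 2 - t ^ 2 * Qm / Qn

/-- The coupling of the two branches. -/
def rhoOf (Xm Qm Qn t w : ℝ) : ℝ := (Xm * Qn - t ^ 2) * (w - t * Qm / Qn) ^ 2

/-- Both diagonal blocks coincide because the modes are translates. In sums and differences of the
two regions, partial transposition pairs the field sum with the momentum difference and conversely.
Algebraically it suffices that α + β = Δ̃ and αβ - ρ = det σ_AB. The terms in t are completed to
squares by dividing by q - q', which makes ρ a product of a Gram determinant and a square. -/
theorem nuTildeMinusSq_eq {σ : PhaseSpace → PhaseSpace → ℝ} {a b : Fin 2 → PhaseSpace}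
    {S S' q q' p p₁ p₂ : ℝ} (hA : covBlock σ a a = !![S, p; p, q])
    (hB : covBlock σ b b = !![S, p; p, q]) (hC : covBlock σ a b = !![S', p₁; p₂, q'])
    (hq : q - q' ≠ 0) : nuTildeMinusSq σ a b =
      lamMinus (alphaOf (S + S') (q + q') (q - q') ((p₁ - p₂) / 2) ((2 * p - p₁ - p₂) / 2)
          ((2 * p + p₁ + p₂) / 2))
        (betaOf (S - S') (q + q') (q - q') ((p₁ - p₂) / 2) ((2 * p - p₁ - p₂) / 2))
        (rhoOf (S - S') (q + q') (q - q') ((2 * p - p₁ - p₂) / 2) ((2 * p + p₁ + p₂) / 2)) := by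
  have hdet : (Matrix.fromBlocks !![S, p; p, q] !![S', p₁; p₂, q'] (!![S', p₁; p₂, q']).transpose
      !![S, p; p, q]).det = Matrix.det !![S, p, S', p₁; p, q, p₂, q'; S', p₂, S, p; p₁, q', p, q] := by
    rw [← Matrix.det_submatrix_equiv_self (finSumFinEquiv (m := 2) (n := 2)).symm]
    congr 1
    ext i j
    fin_cases i <;> fin_cases j <;> rfl
  rw [nuTildeMinusSq]
  simp only [hA, hB, hC, hdet, Matrix.det_fin_two_of]
  rw [lamMinus]
  have e1 : alphaOf (S + S') (q + q') (q - q') ((p₁ - p₂) / 2) ((2 * p - p₁ - p₂) / 2)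
          ((2 * p + p₁ + p₂) / 2) +
        betaOf (S - S') (q + q') (q - q') ((p₁ - p₂) / 2) ((2 * p - p₁ - p₂) / 2) =
      S * q - p * p + (S * q - p * p) - 2 * (S' * q' - p₁ * p₂) := by
    rw [alphaOf, betaOf]; ring
  have e2 : alphaOf (S + S') (q + q') (q - q') ((p₁ - p₂) / 2) ((2 * p - p₁ - p₂) / 2)
          ((2 * p + p₁ + p₂) / 2) *
        betaOf (S - S') (q + q') (q - q') ((p₁ - p₂) / 2) ((2 * p - p₁ - p₂) / 2) -
        rhoOf (S - S') (q + q') (q - q') ((2 * p - p₁ - p₂) / 2) ((2 * p + p₁ + p₂) / 2) =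
      Matrix.det !![S, p, S', p₁; p, q, p₂, q'; S', p₂, S, p; p₁, q', p, q] := by
    rw [alphaOf, betaOf, rhoOf]
    simp [Matrix.det_succ_row_zero, Fin.sum_univ_succ, Fin.succAbove]
    field_simp
    ring
  rw [← e1, ← e2]
  congr 3
  ring

end DeSitter
end

noncomputable section
namespace DeSitter

/-! ### Weighted mode integrals -/

/-- Uniform control of `ψ / ‖k‖^p` for all `p < 3`. -/
def WeightBound (ψ : Space → ℝ) (C : ℝ) : Prop :=
  0 ≤ C ∧ (∀ k, 0 ≤ ψ k) ∧ ∀ p : ℝ, 0 ≤ p → p < 3 →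
    Integrable (fun k => ψ k * ‖k‖ ^ (-p)) ∧ ∫ k, ψ k * ‖k‖ ^ (-p) ≤ C / (3 - p)

theorem ae_ne_zero : ∀ᵐ k : Space, k ≠ 0 := by simp [ae_iff, measure_singleton]

theorem WeightBound.integrable {ψ : Space → ℝ} {C : ℝ} (h : WeightBound ψ C) {F : Space → ℝ}
    (hF : Measurable F) {A B p q : ℝ} (hp : 0 ≤ p) (hp3 : p < 3) (hq : 0 ≤ q) (hq3 : q < 3)
    (hle : ∀ k : Space, k ≠ 0 → |F k| ≤ ψ k * (A * ‖k‖ ^ (-p) + B * ‖k‖ ^ (-q))) :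
    Integrable F := by
  obtain ⟨-, -, h⟩ := h
  have hs := ((h p hp hp3).1.const_mul A).add ((h q hq hq3).1.const_mul B)
  refine hs.mono' hF.aestronglyMeasurable ?_
  filter_upwards [ae_ne_zero] with k hk
  exact (hle k hk).trans_eq (by simp only [Pi.add_apply]; ring)

theorem WeightBound.abs_integral_le {ψ : Space → ℝ} {C : ℝ} (h : WeightBound ψ C) {F : Space → ℝ}
    {A B p q : ℝ} (hA : 0 ≤ A) (hB : 0 ≤ B) (hp : 0 ≤ p) (hp3 : p < 3) (hq : 0 ≤ q) (hq3 : q < 3)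
    (hle : ∀ k : Space, k ≠ 0 → |F k| ≤ ψ k * (A * ‖k‖ ^ (-p) + B * ‖k‖ ^ (-q))) :
    |∫ k, F k| ≤ A * (C / (3 - p)) + B * (C / (3 - q)) := by
  obtain ⟨-, -, h⟩ := h
  have h1 := (h p hp hp3).1.const_mul A
  have h2 := (h q hq hq3).1.const_mul B
  have : ‖∫ k, F k‖ ≤ ∫ k, (A * (ψ k * ‖k‖ ^ (-p)) + B * (ψ k * ‖k‖ ^ (-q))) := by
    refine norm_integral_le_of_norm_le (h1.add h2) ?_
    filter_upwards [ae_ne_zero] with k hk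
    exact (hle k hk).trans_eq (by ring)
  rw [integral_add h1 h2, integral_const_mul, integral_const_mul] at this
  exact this.trans (add_le_add (mul_le_mul_of_nonneg_left (h p hp hp3).2 hA)
    (mul_le_mul_of_nonneg_left (h q hq hq3).2 hB))

/-! ### Mode kernels as functions of the momentum κ, bounded by powers of κ above -3 -/

section pointwise

variable {ε κ H H' H₁ : ℝ}

/-- For κ ≤ 1 one has 1 + H/κ ≤ (1 + H)/κ, and for κ ≥ 1 it is at most 1 + H. -/
theorem one_add_div_rpow_le {e : ℝ} (he : 0 ≤ e) (he2 : e ≤ 2) (hκ : 0 < κ) (hH : 0 ≤ H) :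
    (1 + H / κ) ^ e ≤ (1 + H) ^ 2 * (1 + κ ^ (-e)) := by
  have h1 : (1 + H) ^ e ≤ (1 + H) ^ 2 := by
    rw [← Real.rpow_natCast]
    exact Real.rpow_le_rpow_of_exponent_le (by linarith) (by exact_mod_cast he2)
  have h2 : 0 ≤ κ ^ (-e) := by positivity
  rcases le_total κ 1 with h | h
  · have h3 : 1 + H / κ ≤ (1 + H) * κ⁻¹ := by
      have : 1 ≤ κ⁻¹ := (one_le_inv₀ hκ).2 h
      rw [div_eq_mul_inv]; linarith
    calc (1 + H / κ) ^ e ≤ ((1 + H) * κ⁻¹) ^ e := Real.rpow_le_rpow (by positivity) h3 he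
      _ = (1 + H) ^ e * κ ^ (-e) := by
          rw [Real.mul_rpow (by linarith) (by positivity), Real.inv_rpow hκ.le, Real.rpow_neg hκ.le]
      _ ≤ (1 + H) ^ 2 * (1 + κ ^ (-e)) := mul_le_mul h1 (by linarith) h2 (by positivity)
  · calc (1 + H / κ) ^ e ≤ (1 + H) ^ e :=
          Real.rpow_le_rpow (by positivity) (by linarith [div_le_self hH h]) he
      _ ≤ (1 + H) ^ 2 * (1 + κ ^ (-e)) := by nlinarith [sq_nonneg (1 + H)]

theorem rpow_neg_three_sub (hκ : 0 < κ) :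
    κ ^ (-(2 - 2 * ε)) * κ ^ (-1 : ℝ) = κ ^ (-(3 - 2 * ε)) := by
  rw [← Real.rpow_add hκ]; ring_nf

theorem one_add_div_rpow_le' (h1 : ε ≤ 1 / 4) (h0 : 0 ≤ ε) (hκ : 0 < κ) (hH : 0 ≤ H) (hHH : H ≤ H₁) :
    (1 + H / κ) ^ (2 - 2 * ε) ≤ (1 + H₁) ^ 2 * (1 + κ ^ (-(2 - 2 * ε))) :=
  (one_add_div_rpow_le (by linarith) (by linarith) hκ hH).trans
    (mul_le_mul_of_nonneg_right (by gcongr) (by positivity))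

theorem uf_div_le (h0 : 0 ≤ ε) (h1 : ε ≤ 1 / 4) (hκ : 0 < κ) (hH : 0 ≤ H) (hHH : H ≤ H₁) :
    uf ε (H / κ) / κ ≤ 9 * (1 + H₁) ^ 2 * (κ ^ (-1 : ℝ) + κ ^ (-(3 - 2 * ε))) := by
  have h := uf_le h0 (by linarith) (by positivity : 0 ≤ H / κ)
  have h2 := one_add_div_rpow_le' h1 h0 hκ hH hHH
  have h3 : 0 ≤ κ ^ (-1 : ℝ) := by positivity
  rw [div_eq_mul_inv, ← Real.rpow_neg_one, ← rpow_neg_three_sub hκ]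
  calc _ ≤ 9 * ((1 + H₁) ^ 2 * (1 + κ ^ (-(2 - 2 * ε)))) * κ ^ (-1 : ℝ) :=
        mul_le_mul_of_nonneg_right (by linarith) h3
    _ = _ := by ring

theorem uf_div_sub_le (h0 : 0 ≤ ε) (h1 : ε ≤ 1 / 4) (hκ : 0 < κ) (hH : 0 ≤ H) (hHH : H ≤ H') :
    |uf ε (H' / κ) / κ - uf ε (H / κ) / κ - (H' ^ 2 - H ^ 2) / κ ^ 3| ≤
      25 * ε * ell (H' / κ) * ((H' ^ 2 - H ^ 2) / κ ^ 3) := by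
  have hd : H / κ ≤ H' / κ := div_le_div_of_nonneg_right hHH hκ.le
  have h := abs_uf_sub_le h0 (by linarith) (by positivity : 0 ≤ H / κ) hd
  have e : uf ε (H' / κ) / κ - uf ε (H / κ) / κ - (H' ^ 2 - H ^ 2) / κ ^ 3 =
      (uf ε (H' / κ) - uf ε (H / κ) - ((H' / κ) ^ 2 - (H / κ) ^ 2)) * κ⁻¹ := by
    field_simp
  rw [e, abs_mul, abs_of_pos (inv_pos.2 hκ)]
  calc _ ≤ 25 * ε * ell (H' / κ) * ((H' / κ) ^ 2 - (H / κ) ^ 2) * κ⁻¹ :=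
        mul_le_mul_of_nonneg_right h (by positivity)
    _ = _ := by field_simp

/-- The prefactor κ² stands for a spectral weight of order k². It leaves room to replace the
logarithm by 1 + y, so that only κ⁻¹ and κ⁻² occur, both integrable uniformly in ε. -/
theorem sq_mul_uf_div_sub_le (h0 : 0 ≤ ε) (h1 : ε ≤ 1 / 4) (hκ : 0 < κ) (hH : 0 ≤ H) (hHH : H ≤ H')
    (hH1 : H' ≤ H₁) :
    κ ^ 2 * |uf ε (H' / κ) / κ - uf ε (H / κ) / κ - (H' ^ 2 - H ^ 2) / κ ^ 3| ≤
      25 * ε * (H' ^ 2 - H ^ 2) * κ ^ (-1 : ℝ) + 25 * ε * (H' ^ 2 - H ^ 2) * H₁ * κ ^ (-2 : ℝ) := by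
  have h := uf_div_sub_le h0 h1 hκ hH hHH
  have h2 := ell_le (div_nonneg (hH.trans hHH) hκ.le)
  have h3 : 0 ≤ H' ^ 2 - H ^ 2 := by nlinarith
  have h4 : H' / κ ≤ H₁ / κ := div_le_div_of_nonneg_right hH1 hκ.le
  have e2 : κ ^ (-2 : ℝ) = (κ ^ 2)⁻¹ := by
    rw [Real.rpow_neg hκ.le]; norm_num
  rw [Real.rpow_neg_one, e2]
  calc _ ≤ κ ^ 2 * (25 * ε * (1 + H₁ / κ) * ((H' ^ 2 - H ^ 2) / κ ^ 3)) := by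
        refine mul_le_mul_of_nonneg_left (h.trans ?_) (by positivity)
        exact mul_le_mul_of_nonneg_right
          (mul_le_mul_of_nonneg_left (by linarith) (by positivity)) (by positivity)
    _ = _ := by field_simp

theorem vf_div_sub_le (h0 : 0 ≤ ε) (h1 : ε ≤ 1 / 4) (hκ : 0 < κ) (hH : 0 ≤ H) (hHH : H ≤ H')
    (hH1 : H' ≤ H₁) : |vf ε (H' / κ) - vf ε (H / κ)| ≤
      (6 + 21 * (1 + H₁) ^ 2) * (H' - H) * κ ^ (-1 : ℝ) +
        21 * (1 + H₁) ^ 2 * ε * (H' - H) * κ ^ (-(3 - 2 * ε)) := by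
  have hd : H / κ ≤ H' / κ := div_le_div_of_nonneg_right hHH hκ.le
  have h := abs_vf_sub_le h0 (by linarith) (by positivity : 0 ≤ H / κ) hd
  have h2 := one_add_div_rpow_le' h1 h0 hκ (hH.trans hHH) hH1
  rw [← rpow_neg_three_sub hκ]
  have h3 : H' / κ - H / κ = (H' - H) * κ ^ (-1 : ℝ) := by rw [Real.rpow_neg_one]; ring
  have h4 : 0 ≤ (H' - H) * κ ^ (-1 : ℝ) := mul_nonneg (by linarith) (by positivity)
  rw [h3] at h
  refine h.trans ?_
  calc _ ≤ (6 + 21 * ε * ((1 + H₁) ^ 2 * (1 + κ ^ (-(2 - 2 * ε))))) * ((H' - H) * κ ^ (-1 : ℝ)) :=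
        mul_le_mul_of_nonneg_right (add_le_add le_rfl
          (mul_le_mul_of_nonneg_left h2 (by linarith))) h4
    _ ≤ _ := by
      have h5 : ε * ((1 + H₁) ^ 2 * ((H' - H) * κ ^ (-1 : ℝ))) ≤
          1 * ((1 + H₁) ^ 2 * ((H' - H) * κ ^ (-1 : ℝ))) :=
        mul_le_mul_of_nonneg_right (by linarith) (by positivity)
      linarith

theorem mul_vf_div_sub_sub_le (h0 : 0 ≤ ε) (h1 : ε ≤ 1 / 4) (hκ : 0 < κ) (hH : 0 ≤ H) (hHH : H ≤ H')
    (hH1 : H' ≤ H₁) : κ * |vf ε (H' / κ) - vf ε (H / κ) - (H' - H) / κ| ≤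
      41 * (1 + H₁) ^ 2 * ε * (H' - H) * κ ^ (-0 : ℝ) +
        41 * (1 + H₁) ^ 2 * ε * (H' - H) * κ ^ (-2 : ℝ) := by
  have hd : H / κ ≤ H' / κ := div_le_div_of_nonneg_right hHH hκ.le
  have h := abs_vf_sub_sub_le h0 (by linarith) (by positivity : 0 ≤ H / κ) hd
  have h2 := one_add_div_rpow_le (e := 2) (by norm_num) le_rfl hκ (hH.trans hHH)
  have h6 : (1 + H') ^ 2 ≤ (1 + H₁) ^ 2 := by
    have := hH.trans hHH
    gcongr
  have h2' := h2.trans (mul_le_mul_of_nonneg_right h6 (by positivity))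
  rw [Real.rpow_two] at h2'
  rw [neg_zero, Real.rpow_zero]
  have e : H' / κ - H / κ = (H' - H) / κ := by ring
  rw [e] at h
  have hn : 0 ≤ H' - H := by linarith
  calc _ ≤ κ * (41 * ε * (1 + H' / κ) ^ 2 * ((H' - H) / κ)) := mul_le_mul_of_nonneg_left h hκ.le
    _ = 41 * ε * (H' - H) * (1 + H' / κ) ^ 2 := by field_simp
    _ ≤ 41 * ε * (H' - H) * ((1 + H₁) ^ 2 * (1 + κ ^ (-2 : ℝ))) :=
        mul_le_mul_of_nonneg_left h2' (by positivity)
    _ = _ := by ring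

theorem Nf_div_sub_le (h0 : 0 ≤ ε) (h1 : ε ≤ 1 / 4) (hκ : 0 < κ) (hH : 0 ≤ H) (hHH : H ≤ H')
    (hH1 : H' ≤ H₁) : |Nf ε (H' / κ) * κ - Nf ε (H / κ) * κ| ≤
      30 * (1 + H₁) ^ 2 * ε * (H' ^ 2 - H ^ 2) * κ ^ (-1 : ℝ) +
        15 * (1 + H₁) ^ 2 * ε ^ 2 * (H' ^ 2 - H ^ 2) * κ ^ (-(3 - 2 * ε)) := by
  have hd : H / κ ≤ H' / κ := div_le_div_of_nonneg_right hHH hκ.le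
  have h := abs_Nf_sub_le h0 (by linarith) (by positivity : 0 ≤ H / κ) hd
  have h2 := one_add_div_rpow_le' h1 h0 hκ (hH.trans hHH) hH1
  have hn : 0 ≤ H' ^ 2 - H ^ 2 := by nlinarith
  have hA : 1 ≤ (1 + H₁) ^ 2 := by nlinarith
  rw [← rpow_neg_three_sub hκ, ← sub_mul, abs_mul, abs_of_pos hκ]
  have h3 : ((H' / κ) ^ 2 - (H / κ) ^ 2) * κ = (H' ^ 2 - H ^ 2) * κ ^ (-1 : ℝ) := by
    rw [Real.rpow_neg_one]; field_simp
  have h4 : 0 ≤ (H' ^ 2 - H ^ 2) * κ ^ (-1 : ℝ) := by positivity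
  calc _ ≤ ε * (15 + 15 * ε * (1 + H' / κ) ^ (2 - 2 * ε)) * ((H' / κ) ^ 2 - (H / κ) ^ 2) * κ :=
        mul_le_mul_of_nonneg_right h hκ.le
    _ = ε * (15 + 15 * ε * (1 + H' / κ) ^ (2 - 2 * ε)) * ((H' ^ 2 - H ^ 2) * κ ^ (-1 : ℝ)) := by
        rw [mul_assoc, h3]
    _ ≤ ε * (15 * (1 + H₁) ^ 2 + 15 * ε * ((1 + H₁) ^ 2 * (1 + κ ^ (-(2 - 2 * ε))))) *
          ((H' ^ 2 - H ^ 2) * κ ^ (-1 : ℝ)) := by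
        refine mul_le_mul_of_nonneg_right (mul_le_mul_of_nonneg_left (add_le_add (by linarith)
          (mul_le_mul_of_nonneg_left h2 (by linarith))) h0) h4
    _ ≤ _ := by
      have h5 : ε * (ε * ((1 + H₁) ^ 2 * ((H' ^ 2 - H ^ 2) * κ ^ (-1 : ℝ)))) ≤
          ε * (1 * ((1 + H₁) ^ 2 * ((H' ^ 2 - H ^ 2) * κ ^ (-1 : ℝ)))) :=
        mul_le_mul_of_nonneg_left (mul_le_mul_of_nonneg_right (by linarith) (by positivity)) h0
      linarith

end pointwise

/-- Field-field mode integral. -/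
def entU (ε H : ℝ) (W : Space → ℝ) : ℝ := ∫ k, W k * (uf ε (H / ‖k‖) / ‖k‖)

/-- Field-momentum mode integral. -/
def entV (ε H : ℝ) (W : Space → ℝ) : ℝ := ∫ k, W k * vf ε (H / ‖k‖)

/-- Momentum-momentum mode integral. -/
def entN (ε H : ℝ) (W : Space → ℝ) : ℝ := ∫ k, W k * (Nf ε (H / ‖k‖) * ‖k‖)

theorem integrable_div_pow_three {ψ W : Space → ℝ} {C c : ℝ} (hψ : WeightBound ψ C)
    (hW : Measurable W) (hle2 : ∀ k, |W k| ≤ c * ψ k * ‖k‖ ^ 2) :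
    Integrable fun k => W k / ‖k‖ ^ 3 := by
  refine hψ.integrable (A := c) (B := 0) (p := 1) (q := 0) (hW.div (measurable_norm.pow_const 3))
    (by norm_num) (by norm_num) (by norm_num) (by norm_num) fun k hk => ?_
  have hk' : 0 < ‖k‖ := norm_pos_iff.2 hk
  rw [abs_div, abs_of_pos (by positivity : 0 < ‖k‖ ^ 3), div_le_iff₀ (by positivity),
    Real.rpow_neg_one]
  refine (hle2 k).trans_eq ?_
  field_simp
  ring

theorem integrable_div_norm_of_le {ψ W : Space → ℝ} {C c : ℝ} (hψ : WeightBound ψ C)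
    (hW : Measurable W) (hle2 : ∀ k, |W k| ≤ c * ψ k * ‖k‖) :
    Integrable fun k => W k / ‖k‖ := by
  refine hψ.integrable (A := c) (B := 0) (p := 0) (q := 0) (hW.div measurable_norm)
    (by norm_num) (by norm_num) (by norm_num) (by norm_num) fun k hk => ?_
  have hk' : 0 < ‖k‖ := norm_pos_iff.2 hk
  rw [abs_div, abs_of_pos hk', div_le_iff₀ (by positivity)]
  refine (hle2 k).trans_eq ?_
  rw [neg_zero, Real.rpow_zero]
  ring

/-! ### Bounds for the mode integrals and their increments in H -/

section integrals

variable {ψ W : Space → ℝ} {C c ε H H' H₁ : ℝ}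

theorem measurable_entU (h0 : 0 ≤ ε) (h1 : ε ≤ 1 / 4) (hW : Measurable W) :
    Measurable fun k => W k * (uf ε (H / ‖k‖) / ‖k‖) :=
  hW.mul (((continuous_uf h0 (by linarith)).measurable.comp
    (measurable_const.div measurable_norm)).div measurable_norm)

theorem measurable_entV (h0 : 0 ≤ ε) (h1 : ε ≤ 1 / 4) (hW : Measurable W) :
    Measurable fun k => W k * vf ε (H / ‖k‖) :=
  hW.mul ((continuous_vf h0 (by linarith)).measurable.comp
    (measurable_const.div measurable_norm))

theorem measurable_entN (h0 : 0 ≤ ε) (h1 : ε ≤ 1 / 4) (hW : Measurable W) :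
    Measurable fun k => W k * (Nf ε (H / ‖k‖) * ‖k‖) :=
  hW.mul (((continuous_Nf h0 (by linarith)).measurable.comp
    (measurable_const.div measurable_norm)).mul measurable_norm)

theorem abs_entU_integrand_le (hle : ∀ k, |W k| ≤ c * ψ k) (h0 : 0 < ε)
    (h1 : ε ≤ 1 / 4) (hH : 0 ≤ H) (hH1 : H ≤ H₁) (k : Space) (hk : k ≠ 0) :
    |W k * (uf ε (H / ‖k‖) / ‖k‖)| ≤ ψ k * (c * (9 * (1 + H₁) ^ 2) * ‖k‖ ^ (-1 : ℝ) +
      c * (9 * (1 + H₁) ^ 2) * ‖k‖ ^ (-(3 - 2 * ε))) := by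
  have hk' : 0 < ‖k‖ := norm_pos_iff.2 hk
  have h2 := uf_div_le h0.le h1 hk' hH hH1
  have h3 := div_nonneg (uf_nonneg ε (H / ‖k‖)) hk'.le
  rw [abs_mul, abs_of_nonneg h3]
  calc _ ≤ c * ψ k * (9 * (1 + H₁) ^ 2 * (‖k‖ ^ (-1 : ℝ) + ‖k‖ ^ (-(3 - 2 * ε)))) :=
        mul_le_mul (hle k) h2 h3 ((abs_nonneg _).trans (hle k))
    _ = _ := by ring

theorem integrable_entU (hψ : WeightBound ψ C) (hW : Measurable W) (hle : ∀ k, |W k| ≤ c * ψ k)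
    (h0 : 0 < ε) (h1 : ε ≤ 1 / 4) (hH : 0 ≤ H) :
    Integrable fun k => W k * (uf ε (H / ‖k‖) / ‖k‖) :=
  hψ.integrable (measurable_entU h0.le h1 hW) (by norm_num) (by norm_num) (by linarith)
    (by linarith) (abs_entU_integrand_le hle h0 h1 hH le_rfl)

/-- The exponent p = 3 - 2ε yields C/(3 - p) = C/(2ε): this is the logarithmic infrared divergence
of the massless field, regulated by the mass. -/
theorem abs_entU_le (hψ : WeightBound ψ C) (hc : 0 ≤ c) (hle : ∀ k, |W k| ≤ c * ψ k)
    (h0 : 0 < ε) (h1 : ε ≤ 1 / 4) (hH : 0 ≤ H) (hH1 : H ≤ H₁) :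
    |entU ε H W| ≤ c * (9 * (1 + H₁) ^ 2) * C / ε := by
  have h := hψ.abs_integral_le (by positivity) (by positivity) (by norm_num) (by norm_num)
    (by linarith) (by linarith) (abs_entU_integrand_le hle h0 h1 hH hH1)
  refine h.trans ?_
  have hC := hψ.1
  have e : C / (3 - (3 - 2 * ε)) = C / ε / 2 := by field_simp; ring
  have e2 : C / (3 - 1) ≤ C / ε / 2 := by
    rw [show (3 - 1 : ℝ) = 2 by norm_num]
    exact div_le_div_of_nonneg_right ((le_div_iff₀ h0).2 (by nlinarith)) (by norm_num)
  rw [e]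
  have h5 : 0 ≤ c * (9 * (1 + H₁) ^ 2) := by positivity
  calc _ ≤ c * (9 * (1 + H₁) ^ 2) * (C / ε / 2) + c * (9 * (1 + H₁) ^ 2) * (C / ε / 2) :=
        add_le_add (mul_le_mul_of_nonneg_left e2 h5) le_rfl
    _ = _ := by ring

/-- For a weight of order k² the H² coefficient ∫ W/k³ converges, and the error keeps its factor ε.
-/
theorem entU_sub_le (hψ : WeightBound ψ C) (hc : 0 ≤ c) (hW : Measurable W)
    (hle : ∀ k, |W k| ≤ c * ψ k) (hle2 : ∀ k, |W k| ≤ c * ψ k * ‖k‖ ^ 2) (h0 : 0 < ε)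
    (h1 : ε ≤ 1 / 4) (hH : 0 ≤ H) (hHH : H ≤ H') (hH1 : H' ≤ H₁) :
    |entU ε H' W - entU ε H W - (H' ^ 2 - H ^ 2) * ∫ k, W k / ‖k‖ ^ 3| ≤
      c * 25 * (1 + H₁) * C * ε * (H' ^ 2 - H ^ 2) := by
  have i1 := integrable_entU hψ hW hle h0 h1 hH
  have i2 := integrable_entU hψ hW hle h0 h1 (hH.trans hHH)
  have i3 := integrable_div_pow_three hψ hW hle2
  have hn : 0 ≤ H' ^ 2 - H ^ 2 := by nlinarith
  have i21 : Integrable fun k => W k * (uf ε (H' / ‖k‖) / ‖k‖) - W k * (uf ε (H / ‖k‖) / ‖k‖) :=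
    i2.sub i1
  rw [entU, entU, ← integral_sub i2 i1, ← integral_const_mul, ← integral_sub i21
    (i3.const_mul _)]
  have hH1' : 0 ≤ H₁ := hH.trans (hHH.trans hH1)
  have h := hψ.abs_integral_le
    (F := fun k => W k * (uf ε (H' / ‖k‖) / ‖k‖) - W k * (uf ε (H / ‖k‖) / ‖k‖) -
      (H' ^ 2 - H ^ 2) * (W k / ‖k‖ ^ 3))
    (A := c * (25 * ε * (H' ^ 2 - H ^ 2))) (B := c * (25 * ε * (H' ^ 2 - H ^ 2) * H₁))
    (p := 1) (q := 2) (by positivity) (by positivity)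
    (by norm_num) (by norm_num) (by norm_num) (by norm_num) (fun k hk => by
      have hk' : 0 < ‖k‖ := norm_pos_iff.2 hk
      have h2 := sq_mul_uf_div_sub_le h0.le h1 hk' hH hHH hH1
      rw [show W k * (uf ε (H' / ‖k‖) / ‖k‖) - W k * (uf ε (H / ‖k‖) / ‖k‖) -
        (H' ^ 2 - H ^ 2) * (W k / ‖k‖ ^ 3) = W k * (uf ε (H' / ‖k‖) / ‖k‖ - uf ε (H / ‖k‖) / ‖k‖ -
        (H' ^ 2 - H ^ 2) / ‖k‖ ^ 3) by ring, abs_mul]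
      have hψk := hψ.2.1 k
      calc _ ≤ c * ψ k * ‖k‖ ^ 2 * _ := mul_le_mul_of_nonneg_right (hle2 k) (abs_nonneg _)
        _ = c * ψ k * (‖k‖ ^ 2 * _) := mul_assoc _ _ _
        _ ≤ c * ψ k * _ := mul_le_mul_of_nonneg_left h2 (by positivity)
        _ = _ := by ring)
  refine h.trans ?_
  have hC := hψ.1
  have h5 : 0 ≤ c * (25 * ε * (H' ^ 2 - H ^ 2)) * C := by positivity
  rw [show (3 - 1 : ℝ) = 2 by norm_num, show (3 - 2 : ℝ) = 1 by norm_num]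
  nlinarith

theorem abs_entV_incr_integrand_le (hle : ∀ k, |W k| ≤ c * ψ k) (h0 : 0 < ε)
    (h1 : ε ≤ 1 / 4) (hH : 0 ≤ H) (hHH : H ≤ H') (hH1 : H' ≤ H₁) (k : Space) (hk : k ≠ 0) :
    |W k * (vf ε (H' / ‖k‖) - vf ε (H / ‖k‖))| ≤
      ψ k * (c * ((6 + 21 * (1 + H₁) ^ 2) * (H' - H)) * ‖k‖ ^ (-1 : ℝ) +
        c * (21 * (1 + H₁) ^ 2 * ε * (H' - H)) * ‖k‖ ^ (-(3 - 2 * ε))) := by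
  have hk' : 0 < ‖k‖ := norm_pos_iff.2 hk
  have h2 := vf_div_sub_le h0.le h1 hk' hH hHH hH1
  rw [abs_mul]
  calc _ ≤ c * ψ k * _ := mul_le_mul (hle k) h2 (abs_nonneg _) ((abs_nonneg _).trans (hle k))
    _ = _ := by ring

theorem integrable_entV (hψ : WeightBound ψ C) (hW : Measurable W) (hle : ∀ k, |W k| ≤ c * ψ k)
    (h0 : 0 < ε) (h1 : ε ≤ 1 / 4) (hH : 0 ≤ H) :
    Integrable fun k => W k * vf ε (H / ‖k‖) :=
  hψ.integrable (A := c * ((6 + 21 * (1 + H) ^ 2) * (H - 0)))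
    (B := c * (21 * (1 + H) ^ 2 * ε * (H - 0))) (p := 1) (q := 3 - 2 * ε)
    (measurable_entV h0.le h1 hW) (by norm_num) (by norm_num) (by linarith)
    (by linarith) fun k hk => by
      have := abs_entV_incr_integrand_le hle h0 h1 le_rfl hH le_rfl k hk
      rwa [zero_div, vf_zero (by linarith : ε < 1), sub_zero] at this

theorem entV_zero (h1 : ε ≤ 1 / 4) : entV ε 0 W = 0 := by
  simp [entV, vf_zero (by linarith : ε < 1)]

/-- Valid without vanishing of the weight at k = 0: the factor ε in the singular part of the kernel
cancels the 1/(2ε) of the momentum integral. -/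
theorem abs_entV_sub_le (hψ : WeightBound ψ C) (hc : 0 ≤ c) (hW : Measurable W)
    (hle : ∀ k, |W k| ≤ c * ψ k) (h0 : 0 < ε) (h1 : ε ≤ 1 / 4) (hH : 0 ≤ H) (hHH : H ≤ H')
    (hH1 : H' ≤ H₁) :
    |entV ε H' W - entV ε H W| ≤ c * (6 + 42 * (1 + H₁) ^ 2) * C * (H' - H) := by
  have i1 := integrable_entV hψ hW hle h0 h1 hH
  have i2 := integrable_entV hψ hW hle h0 h1 (hH.trans hHH)
  rw [entV, entV, ← integral_sub i2 i1]
  simp only [← mul_sub]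
  have hn : 0 ≤ H' - H := by linarith
  have h := hψ.abs_integral_le (by positivity) (by positivity) (by norm_num) (by norm_num)
    (by linarith) (by linarith) (abs_entV_incr_integrand_le hle h0 h1 hH hHH hH1)
  refine h.trans ?_
  have hC := hψ.1
  have e : c * (21 * (1 + H₁) ^ 2 * ε * (H' - H)) * (C / (3 - (3 - 2 * ε))) =
      c * (21 * (1 + H₁) ^ 2 * (H' - H)) * C / 2 := by field_simp; ring
  rw [e, show (3 - 1 : ℝ) = 2 by norm_num]
  have h5 : 0 ≤ c * (H' - H) * C := by positivity
  have h6 : 0 ≤ c * (H' - H) * C * (1 + H₁) ^ 2 := by positivity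
  nlinarith

theorem entV_sub_sub_le (hψ : WeightBound ψ C) (hc : 0 ≤ c) (hW : Measurable W)
    (hle : ∀ k, |W k| ≤ c * ψ k) (hle2 : ∀ k, |W k| ≤ c * ψ k * ‖k‖) (h0 : 0 < ε)
    (h1 : ε ≤ 1 / 4) (hH : 0 ≤ H) (hHH : H ≤ H') (hH1 : H' ≤ H₁) :
    |entV ε H' W - entV ε H W - (H' - H) * ∫ k, W k / ‖k‖| ≤
      c * 82 * (1 + H₁) ^ 2 * C * ε * (H' - H) := by
  have i1 := integrable_entV hψ hW hle h0 h1 hH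
  have i2 := integrable_entV hψ hW hle h0 h1 (hH.trans hHH)
  have i3 := integrable_div_norm_of_le hψ hW hle2
  have hn : 0 ≤ H' - H := by linarith
  have i21 : Integrable fun k => W k * vf ε (H' / ‖k‖) - W k * vf ε (H / ‖k‖) := i2.sub i1
  rw [entV, entV, ← integral_sub i2 i1, ← integral_const_mul, ← integral_sub i21
    (i3.const_mul _)]
  have h := hψ.abs_integral_le
    (F := fun k => W k * vf ε (H' / ‖k‖) - W k * vf ε (H / ‖k‖) - (H' - H) * (W k / ‖k‖))
    (A := c * (41 * (1 + H₁) ^ 2 * ε * (H' - H))) (B := c * (41 * (1 + H₁) ^ 2 * ε * (H' - H)))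
    (p := 0) (q := 2) (by positivity) (by positivity)
    (by norm_num) (by norm_num) (by norm_num) (by norm_num) (fun k hk => by
      have hk' : 0 < ‖k‖ := norm_pos_iff.2 hk
      have h2 := mul_vf_div_sub_sub_le h0.le h1 hk' hH hHH hH1
      rw [show W k * vf ε (H' / ‖k‖) - W k * vf ε (H / ‖k‖) - (H' - H) * (W k / ‖k‖) =
        W k * (vf ε (H' / ‖k‖) - vf ε (H / ‖k‖) - (H' - H) / ‖k‖) by ring, abs_mul]
      have hψk := hψ.2.1 k
      calc _ ≤ c * ψ k * ‖k‖ * _ := mul_le_mul_of_nonneg_right (hle2 k) (abs_nonneg _)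
        _ = c * ψ k * (‖k‖ * _) := mul_assoc _ _ _
        _ ≤ c * ψ k * _ := mul_le_mul_of_nonneg_left h2 (by positivity)
        _ = _ := by ring)
  refine h.trans ?_
  have hC := hψ.1
  have h5 : 0 ≤ c * (41 * (1 + H₁) ^ 2 * ε * (H' - H)) * C := by positivity
  rw [show (3 - 0 : ℝ) = 3 by norm_num, show (3 - 2 : ℝ) = 1 by norm_num]
  nlinarith

theorem abs_entN_incr_integrand_le (hle : ∀ k, |W k| ≤ c * ψ k) (h0 : 0 < ε)
    (h1 : ε ≤ 1 / 4) (hH : 0 ≤ H) (hHH : H ≤ H') (hH1 : H' ≤ H₁) (k : Space) (hk : k ≠ 0) :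
    |W k * (Nf ε (H' / ‖k‖) * ‖k‖) - W k * (Nf ε (H / ‖k‖) * ‖k‖)| ≤
      ψ k * (c * (30 * (1 + H₁) ^ 2 * ε * (H' ^ 2 - H ^ 2)) * ‖k‖ ^ (-1 : ℝ) +
        c * (15 * (1 + H₁) ^ 2 * ε ^ 2 * (H' ^ 2 - H ^ 2)) * ‖k‖ ^ (-(3 - 2 * ε))) := by
  have hk' : 0 < ‖k‖ := norm_pos_iff.2 hk
  have h2 := Nf_div_sub_le h0.le h1 hk' hH hHH hH1
  rw [← mul_sub, abs_mul]
  calc _ ≤ c * ψ k * _ := mul_le_mul (hle k) h2 (abs_nonneg _) ((abs_nonneg _).trans (hle k))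
    _ = _ := by ring

/-- At H = 0 the integrand is W·k, which is where the order-1/2 norm of g enters. The increment from
H = 0 is handled by the infrared weights alone. -/
theorem integrable_entN (hψ : WeightBound ψ C) (hψ1 : Integrable fun k => ψ k * ‖k‖)
    (hW : Measurable W) (hle : ∀ k, |W k| ≤ c * ψ k)
    (h0 : 0 < ε) (h1 : ε ≤ 1 / 4) (hH : 0 ≤ H) :
    Integrable fun k => W k * (Nf ε (H / ‖k‖) * ‖k‖) := by
  have i0 : Integrable fun k => W k * (Nf ε (0 / ‖k‖) * ‖k‖) := by
    refine (hψ1.const_mul c).mono' (measurable_entN h0.le h1 hW).aestronglyMeasurable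
      (Eventually.of_forall fun k => ?_)
    rw [zero_div, Nf_zero (by linarith), one_mul, norm_mul, norm_norm, ← mul_assoc]
    exact mul_le_mul_of_nonneg_right (hle k) (norm_nonneg _)
  have i1 : Integrable fun k => W k * (Nf ε (H / ‖k‖) * ‖k‖) - W k * (Nf ε (0 / ‖k‖) * ‖k‖) :=
    hψ.integrable ((measurable_entN h0.le h1 hW).sub (measurable_entN h0.le h1 hW)) (by norm_num)
      (by norm_num) (by linarith) (by linarith)
      (abs_entN_incr_integrand_le hle h0 h1 le_rfl hH le_rfl)
  exact (i1.add i0).congr (Eventually.of_forall fun k => by simp)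

theorem abs_entN_sub_le (hψ : WeightBound ψ C) (hψ1 : Integrable fun k => ψ k * ‖k‖) (hc : 0 ≤ c)
    (hW : Measurable W) (hle : ∀ k, |W k| ≤ c * ψ k) (h0 : 0 < ε) (h1 : ε ≤ 1 / 4) (hH : 0 ≤ H)
    (hHH : H ≤ H') (hH1 : H' ≤ H₁) :
    |entN ε H' W - entN ε H W| ≤ c * 45 * (1 + H₁) ^ 2 * C * ε * (H' ^ 2 - H ^ 2) := by
  have i1 := integrable_entN hψ hψ1 hW hle h0 h1 hH
  have i2 := integrable_entN hψ hψ1 hW hle h0 h1 (hH.trans hHH)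
  rw [entN, entN, ← integral_sub i2 i1]
  have hn : 0 ≤ H' ^ 2 - H ^ 2 := by nlinarith
  have h := hψ.abs_integral_le (by positivity) (by positivity) (by norm_num) (by norm_num)
    (by linarith) (by linarith) (abs_entN_incr_integrand_le hle h0 h1 hH hHH hH1)
  refine h.trans ?_
  have hC := hψ.1
  have e : c * (15 * (1 + H₁) ^ 2 * ε ^ 2 * (H' ^ 2 - H ^ 2)) * (C / (3 - (3 - 2 * ε))) =
      c * (15 * (1 + H₁) ^ 2 * ε * (H' ^ 2 - H ^ 2)) * C / 2 := by field_simp; ring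
  rw [e, show (3 - 1 : ℝ) = 2 by norm_num]
  have h6 : 0 ≤ c * (H' ^ 2 - H ^ 2) * C * (1 + H₁) ^ 2 * ε := by positivity
  nlinarith

theorem entN_zero (h1 : ε ≤ 1 / 4) : entN ε 0 W = ∫ k, W k * ‖k‖ := by
  simp [entN, Nf_zero (by linarith : ε < 1)]

theorem entU_zero (h1 : ε ≤ 1 / 4) : entU ε 0 W = ∫ k, W k / ‖k‖ := by
  simp [entU, uf_zero (by linarith : ε < 1), div_eq_mul_inv]

end integrals

end DeSitter
end

noncomputable section
namespace DeSitter

/-! ### Matrix elements of the covariance metric -/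

/-- Cross spectrum of two smearing functions. -/
def spec (a b : Space → ℝ) (k : Space) : ℂ :=
  ((1 / (2 * Real.pi) ^ 3 : ℝ) : ℂ) * (ft a k * (starRingEnd ℂ) (ft b k))

/-- `ε = 3/2 - ν` as a function of `r = m/H`. -/
def epsOf (r : ℝ) : ℝ := 3 / 2 - Real.sqrt (9 / 4 - r ^ 2)

theorem bdIndex_eq {r H : ℝ} (hH : H ≠ 0) : bdIndex (r * H) H = 3 / 2 - epsOf r := by
  rw [bdIndex, epsOf, mul_pow, mul_div_cancel_right₀ _ (pow_ne_zero 2 hH)]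
  ring

/-- The square root is concave in r²: this is its tangent at 0, and the next bound is its chord on
[0, 9/4]. -/
theorem sq_div_three_le_epsOf {r : ℝ} (hr2 : r ^ 2 ≤ 9 / 4) : r ^ 2 / 3 ≤ epsOf r := by
  rw [epsOf]
  have : Real.sqrt (9 / 4 - r ^ 2) ≤ 3 / 2 - r ^ 2 / 3 := by
    rw [Real.sqrt_le_left (by linarith)]
    nlinarith [sq_nonneg (r ^ 2)]
  linarith

theorem epsOf_le {r : ℝ} (hr2 : r ^ 2 ≤ 9 / 4) : epsOf r ≤ 2 / 3 * r ^ 2 := by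
  rw [epsOf]
  have : 3 / 2 - 2 / 3 * r ^ 2 ≤ Real.sqrt (9 / 4 - r ^ 2) := by
    refine Real.le_sqrt_of_sq_le ?_
    nlinarith [sq_nonneg r]
  linarith

/-- The covariance metric entering `entanglement`. -/
def covOf (r H : ℝ) : PhaseSpace → PhaseSpace → ℝ := if H = 0 then minkCov else bdCov (r * H) H

section spectrum

variable {a b : Space → ℝ}

theorem spec_neg_arg (a b : Space → ℝ) (k : Space) :
    spec a b (-k) = (starRingEnd ℂ) (spec a b k) := by
  rw [spec, spec, map_mul, Complex.conj_ofReal, map_mul, ft_neg_arg, ft_neg_arg]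

theorem continuous_spec (ha : Integrable a) (hb : Integrable b) : Continuous (spec a b) :=
  continuous_const.mul ((continuous_ft ha).mul (Complex.continuous_conj.comp (continuous_ft hb)))

theorem continuous_spec_re (ha : Integrable a) (hb : Integrable b) :
    Continuous fun k => (spec a b k).re := Complex.continuous_re.comp (continuous_spec ha hb)

theorem bdCov_comm (m H : ℝ) (γ γ' : PhaseSpace) : bdCov m H γ γ' = bdCov m H γ' γ := by
  rw [bdCov, bdCov]
  congr 1
  ext k
  congr 2
  simp
  ring

theorem minkCov_field (ψ : Space → ℝ) {C : ℝ} (hψ : WeightBound ψ C) (ha : Integrable a)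
    (hb : Integrable b) (hle : ∀ k, ‖spec a b k‖ ≤ ψ k) :
    minkCov (0, a) (0, b) = ∫ k, (spec a b k).re / ‖k‖ := by
  have e : ∀ k : Space, ((‖k‖ ^ (2 * (-1 / 2 : ℝ)) / (2 * Real.pi) ^ 3 : ℝ) : ℂ) *
      (ft a k * (starRingEnd ℂ) (ft b k)) = ((‖k‖⁻¹ : ℝ) : ℂ) * spec a b k := fun k => by
    rw [spec, ← mul_assoc ((_ : ℝ) : ℂ) ((_ : ℝ) : ℂ), ← Complex.ofReal_mul, show (2 * (-1 / 2 : ℝ)) = -1 by norm_num,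
      Real.rpow_neg_one]
    congr 2
    ring
  have hi : Integrable fun k => ((‖k‖⁻¹ : ℝ) : ℂ) * spec a b k := by
    refine (hψ.2.2 1 (by norm_num) (by norm_num)).1.mono' ?_ (Eventually.of_forall fun k => ?_)
    · exact ((Complex.measurable_ofReal.comp measurable_norm.inv).mul
        (continuous_spec ha hb).measurable).aestronglyMeasurable
    · rw [norm_mul, Complex.norm_real, norm_inv, norm_norm, Real.rpow_neg_one, mul_comm]
      exact mul_le_mul_of_nonneg_right (hle k) (by positivity)
  rw [minkCov]
  have z : sobolev (1 / 2) 0 0 = 0 := by simp [sobolev, ft_zero_fun]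
  simp only [z, Complex.zero_re, zero_add]
  rw [sobolev]
  simp only [e]
  have := integral_re hi
  simp only [RCLike.re_to_complex] at this
  rw [← this]
  congr 1
  ext k
  rw [Complex.re_ofReal_mul]
  ring

theorem minkCov_momentum (hψ1 : Integrable fun k => ‖spec a b k‖ * ‖k‖) (ha : Integrable a)
    (hb : Integrable b) :
    minkCov (-a, 0) (-b, 0) = ∫ k, (spec a b k).re * ‖k‖ := by
  have e : ∀ k : Space, ((‖k‖ ^ (2 * (1 / 2 : ℝ)) / (2 * Real.pi) ^ 3 : ℝ) : ℂ) *
      (ft (-a) k * (starRingEnd ℂ) (ft (-b) k)) = ((‖k‖ : ℝ) : ℂ) * spec a b k := fun k => by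
    rw [spec, ← mul_assoc ((_ : ℝ) : ℂ) ((_ : ℝ) : ℂ), ← Complex.ofReal_mul, show (2 * (1 / 2 : ℝ)) = 1 by norm_num,
      Real.rpow_one, ft_neg, ft_neg, map_neg, neg_mul_neg]
    congr 2
    ring
  have hi : Integrable fun k => ((‖k‖ : ℝ) : ℂ) * spec a b k := by
    refine hψ1.mono' ?_ (Eventually.of_forall fun k => ?_)
    · exact ((Complex.measurable_ofReal.comp measurable_norm).mul
        (continuous_spec ha hb).measurable).aestronglyMeasurable
    · rw [norm_mul, Complex.norm_real, norm_norm, mul_comm]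
  rw [minkCov]
  have z : sobolev (-1 / 2) 0 0 = 0 := by simp [sobolev, ft_zero_fun]
  simp only [z, Complex.zero_re, add_zero]
  rw [sobolev]
  simp only [e]
  have := integral_re hi
  simp only [RCLike.re_to_complex] at this
  rw [← this]
  congr 1
  ext k
  rw [Complex.re_ofReal_mul]
  ring

theorem minkCov_cross : minkCov (0, a) (-b, 0) = 0 := by
  simp [minkCov, sobolev, ft_zero_fun]

theorem minkCov_cross' : minkCov (-b, 0) (0, a) = 0 := by
  simp [minkCov, sobolev, ft_zero_fun]

variable {r H : ℝ}

theorem bdCov_field (h0 : 0 ≤ epsOf r) (h1 : epsOf r < 1) (hH : 0 < H) :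
    bdCov (r * H) H (0, a) (0, b) = entU (epsOf r) H fun k => (spec a b k).re := by
  rw [bdCov, entU]
  refine integral_congr_ae ?_
  filter_upwards [ae_ne_zero] with k hk
  rw [bdAmp_mul_conj h0 h1 (bdIndex_eq hH.ne') hH _ _ hk, spec, Complex.re_ofReal_mul]
  simp only [ft_zero_fun]
  simp only [map_zero, mul_zero, zero_mul, Complex.zero_re, add_zero]
  ring

theorem bdCov_momentum (h0 : 0 ≤ epsOf r) (h1 : epsOf r < 1) (hH : 0 < H) :
    bdCov (r * H) H (-a, 0) (-b, 0) = entN (epsOf r) H fun k => (spec a b k).re := by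
  rw [bdCov, entN]
  refine integral_congr_ae ?_
  filter_upwards [ae_ne_zero] with k hk
  rw [bdAmp_mul_conj h0 h1 (bdIndex_eq hH.ne') hH _ _ hk, spec, Complex.re_ofReal_mul]
  simp only [ft_zero_fun, ft_neg, map_neg, neg_mul_neg]
  simp only [map_zero, mul_zero, zero_mul, Complex.zero_re, add_zero, zero_add]
  ring

/-- The part εyG of the momentum mode contributes the real number εy|G|² and drops out, leaving the
pairing of G with J. -/
theorem im_Gf_mul_conj_Nt {ε y : ℝ} (h0 : 0 ≤ ε) (h1 : ε < 1) (hy : 0 ≤ y) :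
    |(Gf ε y * (starRingEnd ℂ) (Nt ε y)).im| ≤ 3 * (1 + y) := by
  have e : (Gf ε y * (starRingEnd ℂ) (Nt ε y)).im = -(Gf ε y * (starRingEnd ℂ) (Jf ε y)).re := by
    rw [Nt]; simp; ring
  rw [e, abs_neg]
  refine (Complex.abs_re_le_norm _).trans ?_
  rw [norm_mul, RCLike.norm_conj]
  have h2 : (1 + y) ^ (1 - ε) ≤ 1 + y := by
    calc _ ≤ (1 + y) ^ (1 : ℝ) :=
          Real.rpow_le_rpow_of_exponent_le (by linarith) (by linarith)
      _ = _ := Real.rpow_one _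
  calc _ ≤ 3 * (1 + y) ^ (1 - ε) * 1 :=
        mul_le_mul (norm_Gf_le h0 h1 hy) (norm_Jf_le h0 h1) (norm_nonneg _) (by positivity)
    _ ≤ _ := by linarith

theorem integral_eq_zero_of_odd {F : Space → ℝ} (h : ∀ k, F (-k) = -F k) : ∫ k, F k = 0 := by
  have h2 := integral_neg_eq_self F volume
  simp only [h, integral_neg] at h2
  linarith

/-- The imaginary part of the cross spectrum is odd in k and multiplies a radial function, so its
integral vanishes. Its absolute integrability is still needed to split the integral. The minus sign
comes from the momentum mode at η₀. -/
theorem bdCov_cross {ψ : Space → ℝ} {C : ℝ} (hψ : WeightBound ψ C) (ha : Integrable a)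
    (hb : Integrable b) (hle : ∀ k, ‖spec a b k‖ ≤ ψ k) (h0 : 0 < epsOf r) (h1 : epsOf r ≤ 1 / 4)
    (hH : 0 < H) :
    bdCov (r * H) H (0, a) (-b, 0) = -entV (epsOf r) H fun k => (spec a b k).re := by
  set ε := epsOf r with hε
  have h1' : ε < 1 := by linarith
  have hre : ∀ k, |(spec a b k).re| ≤ 1 * ψ k := fun k => by
    rw [one_mul]; exact (Complex.abs_re_le_norm _).trans (hle k)
  have i1 := integrable_entV hψ (continuous_spec_re ha hb).measurable hre h0 h1 hH.le
  have i2 : Integrable fun k : Space => (spec a b k).im *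
      (Gf ε (H / ‖k‖) * (starRingEnd ℂ) (Nt ε (H / ‖k‖))).im := by
    refine hψ.integrable (A := 3) (B := 3 * H) (p := 0) (q := 1) ?_ le_rfl (by norm_num)
      (by norm_num) (by norm_num) fun k hk => ?_
    · refine (Complex.measurable_im.comp (continuous_spec ha hb).measurable).mul ?_
      refine Complex.measurable_im.comp (Measurable.mul ?_ ?_)
      · exact (continuous_Gf h0.le h1').measurable.comp (measurable_const.div measurable_norm)
      · refine Complex.continuous_conj.measurable.comp ?_
        have : Continuous (Nt ε) := (continuous_const.mul (continuous_Jf h0.le h1')).add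
          ((Complex.continuous_ofReal.comp (continuous_const.mul continuous_id)).mul
            (continuous_Gf h0.le h1'))
        exact this.measurable.comp (measurable_const.div measurable_norm)
    · rw [abs_mul, neg_zero, Real.rpow_zero, Real.rpow_neg_one]
      have h3 := im_Gf_mul_conj_Nt h0.le h1' (by positivity : 0 ≤ H / ‖k‖)
      refine (mul_le_mul ((Complex.abs_im_le_norm _).trans (hle k)) h3 (abs_nonneg _)
        (hψ.2.1 k)).trans_eq ?_
      ring
  have hz : ∫ k : Space, (spec a b k).im *
      (Gf ε (H / ‖k‖) * (starRingEnd ℂ) (Nt ε (H / ‖k‖))).im = 0 :=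
    integral_eq_zero_of_odd fun k => by simp only [spec_neg_arg, norm_neg, Complex.conj_im, neg_mul]
  have e : ∀ᵐ k : Space, 2 * (bdAmp (r * H) H (0, a) k *
      (starRingEnd ℂ) (bdAmp (r * H) H (-b, 0) k)).re / (2 * Real.pi) ^ 3 =
      -((spec a b k).re * vf ε (H / ‖k‖)) +
        (spec a b k).im * (Gf ε (H / ‖k‖) * (starRingEnd ℂ) (Nt ε (H / ‖k‖))).im := by
    filter_upwards [ae_ne_zero] with k hk
    rw [bdAmp_mul_conj h0.le h1' (bdIndex_eq hH.ne') hH _ _ hk, vf_eq_re, spec,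
      Complex.re_ofReal_mul, Complex.im_ofReal_mul]
    simp only [ft_zero_fun, ft_neg, map_neg, map_zero, mul_zero, zero_mul, Complex.zero_re,
      add_zero, zero_add, mul_neg, neg_mul, Complex.neg_re, neg_zero]
    rw [Complex.mul_re (ft a k * _)]
    ring
  have i1n : Integrable fun k => -((spec a b k).re * vf ε (H / ‖k‖)) := i1.neg
  rw [bdCov, integral_congr_ae e, integral_add i1n i2, hz, integral_neg, add_zero, entV]

theorem covOf_field {ψ : Space → ℝ} {C : ℝ} (hψ : WeightBound ψ C) (ha : Integrable a)
    (hb : Integrable b) (hle : ∀ k, ‖spec a b k‖ ≤ ψ k) (h0 : 0 < epsOf r) (h1 : epsOf r ≤ 1 / 4)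
    (hH : 0 ≤ H) : covOf r H (0, a) (0, b) = entU (epsOf r) H fun k => (spec a b k).re := by
  rcases hH.eq_or_lt with rfl | hH
  · rw [covOf, if_pos rfl, minkCov_field ψ hψ ha hb hle, entU_zero h1]
  · rw [covOf, if_neg hH.ne', bdCov_field h0.le (by linarith) hH]

theorem covOf_momentum (hψ1 : Integrable fun k => ‖spec a b k‖ * ‖k‖) (ha : Integrable a)
    (hb : Integrable b) (h0 : 0 < epsOf r) (h1 : epsOf r ≤ 1 / 4) (hH : 0 ≤ H) :
    covOf r H (-a, 0) (-b, 0) = entN (epsOf r) H fun k => (spec a b k).re := by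
  rcases hH.eq_or_lt with rfl | hH
  · rw [covOf, if_pos rfl, minkCov_momentum hψ1 ha hb, entN_zero h1]
  · rw [covOf, if_neg hH.ne', bdCov_momentum h0.le (by linarith) hH]

theorem covOf_cross {ψ : Space → ℝ} {C : ℝ} (hψ : WeightBound ψ C) (ha : Integrable a)
    (hb : Integrable b) (hle : ∀ k, ‖spec a b k‖ ≤ ψ k) (h0 : 0 < epsOf r) (h1 : epsOf r ≤ 1 / 4)
    (hH : 0 ≤ H) :
    covOf r H (0, a) (-b, 0) = -entV (epsOf r) H fun k => (spec a b k).re := by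
  rcases hH.eq_or_lt with rfl | hH
  · rw [covOf, if_pos rfl, minkCov_cross, entV_zero h1, neg_zero]
  · rw [covOf, if_neg hH.ne', bdCov_cross hψ ha hb hle h0 h1 hH]

theorem covOf_cross' {ψ : Space → ℝ} {C : ℝ} (hψ : WeightBound ψ C) (ha : Integrable a)
    (hb : Integrable b) (hle : ∀ k, ‖spec a b k‖ ≤ ψ k) (h0 : 0 < epsOf r) (h1 : epsOf r ≤ 1 / 4)
    (hH : 0 ≤ H) :
    covOf r H (-b, 0) (0, a) = -entV (epsOf r) H fun k => (spec a b k).re := by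
  rw [← covOf_cross hψ ha hb hle h0 h1 hH, covOf]
  split_ifs
  · rw [minkCov_cross, minkCov_cross']
  · exact bdCov_comm _ _ _ _

end spectrum

/-! ### Translated smearing functions -/

section translated

variable {a b : Space → ℝ}

theorem integrable_translate (d : Space) (ha : Integrable a) : Integrable (translate d a) :=
  ha.comp_sub_right d

theorem phase_mul_conj (d k : Space) : phase d k * (starRingEnd ℂ) (phase d k) = 1 := by
  rw [Complex.mul_conj, Complex.normSq_apply, phase_re, phase_im]
  norm_cast
  have := Real.sin_sq_add_cos_sq (inner ℝ k d)
  nlinarith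

theorem norm_phase (d k : Space) : ‖phase d k‖ = 1 := by
  rw [phase, mul_comm, Complex.norm_exp_ofReal_mul_I]

theorem spec_translate (d : Space) (a b : Space → ℝ) (k : Space) :
    spec (translate d a) (translate d b) k = spec a b k := by
  rw [spec, spec, ft_translate, ft_translate, map_mul]
  linear_combination ((1 / (2 * Real.pi) ^ 3 : ℝ) : ℂ) * (ft a k * (starRingEnd ℂ) (ft b k)) *
    phase_mul_conj d k

theorem spec_translate_left (d : Space) (a b : Space → ℝ) (k : Space) :
    spec (translate d a) b k = phase d k * spec a b k := by
  rw [spec, spec, ft_translate]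
  ring

theorem spec_translate_right (d : Space) (a b : Space → ℝ) (k : Space) :
    spec a (translate d b) k = (starRingEnd ℂ) (phase d k) * spec a b k := by
  rw [spec, spec, ft_translate, map_mul]
  ring

theorem norm_spec_translate_left (d : Space) (a b : Space → ℝ) (k : Space) :
    ‖spec (translate d a) b k‖ = ‖spec a b k‖ := by
  rw [spec_translate_left, norm_mul, norm_phase, one_mul]

theorem norm_spec_translate_right (d : Space) (a b : Space → ℝ) (k : Space) :
    ‖spec a (translate d b) k‖ = ‖spec a b k‖ := by
  rw [spec_translate_right, norm_mul, RCLike.norm_conj, norm_phase, one_mul]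

theorem spec_translate_left_re (d : Space) (a b : Space → ℝ) (k : Space) :
    (spec (translate d a) b k).re =
      Real.cos (inner ℝ k d) * (spec a b k).re - Real.sin (inner ℝ k d) * (spec a b k).im := by
  rw [spec_translate_left, Complex.mul_re, phase_re, phase_im]

theorem spec_translate_right_re (d : Space) (a b : Space → ℝ) (k : Space) :
    (spec a (translate d b) k).re =
      Real.cos (inner ℝ k d) * (spec a b k).re + Real.sin (inner ℝ k d) * (spec a b k).im := by
  rw [spec_translate_right, Complex.mul_re, Complex.conj_re, Complex.conj_im, phase_re, phase_im]
  ring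

theorem spec_self (a : Space → ℝ) (k : Space) :
    spec a a k = ((‖ft a k‖ ^ 2 / (2 * Real.pi) ^ 3 : ℝ) : ℂ) := by
  rw [spec, Complex.mul_conj, Complex.normSq_eq_norm_sq, ← Complex.ofReal_mul]
  congr 1
  ring

theorem norm_spec (a b : Space → ℝ) (k : Space) :
    ‖spec a b k‖ = ‖ft a k‖ * ‖ft b k‖ / (2 * Real.pi) ^ 3 := by
  rw [spec, norm_mul, norm_mul, RCLike.norm_conj, Complex.norm_real, Real.norm_of_nonneg
    (by positivity)]
  ring

end translated

end DeSitter
end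

noncomputable section
namespace DeSitter

/-! ### The invariants of the two-mode covariance matrix as mode integrals -/

/-- The integrability properties of the smearing functions that enter the covariance metric. -/
structure Smearing (f g : Space → ℝ) : Prop where
  int_f : Integrable f
  int_g : Integrable g
  sq_f : Integrable fun k => ‖ft f k‖ ^ 2
  sq_g : Integrable fun k => ‖ft g k‖ ^ 2
  half_g : Integrable fun k => ‖k‖ * ‖ft g k‖ ^ 2

/-- Power spectrum. -/
def pw (h : Space → ℝ) (k : Space) : ℝ := ‖ft h k‖ ^ 2 / (2 * Real.pi) ^ 3

/-- Common dominating weight. -/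
def psi (f g : Space → ℝ) (k : Space) : ℝ := pw f k + pw g k

theorem pw_nonneg (h : Space → ℝ) (k : Space) : 0 ≤ pw h k := by rw [pw]; positivity

theorem psi_nonneg (f g : Space → ℝ) (k : Space) : 0 ≤ psi f g k :=
  add_nonneg (pw_nonneg f k) (pw_nonneg g k)

theorem continuous_pw {h : Space → ℝ} (hi : Integrable h) : Continuous (pw h) :=
  ((continuous_ft hi).norm.pow 2).div_const _

theorem norm_spec_le (f g : Space → ℝ) (k : Space) : ‖spec f g k‖ ≤ psi f g k := by
  rw [norm_spec, psi, pw, pw, ← add_div]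
  refine div_le_div_of_nonneg_right ?_ (by positivity)
  nlinarith [sq_nonneg (‖ft f k‖ - ‖ft g k‖), norm_nonneg (ft f k), norm_nonneg (ft g k)]

theorem spec_self_re (h : Space → ℝ) (k : Space) : (spec h h k).re = pw h k := by
  rw [spec_self, Complex.ofReal_re, pw]

theorem spec_self_im (h : Space → ℝ) (k : Space) : (spec h h k).im = 0 := by
  rw [spec_self, Complex.ofReal_im]

theorem norm_spec_self (h : Space → ℝ) (k : Space) : ‖spec h h k‖ = pw h k := by
  rw [norm_spec, pw, sq]

/-- Odd-channel power weight; like `wXp` it is used for fields and for momenta. -/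
def wXm (f : Space → ℝ) (d k : Space) : ℝ := pw f k * (1 - Real.cos (inner ℝ k d))

/-- Even-channel power weight. -/
def wXp (f : Space → ℝ) (d k : Space) : ℝ := pw f k * (1 + Real.cos (inner ℝ k d))

/-- Weight of the odd field-momentum correlation between the two regions. -/
def wS (f g : Space → ℝ) (d k : Space) : ℝ := (spec f g k).im * Real.sin (inner ℝ k d)

/-- Weight of the difference of the field-momentum correlations. -/
def wT (f g : Space → ℝ) (d k : Space) : ℝ := (spec f g k).re * (1 - Real.cos (inner ℝ k d))

/-- Weight of the sum of the field-momentum correlations. -/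
def wW (f g : Space → ℝ) (d k : Space) : ℝ := (spec f g k).re * (1 + Real.cos (inner ℝ k d))

/-! ### Orders of vanishing at k = 0 of the trigonometric weights -/

section angles

variable (d k : Space)

theorem one_sub_cos_nonneg (x : ℝ) : 0 ≤ 1 - Real.cos x := by linarith [Real.cos_le_one x]
theorem one_add_cos_nonneg (x : ℝ) : 0 ≤ 1 + Real.cos x := by linarith [Real.neg_one_le_cos x]

theorem abs_inner_le : |(inner ℝ k d : ℝ)| ≤ ‖k‖ * ‖d‖ := abs_real_inner_le_norm k d

/-- The constant 2 + ‖d‖² is larger than needed so that one constant serves all trigonometric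
weights, both for their boundedness and for their vanishing. -/
theorem one_sub_cos_le_sq : 1 - Real.cos (inner ℝ k d) ≤ (2 + ‖d‖ ^ 2) * ‖k‖ ^ 2 := by
  have h1 := Real.one_sub_sq_div_two_le_cos (x := inner ℝ k d)
  have h2 : (inner ℝ k d : ℝ) ^ 2 ≤ (‖k‖ * ‖d‖) ^ 2 := sq_le_sq' (by
    linarith [neg_abs_le (inner ℝ k d : ℝ), abs_inner_le d k]) (by
    linarith [le_abs_self (inner ℝ k d : ℝ), abs_inner_le d k])
  nlinarith [sq_nonneg ‖k‖, sq_nonneg (‖k‖ * ‖d‖)]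

theorem abs_sin_le : |Real.sin (inner ℝ k d)| ≤ (2 + ‖d‖ ^ 2) * ‖k‖ := by
  have h1 := Real.abs_sin_le_abs (x := inner ℝ k d)
  have h2 : ‖d‖ ≤ 2 + ‖d‖ ^ 2 := by nlinarith [sq_nonneg (‖d‖ - 1)]
  nlinarith [abs_inner_le d k, norm_nonneg k, mul_le_mul_of_nonneg_right h2 (norm_nonneg k)]

theorem one_sub_cos_le : 1 - Real.cos (inner ℝ k d) ≤ (2 + ‖d‖ ^ 2) * ‖k‖ := by
  have h1 := Real.one_sub_sq_div_two_le_cos (x := inner ℝ k d)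
  have h2 : ‖d‖ ≤ 2 + ‖d‖ ^ 2 := by nlinarith [sq_nonneg (‖d‖ - 1)]
  have h3 : 1 - Real.cos (inner ℝ k d) ≤ |(inner ℝ k d : ℝ)| := by
    rcases le_total 2 |(inner ℝ k d : ℝ)| with h | h
    · linarith [Real.neg_one_le_cos (inner ℝ k d)]
    · nlinarith [abs_nonneg (inner ℝ k d : ℝ), sq_abs (inner ℝ k d : ℝ)]
  nlinarith [abs_inner_le d k, norm_nonneg k, mul_le_mul_of_nonneg_right h2 (norm_nonneg k)]

theorem abs_sin_le_const : |Real.sin (inner ℝ k d)| ≤ 2 + ‖d‖ ^ 2 := by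
  nlinarith [Real.abs_sin_le_one (inner ℝ k d), sq_nonneg ‖d‖]

theorem one_sub_cos_le_const : 1 - Real.cos (inner ℝ k d) ≤ 2 + ‖d‖ ^ 2 := by
  nlinarith [Real.neg_one_le_cos (inner ℝ k d), sq_nonneg ‖d‖]

theorem one_add_cos_le_const : 1 + Real.cos (inner ℝ k d) ≤ 2 + ‖d‖ ^ 2 := by
  nlinarith [Real.cos_le_one (inner ℝ k d), sq_nonneg ‖d‖]

end angles

section weights

variable (f g : Space → ℝ) (d k : Space)

theorem wXm_nonneg : 0 ≤ wXm f d k := mul_nonneg (pw_nonneg _ _) (one_sub_cos_nonneg _)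
theorem wXp_nonneg : 0 ≤ wXp f d k := mul_nonneg (pw_nonneg _ _) (one_add_cos_nonneg _)

theorem pw_left_le : pw f k ≤ psi f g k := le_add_of_nonneg_right (pw_nonneg _ _)

theorem abs_mul_le_of {x y A B : ℝ} (hx : |x| ≤ A) (hy : |y| ≤ B) : |x * y| ≤ B * A := by
  rw [abs_mul, mul_comm B]
  exact mul_le_mul hx hy (abs_nonneg _) ((abs_nonneg _).trans hx)

theorem abs_pw_le : |pw f k| ≤ psi f g k := by
  rw [abs_of_nonneg (pw_nonneg _ _)]; exact pw_left_le f g k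

theorem abs_re_le : |(spec f g k).re| ≤ psi f g k :=
  (Complex.abs_re_le_norm _).trans (norm_spec_le f g k)

theorem abs_im_le : |(spec f g k).im| ≤ psi f g k :=
  (Complex.abs_im_le_norm _).trans (norm_spec_le f g k)

theorem abs_wXm_le : |wXm f d k| ≤ (2 + ‖d‖ ^ 2) * psi f g k :=
  abs_mul_le_of (abs_pw_le f g k) (by
    rw [abs_of_nonneg (one_sub_cos_nonneg _)]; exact one_sub_cos_le_const d k)

theorem abs_wXm_le_sq : |wXm f d k| ≤ (2 + ‖d‖ ^ 2) * psi f g k * ‖k‖ ^ 2 :=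
  (abs_mul_le_of (abs_pw_le f g k) ((abs_of_nonneg (one_sub_cos_nonneg _)).trans_le
    (one_sub_cos_le_sq d k))).trans_eq (by ring)

theorem abs_wXp_le : |wXp f d k| ≤ (2 + ‖d‖ ^ 2) * psi f g k :=
  abs_mul_le_of (abs_pw_le f g k) (by
    rw [abs_of_nonneg (one_add_cos_nonneg _)]; exact one_add_cos_le_const d k)

theorem abs_wXm_le_pw : |wXm g d k| ≤ (2 + ‖d‖ ^ 2) * pw g k :=
  abs_mul_le_of (abs_of_nonneg (pw_nonneg _ _)).le (by
    rw [abs_of_nonneg (one_sub_cos_nonneg _)]; exact one_sub_cos_le_const d k)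

theorem abs_wXp_le_pw : |wXp g d k| ≤ (2 + ‖d‖ ^ 2) * pw g k :=
  abs_mul_le_of (abs_of_nonneg (pw_nonneg _ _)).le (by
    rw [abs_of_nonneg (one_add_cos_nonneg _)]; exact one_add_cos_le_const d k)

theorem abs_wS_le : |wS f g d k| ≤ (2 + ‖d‖ ^ 2) * psi f g k :=
  abs_mul_le_of (abs_im_le f g k) (abs_sin_le_const d k)

theorem abs_wS_le_norm : |wS f g d k| ≤ (2 + ‖d‖ ^ 2) * psi f g k * ‖k‖ :=
  (abs_mul_le_of (abs_im_le f g k) (abs_sin_le d k)).trans_eq (by ring)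

theorem abs_wT_le : |wT f g d k| ≤ (2 + ‖d‖ ^ 2) * psi f g k :=
  abs_mul_le_of (abs_re_le f g k) (by
    rw [abs_of_nonneg (one_sub_cos_nonneg _)]; exact one_sub_cos_le_const d k)

theorem abs_wT_le_norm : |wT f g d k| ≤ (2 + ‖d‖ ^ 2) * psi f g k * ‖k‖ :=
  (abs_mul_le_of (abs_re_le f g k) ((abs_of_nonneg (one_sub_cos_nonneg _)).trans_le
    (one_sub_cos_le d k))).trans_eq (by ring)

theorem abs_wW_le : |wW f g d k| ≤ (2 + ‖d‖ ^ 2) * psi f g k :=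
  abs_mul_le_of (abs_re_le f g k) (by
    rw [abs_of_nonneg (one_add_cos_nonneg _)]; exact one_add_cos_le_const d k)

end weights

theorem continuous_inner_left (d : Space) : Continuous fun k : Space => (inner ℝ k d : ℝ) :=
  continuous_id.inner continuous_const

namespace Smearing

variable {f g : Space → ℝ}

theorem exists_weightBound (h : Smearing f g) :
    ∃ C, WeightBound (psi f g) C ∧ WeightBound (pw g) C := by
  obtain ⟨C₁, h1, h2⟩ := exists_weight_bound ((continuous_pw h.int_f).add (continuous_pw h.int_g))
    ((h.sq_f.div_const _).add (h.sq_g.div_const _)) (psi_nonneg f g)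
  obtain ⟨C₂, h3, h4⟩ := exists_weight_bound (continuous_pw h.int_g) (h.sq_g.div_const _)
    (pw_nonneg g)
  refine ⟨max C₁ C₂, ⟨le_max_of_le_left h1, psi_nonneg f g, fun p hp hp3 => ⟨(h2 p hp hp3).1,
    (h2 p hp hp3).2.trans (div_le_div_of_nonneg_right (le_max_left _ _) (by linarith))⟩⟩,
    ⟨le_max_of_le_left h1, pw_nonneg g, fun p hp hp3 => ⟨(h4 p hp hp3).1,
    (h4 p hp hp3).2.trans (div_le_div_of_nonneg_right (le_max_right _ _) (by linarith))⟩⟩⟩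

theorem integrable_pw_mul (h : Smearing f g) : Integrable fun k => pw g k * ‖k‖ :=
  (h.half_g.div_const ((2 * Real.pi) ^ 3)).congr (Eventually.of_forall fun k => by
    simp only [pw]; ring)

theorem continuous_re (h : Smearing f g) : Continuous fun k => (spec f g k).re :=
  continuous_spec_re h.int_f h.int_g

theorem continuous_im (h : Smearing f g) : Continuous fun k => (spec f g k).im :=
  Complex.continuous_im.comp (continuous_spec h.int_f h.int_g)

theorem continuous_wXm (h : Smearing f g) (d : Space) : Continuous (wXm f d) :=
  (continuous_pw h.int_f).mul
    (continuous_const.sub (Real.continuous_cos.comp (continuous_inner_left d)))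

theorem continuous_wXp (h : Smearing f g) (d : Space) : Continuous (wXp f d) :=
  (continuous_pw h.int_f).mul
    (continuous_const.add (Real.continuous_cos.comp (continuous_inner_left d)))

theorem continuous_wQm (h : Smearing f g) (d : Space) : Continuous (wXm g d) :=
  (continuous_pw h.int_g).mul
    (continuous_const.sub (Real.continuous_cos.comp (continuous_inner_left d)))

theorem continuous_wQp (h : Smearing f g) (d : Space) : Continuous (wXp g d) :=
  (continuous_pw h.int_g).mul
    (continuous_const.add (Real.continuous_cos.comp (continuous_inner_left d)))

theorem continuous_wS (h : Smearing f g) (d : Space) : Continuous (wS f g d) :=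
  h.continuous_im.mul (Real.continuous_sin.comp (continuous_inner_left d))

theorem continuous_wT (h : Smearing f g) (d : Space) : Continuous (wT f g d) :=
  h.continuous_re.mul
    (continuous_const.sub (Real.continuous_cos.comp (continuous_inner_left d)))

theorem continuous_wW (h : Smearing f g) (d : Space) : Continuous (wW f g d) :=
  h.continuous_re.mul
    (continuous_const.add (Real.continuous_cos.comp (continuous_inner_left d)))

end Smearing

/-! ### The partially transposed spectrum as a function of ε and H -/

section formula

variable {f g : Space → ℝ} {d : Space} {ε r H : ℝ}

theorem alphaOf_neg (Xn Qm Qn s t w : ℝ) :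
    alphaOf Xn Qm Qn (-s) (-t) (-w) = alphaOf Xn Qm Qn s t w := by
  rw [alphaOf, alphaOf]; ring

theorem betaOf_neg (Xm Qm Qn s t : ℝ) : betaOf Xm Qm Qn (-s) (-t) = betaOf Xm Qm Qn s t := by
  rw [betaOf, betaOf]; ring

theorem rhoOf_neg (Xm Qm Qn t w : ℝ) : rhoOf Xm Qm Qn (-t) (-w) = rhoOf Xm Qm Qn t w := by
  rw [rhoOf, rhoOf]; ring

/-- Upper branch of the partially transposed spectrum. -/
def alphaH (f g : Space → ℝ) (d : Space) (ε H : ℝ) : ℝ :=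
  alphaOf (entU ε H (wXp f d)) (entN ε H (wXp g d)) (entN ε H (wXm g d)) (entV ε H (wS f g d))
    (entV ε H (wT f g d)) (entV ε H (wW f g d))

/-- Lower branch of the partially transposed spectrum. -/
def betaH (f g : Space → ℝ) (d : Space) (ε H : ℝ) : ℝ :=
  betaOf (entU ε H (wXm f d)) (entN ε H (wXp g d)) (entN ε H (wXm g d)) (entV ε H (wS f g d))
    (entV ε H (wT f g d))

/-- Coupling of the two branches. -/
def rhoH (f g : Space → ℝ) (d : Space) (ε H : ℝ) : ℝ :=
  rhoOf (entU ε H (wXm f d)) (entN ε H (wXp g d)) (entN ε H (wXm g d))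
    (entV ε H (wT f g d)) (entV ε H (wW f g d))

/-- `ν̃₋²` as a function of `ε` and `H`. -/
def lamH (f g : Space → ℝ) (d : Space) (ε H : ℝ) : ℝ :=
  lamMinus (alphaH f g d ε H) (betaH f g d ε H) (rhoH f g d ε H)

theorem covBlock_pureMode (σ : PhaseSpace → PhaseSpace → ℝ) (f g f' g' : Space → ℝ) :
    covBlock σ (pureMode f g) (pureMode f' g') =
      !![σ (0, f) (0, f'), σ (0, f) (-g', 0); σ (-g, 0) (0, f'), σ (-g, 0) (-g', 0)] := by
  ext i j
  fin_cases i <;> fin_cases j <;> rfl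

/-- Translation multiplies a cross spectrum by e^{±ik·d}: the cosine parts combine into the weights
1 ± cos, and the sine part is the antisymmetric half of the two cross correlations. Overall signs of
s, t and w are irrelevant because only s², t² and tw occur. -/
theorem nuTilde_covOf (h : Smearing f g) (h0 : 0 < epsOf r) (h1 : epsOf r ≤ 1 / 4) (hH : 0 ≤ H)
    (hQ : entN (epsOf r) H (wXm g d) ≠ 0) :
    nuTildeMinusSq (covOf r H) (pureMode f g) (pureMode (translate d f) (translate d g)) =
      lamH f g d (epsOf r) H := by
  obtain ⟨C, hψ, hψg⟩ := h.exists_weightBound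
  have hf := h.int_f
  have hg := h.int_g
  have hTf := integrable_translate d hf
  have hTg := integrable_translate d hg
  have hi := h.integrable_pw_mul
  set ε := epsOf r with hε
  have bff : ∀ k, ‖spec f f k‖ ≤ psi f g k := fun k => by
    rw [norm_spec_self]; exact pw_left_le f g k
  have bgg : Integrable fun k => ‖spec g g k‖ * ‖k‖ := by simpa only [norm_spec_self] using hi
  -- Integrability for a general bounded angular factor θ, used with θ = 1 and θ = cos.
  have cU : ∀ θ : ℝ → ℝ, Continuous θ → (∀ x, |θ x| ≤ 1) →
      Integrable fun k => pw f k * θ (inner ℝ k d) * (uf ε (H / ‖k‖) / ‖k‖) := fun θ hθ hb =>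
    integrable_entU (c := 1) hψ (((continuous_pw hf).mul
      (hθ.comp (continuous_inner_left d))).measurable)
      (fun k => abs_mul_le_of (abs_pw_le f g k) (hb _)) h0 h1 hH
  have cN : ∀ θ : ℝ → ℝ, Continuous θ → (∀ x, |θ x| ≤ 1) →
      Integrable fun k => pw g k * θ (inner ℝ k d) * (Nf ε (H / ‖k‖) * ‖k‖) := fun θ hθ hb =>
    integrable_entN (c := 1) hψg hi (((continuous_pw hg).mul
      (hθ.comp (continuous_inner_left d))).measurable)
      (fun k => abs_mul_le_of (abs_of_nonneg (pw_nonneg _ _)).le (hb _)) h0 h1 hH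
  have cV : ∀ θ : ℝ → ℝ, Continuous θ → (∀ x, |θ x| ≤ 1) →
      Integrable fun k => (spec f g k).re * θ (inner ℝ k d) * vf ε (H / ‖k‖) := fun θ hθ hb =>
    integrable_entV (c := 1) hψ ((h.continuous_re.mul
      (hθ.comp (continuous_inner_left d))).measurable)
      (fun k => abs_mul_le_of (abs_re_le f g k) (hb _)) h0 h1 hH
  have iS := integrable_entV hψ (h.continuous_wS d).measurable (abs_wS_le f g d) h0 h1 hH
  have u1 := cU (fun _ => 1) continuous_const (fun _ => by norm_num)
  have u2 := cU Real.cos Real.continuous_cos Real.abs_cos_le_one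
  have n1 := cN (fun _ => 1) continuous_const (fun _ => by norm_num)
  have n2 := cN Real.cos Real.continuous_cos Real.abs_cos_le_one
  have v1 := cV (fun _ => 1) continuous_const (fun _ => by norm_num)
  have v2 := cV Real.cos Real.continuous_cos Real.abs_cos_le_one
  set S := entU ε H fun k => (spec f f k).re with hS
  set S' := entU ε H fun k => (spec f (translate d f) k).re with hS'
  set q := entN ε H fun k => (spec g g k).re with hq
  set q' := entN ε H fun k => (spec g (translate d g) k).re with hq'
  set p := entV ε H fun k => (spec f g k).re with hp
  set p₁ := entV ε H fun k => (spec f (translate d g) k).re with hp1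
  set p₂ := entV ε H fun k => (spec (translate d f) g k).re with hp2
  have hA : covBlock (covOf r H) (pureMode f g) (pureMode f g) = !![S, -p; -p, q] := by
    rw [covBlock_pureMode, covOf_field hψ hf hf bff h0 h1 hH, covOf_momentum bgg hg hg h0 h1 hH,
      covOf_cross hψ hf hg (norm_spec_le f g) h0 h1 hH,
      covOf_cross' hψ hf hg (norm_spec_le f g) h0 h1 hH]
  have hB : covBlock (covOf r H) (pureMode (translate d f) (translate d g))
      (pureMode (translate d f) (translate d g)) = !![S, -p; -p, q] := by
    rw [covBlock_pureMode,
      covOf_field hψ hTf hTf (fun k => by rw [spec_translate]; exact bff k) h0 h1 hH,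
      covOf_momentum (by simpa only [spec_translate] using bgg) hTg hTg h0 h1 hH,
      covOf_cross hψ hTf hTg (fun k => by rw [spec_translate]; exact norm_spec_le f g k) h0 h1 hH,
      covOf_cross' hψ hTf hTg (fun k => by rw [spec_translate]; exact norm_spec_le f g k) h0 h1 hH]
    simp only [spec_translate]
    rfl
  have hC : covBlock (covOf r H) (pureMode f g) (pureMode (translate d f) (translate d g)) =
      !![S', -p₁; -p₂, q'] := by
    rw [covBlock_pureMode,
      covOf_field hψ hf hTf (fun k => by rw [norm_spec_translate_right]; exact bff k) h0 h1 hH,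
      covOf_momentum (by simpa only [norm_spec_translate_right] using bgg) hg hTg h0 h1 hH,
      covOf_cross hψ hf hTg (fun k => by
        rw [norm_spec_translate_right]; exact norm_spec_le f g k) h0 h1 hH,
      covOf_cross' hψ hTf hg (fun k => by
        rw [norm_spec_translate_left]; exact norm_spec_le f g k) h0 h1 hH]
  have e1 : S + S' = entU ε H (wXp f d) := by
    rw [hS, hS', entU, entU, entU, ← integral_add (by simpa [spec_self_re] using u1)
      (by simpa [spec_translate_right_re, spec_self_re, spec_self_im, mul_comm] using u2)]
    congr 1; ext k
    rw [spec_translate_right_re, spec_self_re, spec_self_im, wXp]; ring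
  have e2 : S - S' = entU ε H (wXm f d) := by
    rw [hS, hS', entU, entU, entU, ← integral_sub (by simpa [spec_self_re] using u1)
      (by simpa [spec_translate_right_re, spec_self_re, spec_self_im, mul_comm] using u2)]
    congr 1; ext k
    rw [spec_translate_right_re, spec_self_re, spec_self_im, wXm]; ring
  have e3 : q + q' = entN ε H (wXp g d) := by
    rw [hq, hq', entN, entN, entN, ← integral_add (by simpa [spec_self_re] using n1)
      (by simpa [spec_translate_right_re, spec_self_re, spec_self_im, mul_comm] using n2)]
    congr 1; ext k
    rw [spec_translate_right_re, spec_self_re, spec_self_im, wXp]; ring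
  have e4 : q - q' = entN ε H (wXm g d) := by
    rw [hq, hq', entN, entN, entN, ← integral_sub (by simpa [spec_self_re] using n1)
      (by simpa [spec_translate_right_re, spec_self_re, spec_self_im, mul_comm] using n2)]
    congr 1; ext k
    rw [spec_translate_right_re, spec_self_re, spec_self_im, wXm]; ring
  have r1 : p₁ = entV ε H (fun k => (spec f g k).re * Real.cos (inner ℝ k d)) +
      entV ε H (wS f g d) := by
    rw [hp1, entV, entV, entV, ← integral_add v2 iS]
    congr 1; ext k
    rw [spec_translate_right_re, wS]; ring
  have r2 : p₂ = entV ε H (fun k => (spec f g k).re * Real.cos (inner ℝ k d)) -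
      entV ε H (wS f g d) := by
    rw [hp2, entV, entV, entV, ← integral_sub v2 iS]
    congr 1; ext k
    rw [spec_translate_left_re, wS]; ring
  have r3 : p - entV ε H (fun k => (spec f g k).re * Real.cos (inner ℝ k d)) =
      entV ε H (wT f g d) := by
    rw [hp, entV, entV, entV, ← integral_sub (by simpa using v1) v2]
    congr 1; ext k
    rw [wT]; ring
  have r4 : p + entV ε H (fun k => (spec f g k).re * Real.cos (inner ℝ k d)) =
      entV ε H (wW f g d) := by
    rw [hp, entV, entV, entV, ← integral_add (by simpa using v1) v2]
    congr 1; ext k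
    rw [wW]; ring
  rw [nuTildeMinusSq_eq hA hB hC (by rw [e4]; exact hQ), e1, e2, e3, e4,
    show (-p₁ - -p₂) / 2 = -entV ε H (wS f g d) by rw [r1, r2]; ring,
    show (2 * -p - -p₁ - -p₂) / 2 = -entV ε H (wT f g d) by rw [r1, r2, ← r3]; ring,
    show (2 * -p + -p₁ + -p₂) / 2 = -entV ε H (wW f g d) by rw [r1, r2, ← r4]; ring,
    alphaOf_neg, betaOf_neg, rhoOf_neg]
  rfl

theorem entanglement_eq (h : Smearing f g) (h0 : 0 < epsOf r) (h1 : epsOf r ≤ 1 / 4) (hH : 0 ≤ H)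
    (hQ : entN (epsOf r) H (wXm g d) ≠ 0) : entanglement f g d r H =
      max 0 (-Real.logb 2 (Real.sqrt (lamH f g d (epsOf r) H))) := by
  rw [← nuTilde_covOf h h0 h1 hH hQ]
  rfl

end formula

end DeSitter
end

noncomputable section
namespace DeSitter

/-! ### Positivity -/

/-- A continuous nonnegative weight that is positive at one nonzero momentum is positive on a
nonempty open set, on which F is positive too once the origin is removed. -/
theorem integral_mul_pos {W F : Space → ℝ} (hW : Continuous W) (hW0 : ∀ k, 0 ≤ W k)
    (hF0 : ∀ k, 0 ≤ F k) (hF : ∀ k, k ≠ 0 → 0 < F k) (hi : Integrable fun k => W k * F k)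
    {k₀ : Space} (hk₀ : k₀ ≠ 0) (hk : 0 < W k₀) : 0 < ∫ k, W k * F k := by
  rw [integral_pos_iff_support_of_nonneg (fun k => mul_nonneg (hW0 k) (hF0 k)) hi]
  have ho : IsOpen ({k | 0 < W k} ∩ {0}ᶜ) :=
    (isOpen_lt continuous_const hW).inter isOpen_compl_singleton
  refine (ho.measure_pos volume ⟨k₀, hk, hk₀⟩).trans_le (measure_mono fun k hk => ?_)
  exact (mul_pos hk.1 (hF k hk.2)).ne'

/-- If sin(k·d) = 0, moving k along d by a small τ > 0 gives ±sin(τ‖d‖²) ≠ 0. -/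
theorem exists_sin_ne_zero {d : Space} (hd : d ≠ 0) {U : Set Space} (hU : IsOpen U)
    (hne : U.Nonempty) : ∃ k ∈ U, Real.sin (inner ℝ k d) ≠ 0 := by
  obtain ⟨k, hk⟩ := hne
  by_cases hs : Real.sin (inner ℝ k d) = 0
  · have hd2 : 0 < ‖d‖ ^ 2 := by positivity
    have hc : Tendsto (fun τ : ℝ => k + τ • d) (𝓝[>] 0) (𝓝 k) := by
      have : Continuous fun τ : ℝ => k + τ • d := by fun_prop
      simpa using (this.tendsto 0).mono_left nhdsWithin_le_nhds
    have h1 : ∀ᶠ τ : ℝ in 𝓝[>] 0, k + τ • d ∈ U := hc (hU.mem_nhds hk)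
    have h2 : ∀ᶠ τ : ℝ in 𝓝[>] 0, τ < Real.pi / ‖d‖ ^ 2 :=
      nhdsWithin_le_nhds (Iio_mem_nhds (by positivity))
    obtain ⟨τ, ⟨hτU, hτ⟩, hτ0 : 0 < τ⟩ := ((h1.and h2).and self_mem_nhdsWithin).exists
    refine ⟨_, hτU, ?_⟩
    have e : (inner ℝ (k + τ • d) d : ℝ) = inner ℝ k d + τ * ‖d‖ ^ 2 := by
      rw [inner_add_left, inner_smul_left, real_inner_self_eq_norm_sq]; simp
    rw [e, Real.sin_add, hs, zero_mul, zero_add]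
    have hcos : Real.cos (inner ℝ k d) ≠ 0 := fun h => by
      have := Real.sin_sq_add_cos_sq (inner ℝ k d)
      rw [hs, h] at this
      norm_num at this
    exact mul_ne_zero hcos (Real.sin_pos_of_pos_of_lt_pi (by positivity)
      ((lt_div_iff₀ hd2).1 hτ)).ne'
  · exact ⟨k, hk, hs⟩

/-- Where sin(k·d) ≠ 0 both factors of (1 - cos)(1 + cos) = sin² are positive. -/
theorem exists_weights_pos {d : Space} (hd : d ≠ 0) {a : Space → ℝ} (ha : Integrable a)
    (hne : ∃ k, ft a k ≠ 0) : ∃ k : Space, k ≠ 0 ∧ 0 < wXm a d k ∧ 0 < wXp a d k := by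
  obtain ⟨k, hk, hs⟩ := exists_sin_ne_zero hd
    ((continuous_ft ha).isOpen_preimage _ isOpen_compl_singleton : IsOpen {k | ft a k ≠ 0}) hne
  have hp : 0 < pw a k := by
    have : 0 < ‖ft a k‖ := norm_pos_iff.2 hk
    rw [pw]; positivity
  have h2 : 0 < (1 - Real.cos (inner ℝ k d)) * (1 + Real.cos (inner ℝ k d)) := by
    have := Real.sin_sq_add_cos_sq (inner ℝ k d)
    have := sq_pos_of_ne_zero hs
    nlinarith
  have h4 : 0 < 1 + Real.cos (inner ℝ k d) := by
    rcases (one_add_cos_nonneg (inner ℝ k d)).eq_or_lt with h | h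
    · rw [← h] at h2; simp at h2
    · exact h
  refine ⟨k, ?_, mul_pos hp ?_, mul_pos hp h4⟩
  · rintro rfl
    simp at hs
  · nlinarith

section

variable {f g : Space → ℝ} {d : Space} {ε H : ℝ}

namespace Smearing

theorem integrable_Xm (h : Smearing f g) (h0 : 0 < ε) (h1 : ε ≤ 1 / 4) (hH : 0 ≤ H) :
    Integrable fun k => wXm f d k * (uf ε (H / ‖k‖) / ‖k‖) := by
  obtain ⟨C, hψ, -⟩ := h.exists_weightBound
  exact integrable_entU hψ (h.continuous_wXm d).measurable (abs_wXm_le f g d) h0 h1 hH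

theorem integrable_Xp (h : Smearing f g) (h0 : 0 < ε) (h1 : ε ≤ 1 / 4) (hH : 0 ≤ H) :
    Integrable fun k => wXp f d k * (uf ε (H / ‖k‖) / ‖k‖) := by
  obtain ⟨C, hψ, -⟩ := h.exists_weightBound
  exact integrable_entU hψ (h.continuous_wXp d).measurable (abs_wXp_le f g d) h0 h1 hH

theorem integrable_Qm (h : Smearing f g) (h0 : 0 < ε) (h1 : ε ≤ 1 / 4) (hH : 0 ≤ H) :
    Integrable fun k => wXm g d k * (Nf ε (H / ‖k‖) * ‖k‖) := by
  obtain ⟨C, -, hψ⟩ := h.exists_weightBound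
  exact integrable_entN hψ h.integrable_pw_mul (h.continuous_wQm d).measurable
    (abs_wXm_le_pw g d) h0 h1 hH

theorem integrable_Qp (h : Smearing f g) (h0 : 0 < ε) (h1 : ε ≤ 1 / 4) (hH : 0 ≤ H) :
    Integrable fun k => wXp g d k * (Nf ε (H / ‖k‖) * ‖k‖) := by
  obtain ⟨C, -, hψ⟩ := h.exists_weightBound
  exact integrable_entN hψ h.integrable_pw_mul (h.continuous_wQp d).measurable
    (abs_wXp_le_pw g d) h0 h1 hH

theorem integrable_T (h : Smearing f g) (h0 : 0 < ε) (h1 : ε ≤ 1 / 4) (hH : 0 ≤ H) :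
    Integrable fun k => wT f g d k * vf ε (H / ‖k‖) := by
  obtain ⟨C, hψ, -⟩ := h.exists_weightBound
  exact integrable_entV hψ (h.continuous_wT d).measurable (abs_wT_le f g d) h0 h1 hH

end Smearing

theorem wT_sq_le (f g : Space → ℝ) (d k : Space) : wT f g d k ^ 2 ≤ wXm f d k * wXm g d k := by
  have h1 : (spec f g k).re ^ 2 ≤ pw f k * pw g k := by
    have h2 := sq_le_sq' (by linarith [neg_abs_le (spec f g k).re, Complex.abs_re_le_norm (spec f g k)])
      (Complex.re_le_norm (spec f g k))
    refine h2.trans_eq ?_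
    rw [norm_spec, pw, pw]; ring
  rw [wT, wXm, wXm, mul_pow]
  calc _ ≤ pw f k * pw g k * (1 - Real.cos (inner ℝ k d)) ^ 2 :=
        mul_le_mul_of_nonneg_right h1 (sq_nonneg _)
    _ = _ := by ring

/-- Cauchy-Schwarz for the mode integrals: the quadratic in x is the integral of a pointwise
nonnegative form, so its discriminant is nonpositive. -/
theorem entV_sq_le (h : Smearing f g) (h0 : 0 < ε) (h1 : ε ≤ 1 / 4) (hH : 0 ≤ H) :
    entV ε H (wT f g d) ^ 2 ≤ entU ε H (wXm f d) * entN ε H (wXm g d) := by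
  have iX := h.integrable_Xm (d := d) h0 h1 hH
  have iQ := h.integrable_Qm (d := d) h0 h1 hH
  have iT := h.integrable_T (d := d) h0 h1 hH
  have key : ∀ x : ℝ, 0 ≤ entU ε H (wXm f d) * (x * x) + (2 * entV ε H (wT f g d)) * x +
      entN ε H (wXm g d) := fun x => by
    have e : entU ε H (wXm f d) * (x * x) + (2 * entV ε H (wT f g d)) * x + entN ε H (wXm g d) =
        ∫ k, (wXm f d k * (uf ε (H / ‖k‖) / ‖k‖) * (x * x) +
          wT f g d k * vf ε (H / ‖k‖) * (2 * x) + wXm g d k * (Nf ε (H / ‖k‖) * ‖k‖)) := by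
      have i1 := iX.mul_const (x * x)
      have i2 := iT.mul_const (2 * x)
      have i12 : Integrable fun k => wXm f d k * (uf ε (H / ‖k‖) / ‖k‖) * (x * x) +
          wT f g d k * vf ε (H / ‖k‖) * (2 * x) := i1.add i2
      rw [integral_add i12 iQ, integral_add i1 i2, integral_mul_const, integral_mul_const,
        entU, entV, entN]
      ring
    rw [e]
    refine integral_nonneg_of_ae ?_
    filter_upwards [ae_ne_zero] with k hk
    have hk' : 0 < ‖k‖ := norm_pos_iff.2 hk
    set A := wXm f d k * (uf ε (H / ‖k‖) / ‖k‖) with hA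
    set B := wXm g d k * (Nf ε (H / ‖k‖) * ‖k‖) with hB
    set T := wT f g d k * vf ε (H / ‖k‖) with hT
    have hA0 : 0 ≤ A := mul_nonneg (wXm_nonneg _ _ _) (div_nonneg (uf_nonneg _ _) hk'.le)
    have hB0 : 0 ≤ B := mul_nonneg (wXm_nonneg _ _ _) (mul_nonneg (Nf_nonneg _ _) hk'.le)
    have hv : vf ε (H / ‖k‖) ^ 2 ≤ uf ε (H / ‖k‖) * Nf ε (H / ‖k‖) := by
      have h3 := abs_vf_le ε (H / ‖k‖)
      rw [← sq_abs]
      calc _ ≤ (Real.sqrt (uf ε (H / ‖k‖)) * Real.sqrt (Nf ε (H / ‖k‖))) ^ 2 :=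
            pow_le_pow_left₀ (abs_nonneg _) h3 2
        _ = _ := by rw [mul_pow, Real.sq_sqrt (uf_nonneg _ _), Real.sq_sqrt (Nf_nonneg _ _)]
    have hTAB : T ^ 2 ≤ A * B := by
      rw [hT, mul_pow]
      calc _ ≤ wXm f d k * wXm g d k * (uf ε (H / ‖k‖) * Nf ε (H / ‖k‖)) :=
            mul_le_mul (wT_sq_le f g d k) hv (sq_nonneg _)
              (mul_nonneg (wXm_nonneg _ _ _) (wXm_nonneg _ _ _))
        _ = _ := by rw [hA, hB]; field_simp
    change 0 ≤ A * (x * x) + T * (2 * x) + B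
    -- Multiplying by A completes the square. In the degenerate case A = 0 the bound T² ≤ AB forces
    -- T = 0.
    rcases hA0.eq_or_lt with h | h
    · have : T = 0 := by
        rw [← h, zero_mul] at hTAB
        exact pow_eq_zero_iff (two_ne_zero) |>.1 (le_antisymm hTAB (sq_nonneg _))
      rw [← h, this]; simpa using hB0
    · have : 0 ≤ A * (A * (x * x) + T * (2 * x) + B) := by nlinarith [sq_nonneg (A * x + T)]
      exact nonneg_of_mul_nonneg_right this h
  have := discrim_le_zero key
  rw [discrim] at this
  nlinarith

theorem rhoH_nonneg (h : Smearing f g) (h0 : 0 < ε) (h1 : ε ≤ 1 / 4) (hH : 0 ≤ H) :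
    0 ≤ rhoH f g d ε H :=
  mul_nonneg (sub_nonneg.2 (entV_sq_le h h0 h1 hH)) (sq_nonneg _)

/-! ### The slope of the lower branch -/

/-- Numerator of the Gram integrand. -/
def gramVec (f g : Space → ℝ) (d : Space) (A B : ℝ) (k : Space) : ℂ :=
  ft f k * (1 - phase d k) -
    ((‖k‖ ^ 2 : ℝ) : ℂ) * (ft g k * ((A : ℂ) * (1 + phase d k) + (B : ℂ) * (1 - phase d k)))

/-- The factors 1 + e^{ik·d} and 1 - e^{ik·d} are orthogonal over the reals, so no AB term appears.
The factor 1/2 compensates |1 ∓ e^{ik·d}|² = 2(1 ∓ cos). -/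
theorem gramVec_eq (f g : Space → ℝ) (d : Space) (A B : ℝ) {k : Space} (hk : k ≠ 0) :
    ‖gramVec f g d A B k‖ ^ 2 * (1 / (2 * (2 * Real.pi) ^ 3)) * (1 / ‖k‖ ^ 3) =
      wXm f d k / ‖k‖ ^ 3 + A ^ 2 * (wXp g d k * ‖k‖) + B ^ 2 * (wXm g d k * ‖k‖) -
        2 * A * (wS f g d k / ‖k‖) - 2 * B * (wT f g d k / ‖k‖) := by
  have hk' : 0 < ‖k‖ := norm_pos_iff.2 hk
  have hs := Real.sin_sq_add_cos_sq (inner ℝ k d)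
  rw [gramVec, wXm, wXp, wXm, wS, wT, spec, Complex.re_ofReal_mul, Complex.im_ofReal_mul, pw, pw]
  simp only [← Complex.normSq_eq_norm_sq, Complex.normSq_apply]
  simp only [Complex.sub_re, Complex.sub_im, Complex.mul_re, Complex.mul_im, Complex.ofReal_re,
    Complex.ofReal_im, Complex.add_re, Complex.add_im, Complex.one_re, Complex.one_im, phase_re,
    phase_im, Complex.conj_re, Complex.conj_im]
  set c := Real.cos (inner ℝ k d)
  set s := Real.sin (inner ℝ k d)
  generalize (ft f k).re = f1
  generalize (ft f k).im = f2
  generalize (ft g k).re = g1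
  generalize (ft g k).im = g2
  generalize ‖k‖ = κ at hk' ⊢
  have hpi : 0 < (2 * Real.pi) ^ 3 := by positivity
  generalize (2 * Real.pi) ^ 3 = P at hpi ⊢
  field_simp
  linear_combination (f1 ^ 2 + f2 ^ 2 + κ ^ 4 * (g1 ^ 2 + g2 ^ 2) * (A - B) ^ 2 -
    2 * κ ^ 2 * (f1 * g1 + f2 * g2) * (B - A)) * hs

theorem continuous_phase (d : Space) : Continuous (phase d) :=
  Complex.continuous_exp.comp (continuous_const.mul
    (Complex.continuous_ofReal.comp (continuous_inner_left d)))

theorem continuous_gramVec (h : Smearing f g) (A B : ℝ) : Continuous (gramVec f g d A B) := by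
  have h1 := continuous_ft h.int_f
  have h2 := continuous_ft h.int_g
  have h3 := continuous_phase d
  unfold gramVec
  fun_prop

theorem abs_sin_le_norm_one_sub_phase (d k : Space) :
    |Real.sin (inner ℝ k d)| ≤ ‖1 - phase d k‖ := by
  have := Complex.abs_im_le_norm (1 - phase d k)
  rwa [Complex.sub_im, Complex.one_im, phase_im, zero_sub, abs_neg] at this

/-- Along k = τd the term with f̃ is at least of order τ because f̃(0) ≠ 0, while the term with g̃
is of order τ². They cannot cancel for small τ > 0. -/
theorem exists_gramVec_ne_zero (h : Smearing f g) (hd : d ≠ 0) (h0 : ft f 0 ≠ 0) (A B : ℝ) :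
    ∃ k : Space, k ≠ 0 ∧ gramVec f g d A B k ≠ 0 := by
  have hd0 : 0 < ‖d‖ := norm_pos_iff.2 hd
  have hd2 : 0 < ‖d‖ ^ 2 := by positivity
  set c := ‖ft f 0‖ / 2 with hc
  have hc0 : 0 < c := half_pos (norm_pos_iff.2 h0)
  set M := ‖ft g 0‖ + 1 with hM
  have hM0 : 0 < M := by positivity
  have hcont : Tendsto (fun τ : ℝ => τ • d) (𝓝[>] 0) (𝓝 0) := by
    have : Continuous fun τ : ℝ => τ • d := by fun_prop
    simpa using (this.tendsto 0).mono_left nhdsWithin_le_nhds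
  have e1 : ∀ᶠ τ : ℝ in 𝓝[>] 0, c < ‖ft f (τ • d)‖ :=
    (((continuous_ft h.int_f).norm.tendsto 0).comp hcont).eventually
      (lt_mem_nhds (half_lt_self (norm_pos_iff.2 h0)))
  have e2 : ∀ᶠ τ : ℝ in 𝓝[>] 0, ‖ft g (τ • d)‖ < M :=
    (((continuous_ft h.int_g).norm.tendsto 0).comp hcont).eventually
      (gt_mem_nhds (lt_add_one _))
  have e3 : ∀ᶠ τ : ℝ in 𝓝[>] 0, τ < Real.pi / 2 / ‖d‖ ^ 2 :=
    nhdsWithin_le_nhds (Iio_mem_nhds (by positivity))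
  -- The threshold comes from comparing c·(2/π)τ‖d‖², by Jordan's inequality for the sine, with
  -- τ²‖d‖² times the bound on the g̃ term. The added 1 keeps the denominator positive when A = B =
  -- 0.
  have e4 : ∀ᶠ τ : ℝ in 𝓝[>] 0, τ < c * (2 / Real.pi) / (M * (2 * |A| + 2 * |B| + 1)) :=
    nhdsWithin_le_nhds (Iio_mem_nhds (by positivity))
  obtain ⟨τ, ⟨⟨⟨hτ1, hτ2⟩, hτ3⟩, hτ4⟩, hτ0 : 0 < τ⟩ :=
    ((((e1.and e2).and e3).and e4).and self_mem_nhdsWithin).exists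
  refine ⟨τ • d, smul_ne_zero hτ0.ne' hd, fun hz => ?_⟩
  have hin : (inner ℝ (τ • d) d : ℝ) = τ * ‖d‖ ^ 2 := by
    rw [inner_smul_left, real_inner_self_eq_norm_sq]; simp
  have hsin : 2 / Real.pi * (τ * ‖d‖ ^ 2) ≤ ‖1 - phase d (τ • d)‖ := by
    have h1 := Real.mul_le_sin (x := τ * ‖d‖ ^ 2) (by positivity)
      ((lt_div_iff₀ hd2).1 hτ3).le
    have h2 := abs_sin_le_norm_one_sub_phase d (τ • d)
    rw [hin] at h2
    exact h1.trans ((le_abs_self _).trans h2)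
  have hn : ‖τ • d‖ ^ 2 = τ ^ 2 * ‖d‖ ^ 2 := by
    rw [norm_smul, mul_pow, Real.norm_eq_abs, sq_abs]
  have hcomb : ‖(A : ℂ) * (1 + phase d (τ • d)) + (B : ℂ) * (1 - phase d (τ • d))‖ ≤
      2 * |A| + 2 * |B| := by
    have p1 : ‖1 + phase d (τ • d)‖ ≤ 2 :=
      (norm_add_le _ _).trans_eq (by rw [norm_phase, norm_one]; norm_num)
    have p2 : ‖1 - phase d (τ • d)‖ ≤ 2 :=
      (norm_sub_le _ _).trans_eq (by rw [norm_phase, norm_one]; norm_num)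
    refine (norm_add_le _ _).trans ?_
    rw [norm_mul, norm_mul, Complex.norm_real, Complex.norm_real, Real.norm_eq_abs,
      Real.norm_eq_abs]
    nlinarith [abs_nonneg A, abs_nonneg B]
  rw [gramVec, sub_eq_zero] at hz
  have hz' := congrArg norm hz
  rw [norm_mul, norm_mul, norm_mul, Complex.norm_real, Real.norm_of_nonneg (by positivity), hn]
    at hz'
  have l1 : c * (2 / Real.pi * (τ * ‖d‖ ^ 2)) ≤ ‖ft f (τ • d)‖ * ‖1 - phase d (τ • d)‖ :=
    mul_le_mul hτ1.le hsin (by positivity) (norm_nonneg _)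
  have l2 : τ ^ 2 * ‖d‖ ^ 2 * (‖ft g (τ • d)‖ *
      ‖(A : ℂ) * (1 + phase d (τ • d)) + (B : ℂ) * (1 - phase d (τ • d))‖) ≤
      τ ^ 2 * ‖d‖ ^ 2 * (M * (2 * |A| + 2 * |B| + 1)) :=
    mul_le_mul_of_nonneg_left (mul_le_mul hτ2.le (by linarith) (norm_nonneg _) hM0.le)
      (by positivity)
  rw [lt_div_iff₀ (by positivity)] at hτ4
  have l3 : τ * ‖d‖ ^ 2 * (τ * (M * (2 * |A| + 2 * |B| + 1))) <
      τ * ‖d‖ ^ 2 * (c * (2 / Real.pi)) := mul_lt_mul_of_pos_left hτ4 (by positivity)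
  nlinarith

namespace Smearing

theorem integrable_mul_norm (h : Smearing f g) :
    Integrable (fun k => wXp g d k * ‖k‖) ∧ Integrable (fun k => wXm g d k * ‖k‖) := by
  have h1 := h.integrable_Qp (d := d) (ε := 1 / 4) (H := 0) (by norm_num) le_rfl le_rfl
  have h2 := h.integrable_Qm (d := d) (ε := 1 / 4) (H := 0) (by norm_num) le_rfl le_rfl
  simp only [zero_div, Nf_zero (show (1 / 4 : ℝ) < 1 by norm_num), one_mul] at h1 h2
  exact ⟨h1, h2⟩

theorem integrable_div_norm (h : Smearing f g) :
    Integrable (fun k => wXp f d k / ‖k‖) ∧ Integrable (fun k => wXm f d k / ‖k‖) := by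
  have h1 := h.integrable_Xp (d := d) (ε := 1 / 4) (H := 0) (by norm_num) le_rfl le_rfl
  have h2 := h.integrable_Xm (d := d) (ε := 1 / 4) (H := 0) (by norm_num) le_rfl le_rfl
  simp only [zero_div, uf_zero (show (1 / 4 : ℝ) < 1 by norm_num)] at h1 h2
  exact ⟨by simpa [div_eq_mul_inv] using h1, by simpa [div_eq_mul_inv] using h2⟩

end Smearing

theorem integral_wXp_momentum_pos (h : Smearing f g) (hd : d ≠ 0) (hg : ∃ k, ft g k ≠ 0) :
    0 < ∫ k, wXp g d k * ‖k‖ := by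
  obtain ⟨k, hk, -, hp⟩ := exists_weights_pos hd h.int_g hg
  exact integral_mul_pos (h.continuous_wQp d) (wXp_nonneg g d) (fun k => norm_nonneg k)
    (fun k hk => norm_pos_iff.2 hk) h.integrable_mul_norm.1 hk hp

theorem integral_wXm_momentum_pos (h : Smearing f g) (hd : d ≠ 0) (hg : ∃ k, ft g k ≠ 0) :
    0 < ∫ k, wXm g d k * ‖k‖ := by
  obtain ⟨k, hk, hp, -⟩ := exists_weights_pos hd h.int_g hg
  exact integral_mul_pos (h.continuous_wQm d) (wXm_nonneg g d) (fun k => norm_nonneg k)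
    (fun k hk => norm_pos_iff.2 hk) h.integrable_mul_norm.2 hk hp

theorem integral_wXp_field_pos (h : Smearing f g) (hd : d ≠ 0) (hf : ∃ k, ft f k ≠ 0) :
    0 < ∫ k, wXp f d k / ‖k‖ := by
  obtain ⟨k, hk, -, hp⟩ := exists_weights_pos hd h.int_f hf
  have := (h.integrable_div_norm (d := d)).1
  simp only [div_eq_mul_inv] at this ⊢
  exact integral_mul_pos (h.continuous_wXp d) (wXp_nonneg f d) (fun k => inv_nonneg.2 (norm_nonneg k))
    (fun k hk => inv_pos.2 (norm_pos_iff.2 hk)) this hk hp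

theorem integral_wXm_field_pos (h : Smearing f g) (hd : d ≠ 0) (hf : ∃ k, ft f k ≠ 0) :
    0 < ∫ k, wXm f d k / ‖k‖ := by
  obtain ⟨k, hk, hp, -⟩ := exists_weights_pos hd h.int_f hf
  have := (h.integrable_div_norm (d := d)).2
  simp only [div_eq_mul_inv] at this ⊢
  exact integral_mul_pos (h.continuous_wXm d) (wXm_nonneg f d) (fun k => inv_nonneg.2 (norm_nonneg k))
    (fun k hk => inv_pos.2 (norm_pos_iff.2 hk)) this hk hp

/-- Slope of the lower branch in `H²`. -/
def slope (f g : Space → ℝ) (d : Space) : ℝ :=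
  (∫ k, wXm f d k / ‖k‖ ^ 3) * (∫ k, wXp g d k * ‖k‖) - (∫ k, wS f g d k / ‖k‖) ^ 2 -
    (∫ k, wT f g d k / ‖k‖) ^ 2 * ((∫ k, wXp g d k * ‖k‖) * (∫ k, wXm g d k * ‖k‖)⁻¹)

/-- With A = s/P and B = t/M the integral of the Gram integrand is its minimum X - s²/P - t²/M over
A and B, and the slope is P times it. The integrand is continuous away from k = 0 and does not
vanish identically. -/
theorem slope_pos (h : Smearing f g) (hd : d ≠ 0) (h0 : ft f 0 ≠ 0) (hg : ∃ k, ft g k ≠ 0) :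
    0 < slope f g d := by
  obtain ⟨C, hψ, -⟩ := h.exists_weightBound
  have hQp := integral_wXp_momentum_pos h hd hg
  have hQm := integral_wXm_momentum_pos h hd hg
  have iX := integrable_div_pow_three hψ (h.continuous_wXm d).measurable (abs_wXm_le_sq f g d)
  have iS := integrable_div_norm_of_le hψ (h.continuous_wS d).measurable (abs_wS_le_norm f g d)
  have iT := integrable_div_norm_of_le hψ (h.continuous_wT d).measurable (abs_wT_le_norm f g d)
  obtain ⟨iP, iM⟩ := h.integrable_mul_norm (d := d)
  rw [slope]
  set X := ∫ k, wXm f d k / ‖k‖ ^ 3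
  set P := ∫ k, wXp g d k * ‖k‖
  set M := ∫ k, wXm g d k * ‖k‖
  set s := ∫ k, wS f g d k / ‖k‖
  set t := ∫ k, wT f g d k / ‖k‖
  obtain ⟨k₀, hk₀, hv⟩ := exists_gramVec_ne_zero h hd h0 (s / P) (t / M)
  set A := s / P
  set B := t / M
  have j1 : Integrable fun k => wXm f d k / ‖k‖ ^ 3 + A ^ 2 * (wXp g d k * ‖k‖) :=
    iX.add (iP.const_mul _)
  have j2 : Integrable fun k => wXm f d k / ‖k‖ ^ 3 + A ^ 2 * (wXp g d k * ‖k‖) +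
    B ^ 2 * (wXm g d k * ‖k‖) := j1.add (iM.const_mul _)
  have j3 : Integrable fun k => wXm f d k / ‖k‖ ^ 3 + A ^ 2 * (wXp g d k * ‖k‖) +
    B ^ 2 * (wXm g d k * ‖k‖) - 2 * A * (wS f g d k / ‖k‖) := j2.sub (iS.const_mul _)
  have j4 : Integrable fun k => wXm f d k / ‖k‖ ^ 3 + A ^ 2 * (wXp g d k * ‖k‖) +
    B ^ 2 * (wXm g d k * ‖k‖) - 2 * A * (wS f g d k / ‖k‖) - 2 * B * (wT f g d k / ‖k‖) :=
    j3.sub (iT.const_mul _)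
  have hae : ∀ᵐ k : Space, wXm f d k / ‖k‖ ^ 3 + A ^ 2 * (wXp g d k * ‖k‖) +
      B ^ 2 * (wXm g d k * ‖k‖) - 2 * A * (wS f g d k / ‖k‖) - 2 * B * (wT f g d k / ‖k‖) =
      ‖gramVec f g d A B k‖ ^ 2 * (1 / (2 * (2 * Real.pi) ^ 3)) * (1 / ‖k‖ ^ 3) := by
    filter_upwards [ae_ne_zero] with k hk
    exact (gramVec_eq f g d A B hk).symm
  have hpos : 0 < ∫ k, ‖gramVec f g d A B k‖ ^ 2 * (1 / (2 * (2 * Real.pi) ^ 3)) *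
      (1 / ‖k‖ ^ 3) := by
    refine integral_mul_pos (((continuous_gramVec h A B).norm.pow 2).mul continuous_const)
      (fun k => by positivity) (fun k => by positivity) (fun k hk => ?_) (j4.congr hae) hk₀ ?_
    · have hk' : 0 < ‖k‖ := norm_pos_iff.2 hk
      positivity
    · have := norm_pos_iff.2 hv
      positivity
  rw [← integral_congr_ae hae, integral_sub j3 (iT.const_mul _), integral_sub j2 (iS.const_mul _),
    integral_add j1 (iM.const_mul _), integral_add iX (iP.const_mul _), integral_const_mul,
    integral_const_mul, integral_const_mul, integral_const_mul] at hpos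
  change 0 < X + A ^ 2 * P + B ^ 2 * M - 2 * A * s - 2 * B * t at hpos
  have e : X * P - s ^ 2 - t ^ 2 * (P * M⁻¹) =
      P * (X + A ^ 2 * P + B ^ 2 * M - 2 * A * s - 2 * B * t) := by
    simp only [A, B]
    field_simp
    ring
  rw [e]
  exact mul_pos hQp hpos

end
end DeSitter
end

noncomputable section
namespace DeSitter

/-! ### Increments of functions of `(ε, H)` that are uniform in `H ∈ [0, H₁]` as `ε → 0⁺` -/

/-- `F ε 0 = b` and `F` grows like `a H²` up to an error of relative order `ε`. -/
def QuadAsymp (H₁ : ℝ) (F : ℝ → ℝ → ℝ) (b a : ℝ) : Prop :=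
  (∀ᶠ ε in 𝓝[>] (0 : ℝ), F ε 0 = b) ∧ ∃ C, 0 ≤ C ∧ ∀ᶠ ε in 𝓝[>] (0 : ℝ), ∀ H H', 0 ≤ H → H ≤ H' →
    H' ≤ H₁ → |F ε H' - F ε H - a * (H' ^ 2 - H ^ 2)| ≤ C * ε * (H' ^ 2 - H ^ 2)

/-- `F ε 0 = 0` and `F` grows like `a H` up to an error of relative order `ε`. -/
def LinAsymp (H₁ : ℝ) (F : ℝ → ℝ → ℝ) (a : ℝ) : Prop :=
  (∀ᶠ ε in 𝓝[>] (0 : ℝ), F ε 0 = 0) ∧ ∃ C, 0 ≤ C ∧ ∀ᶠ ε in 𝓝[>] (0 : ℝ), ∀ H H', 0 ≤ H → H ≤ H' →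
    H' ≤ H₁ → |F ε H' - F ε H - a * (H' - H)| ≤ C * ε * (H' - H)

/-- `F ε 0 = 0` and `F` is Lipschitz in `H`. -/
def LipAsymp (H₁ : ℝ) (F : ℝ → ℝ → ℝ) : Prop :=
  (∀ᶠ ε in 𝓝[>] (0 : ℝ), F ε 0 = 0) ∧ ∃ C, 0 ≤ C ∧ ∀ᶠ ε in 𝓝[>] (0 : ℝ), ∀ H H', 0 ≤ H → H ≤ H' →
    H' ≤ H₁ → |F ε H' - F ε H| ≤ C * (H' - H)

/-- `F` is bounded and Lipschitz in `H²`. -/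
def LipSqAsymp (H₁ : ℝ) (F : ℝ → ℝ → ℝ) : Prop :=
  ∃ C, 0 ≤ C ∧ ∀ᶠ ε in 𝓝[>] (0 : ℝ), ∀ H H', 0 ≤ H → H ≤ H' →
    H' ≤ H₁ → |F ε H' - F ε H| ≤ C * (H' ^ 2 - H ^ 2) ∧ |F ε H'| ≤ C

theorem eventually_pos : ∀ᶠ ε in 𝓝[>] (0 : ℝ), 0 < ε := self_mem_nhdsWithin

theorem eventually_le_of_pos {c : ℝ} (hc : 0 < c) : ∀ᶠ ε in 𝓝[>] (0 : ℝ), ε ≤ c :=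
  nhdsWithin_le_nhds (Iic_mem_nhds hc)

variable {H₁ a a' b b' : ℝ} {F G : ℝ → ℝ → ℝ}

theorem QuadAsymp.lipSq (hF : QuadAsymp H₁ F b a) : LipSqAsymp H₁ F := by
  obtain ⟨h0, C, hC, h⟩ := hF
  -- One constant serves both the Lipschitz bound and the sup bound.
  refine ⟨|b| + (|a| + C) * (1 + H₁ ^ 2), by positivity, ?_⟩
  filter_upwards [h0, h, eventually_pos, eventually_le_of_pos one_pos] with ε h0 h hε hε1 H H' hH hHH hH1
  have key : ∀ H, 0 ≤ H → H ≤ H' → |F ε H' - F ε H| ≤ (|a| + C) * (H' ^ 2 - H ^ 2) := by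
    intro H hH hHH
    have hn : 0 ≤ H' ^ 2 - H ^ 2 := by nlinarith
    have h1 := h H H' hH hHH hH1
    have h2 := abs_add_le (F ε H' - F ε H - a * (H' ^ 2 - H ^ 2)) (a * (H' ^ 2 - H ^ 2))
    rw [sub_add_cancel, abs_mul a, abs_of_nonneg hn] at h2
    have h3 : C * ε * (H' ^ 2 - H ^ 2) ≤ C * 1 * (H' ^ 2 - H ^ 2) := by gcongr
    linarith
  have hn : 0 ≤ H' ^ 2 - H ^ 2 := by nlinarith
  have hsq : H' ^ 2 ≤ H₁ ^ 2 := by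
    have := hH.trans hHH
    gcongr
  constructor
  · refine (key H hH hHH).trans (mul_le_mul_of_nonneg_right ?_ hn)
    have : 0 ≤ (|a| + C) * H₁ ^ 2 := by positivity
    nlinarith [abs_nonneg b]
  · have h1 := key 0 le_rfl (hH.trans hHH)
    rw [h0] at h1
    have h2 := abs_add_le (F ε H' - b) b
    rw [sub_add_cancel] at h2
    have : (|a| + C) * (H' ^ 2 - 0 ^ 2) ≤ (|a| + C) * (1 + H₁ ^ 2) := by
      refine mul_le_mul_of_nonneg_left ?_ (by positivity)
      linarith
    linarith

theorem QuadAsymp.sub (hF : QuadAsymp H₁ F b a) (hG : QuadAsymp H₁ G b' a') :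
    QuadAsymp H₁ (fun ε H => F ε H - G ε H) (b - b') (a - a') := by
  obtain ⟨h0, C, hC, h⟩ := hF
  obtain ⟨g0, D, hD, g⟩ := hG
  refine ⟨by filter_upwards [h0, g0] with ε h g; rw [h, g], C + D, by positivity, ?_⟩
  filter_upwards [h, g] with ε h g H H' hH hHH hH1
  have h1 := abs_le.1 (h H H' hH hHH hH1)
  have h2 := abs_le.1 (g H H' hH hHH hH1)
  rw [abs_le]
  constructor <;> nlinarith

/-- The second factor must have slope zero, so that it equals b' + O(ε) and the H² coefficient is
just a·b'. Momentum correlators and their ratios are of this kind. -/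
theorem QuadAsymp.mul (hF : QuadAsymp H₁ F b a) (hG : QuadAsymp H₁ G b' 0) :
    QuadAsymp H₁ (fun ε H => F ε H * G ε H) (b * b') (a * b') := by
  obtain ⟨B, hB, hFb⟩ := hF.lipSq
  obtain ⟨h0, C, hC, h⟩ := hF
  obtain ⟨g0, D, hD, g⟩ := hG
  refine ⟨by filter_upwards [h0, g0] with ε h g; rw [h, g], C * (|b'| + D * H₁ ^ 2) +
    |a| * (D * H₁ ^ 2) + B * D, by positivity, ?_⟩
  filter_upwards [hFb, h, g, g0, eventually_pos, eventually_le_of_pos one_pos] with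
    ε hFb h g g0 hε hε1 H H' hH hHH hH1
  have hn : 0 ≤ H' ^ 2 - H ^ 2 := by nlinarith
  have h1 := h H H' hH hHH hH1
  have h2 := g H H' hH hHH hH1
  have h3 := g 0 H' le_rfl (hH.trans hHH) hH1
  rw [g0] at h3
  simp only [zero_mul, sub_zero] at h2 h3
  have hsq : H' ^ 2 ≤ H₁ ^ 2 := by
    have := hH.trans hHH
    gcongr
  have h4 : |F ε H| ≤ B := (hFb H H hH le_rfl (hHH.trans hH1)).2
  have h5 : |G ε H' - b'| ≤ D * H₁ ^ 2 * ε := by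
    refine h3.trans ?_
    have : D * ε * H' ^ 2 ≤ D * ε * H₁ ^ 2 := by gcongr
    nlinarith
  have h6 : |G ε H'| ≤ |b'| + D * H₁ ^ 2 := by
    have h7 := abs_add_le (G ε H' - b') b'
    rw [sub_add_cancel] at h7
    have : D * H₁ ^ 2 * ε ≤ D * H₁ ^ 2 * 1 := by gcongr
    linarith
  have e : F ε H' * G ε H' - F ε H * G ε H - a * b' * (H' ^ 2 - H ^ 2) =
      (F ε H' - F ε H - a * (H' ^ 2 - H ^ 2)) * G ε H' + a * (H' ^ 2 - H ^ 2) * (G ε H' - b') +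
        F ε H * (G ε H' - G ε H) := by ring
  rw [e]
  refine (abs_add_three _ _ _).trans ?_
  rw [abs_mul, abs_mul, abs_mul a, abs_mul (F ε H), abs_of_nonneg hn]
  have p1 : |F ε H' - F ε H - a * (H' ^ 2 - H ^ 2)| * |G ε H'| ≤
      C * ε * (H' ^ 2 - H ^ 2) * (|b'| + D * H₁ ^ 2) :=
    mul_le_mul h1 h6 (abs_nonneg _) (by positivity)
  have p2 : |a| * (H' ^ 2 - H ^ 2) * |G ε H' - b'| ≤
      |a| * (H' ^ 2 - H ^ 2) * (D * H₁ ^ 2 * ε) := mul_le_mul_of_nonneg_left h5 (by positivity)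
  have p3 : |F ε H| * |G ε H' - G ε H| ≤ B * (D * ε * (H' ^ 2 - H ^ 2)) :=
    mul_le_mul h4 h2 (abs_nonneg _) hB
  linarith

/-- With zero slope F stays within O(ε) of b on the whole range of H, hence above b/2 once ε is
small. -/
theorem QuadAsymp.eventually_ge (hF : QuadAsymp H₁ F b 0) (hb : 0 < b) :
    ∀ᶠ ε in 𝓝[>] (0 : ℝ), ∀ H, 0 ≤ H → H ≤ H₁ → b / 2 ≤ F ε H := by
  obtain ⟨h0, C, hC, h⟩ := hF
  filter_upwards [h0, h, eventually_pos, eventually_le_of_pos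
    (show 0 < b / 2 / (C * H₁ ^ 2 + 1) by positivity)] with ε h0 h hε hε1 H hH hH1
  have h1 := h 0 H le_rfl hH hH1
  rw [h0, zero_mul, sub_zero] at h1
  rw [le_div_iff₀ (by positivity)] at hε1
  have hsq : C * ε * (H ^ 2 - 0 ^ 2) ≤ C * ε * H₁ ^ 2 := by
    have : H ^ 2 ≤ H₁ ^ 2 := by gcongr
    refine mul_le_mul_of_nonneg_left ?_ (by positivity)
    linarith
  have := (abs_le.1 h1).1
  nlinarith

theorem QuadAsymp.inv (hF : QuadAsymp H₁ F b 0) (hb : 0 < b) :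
    QuadAsymp H₁ (fun ε H => (F ε H)⁻¹) b⁻¹ 0 := by
  have hge := hF.eventually_ge hb
  obtain ⟨h0, C, hC, h⟩ := hF
  refine ⟨by filter_upwards [h0] with ε h; rw [h], C * (4 / b ^ 2), by positivity, ?_⟩
  filter_upwards [hge, h, eventually_pos] with ε hge h hε H H' hH hHH hH1
  have hn : 0 ≤ H' ^ 2 - H ^ 2 := by nlinarith
  have g1 := hge H hH (hHH.trans hH1)
  have g2 := hge H' (hH.trans hHH) hH1
  have h1 := h H H' hH hHH hH1
  rw [zero_mul, sub_zero] at h1 ⊢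
  have p1 : 0 < F ε H := by linarith
  have p2 : 0 < F ε H' := by linarith
  rw [inv_sub_inv p2.ne' p1.ne', abs_div, abs_of_pos (mul_pos p2 p1), abs_sub_comm,
    div_le_iff₀ (mul_pos p2 p1)]
  have h2 : b / 2 * (b / 2) ≤ F ε H' * F ε H := mul_le_mul g2 g1 (by positivity) p2.le
  have h3 : 1 ≤ 4 / b ^ 2 * (F ε H' * F ε H) := by
    calc (1 : ℝ) = 4 / b ^ 2 * (b / 2 * (b / 2)) := by field_simp; norm_num
      _ ≤ _ := mul_le_mul_of_nonneg_left h2 (by positivity)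
  calc _ ≤ C * ε * (H' ^ 2 - H ^ 2) * 1 := by linarith
    _ ≤ C * ε * (H' ^ 2 - H ^ 2) * (4 / b ^ 2 * (F ε H' * F ε H)) :=
        mul_le_mul_of_nonneg_left h3 (by positivity)
    _ = _ := by ring

theorem LinAsymp.lip (hF : LinAsymp H₁ F a) : LipAsymp H₁ F := by
  obtain ⟨h0, C, hC, h⟩ := hF
  refine ⟨h0, |a| + C, by positivity, ?_⟩
  filter_upwards [h, eventually_pos, eventually_le_of_pos one_pos] with ε h hε hε1 H H' hH hHH hH1
  have hn : 0 ≤ H' - H := by linarith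
  have h1 := h H H' hH hHH hH1
  have h2 := abs_add_le (F ε H' - F ε H - a * (H' - H)) (a * (H' - H))
  rw [sub_add_cancel, abs_mul a, abs_of_nonneg hn] at h2
  have h3 : C * ε * (H' - H) ≤ C * 1 * (H' - H) := by gcongr
  linarith

/-- The error (H' - H)ε meets a factor of order H' + H, because F vanishes at H = 0, and so becomes
ε(H'² - H²). -/
theorem LinAsymp.sq (hF : LinAsymp H₁ F a) : QuadAsymp H₁ (fun ε H => F ε H ^ 2) 0 (a ^ 2) := by
  obtain ⟨-, B, hB, hl⟩ := hF.lip
  obtain ⟨h0, C, hC, h⟩ := hF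
  refine ⟨by filter_upwards [h0] with ε h; rw [h]; norm_num, C * (2 * B) + |a| * C * 2,
    by positivity, ?_⟩
  filter_upwards [hl, h, h0, eventually_pos] with ε hl h h0 hε H H' hH hHH hH1
  have hn : 0 ≤ H' - H := by linarith
  have hH' := hH.trans hHH
  have h1 := h H H' hH hHH hH1
  have l1 := hl 0 H le_rfl hH (hHH.trans hH1)
  have l2 := hl 0 H' le_rfl hH' hH1
  have q1 := h 0 H le_rfl hH (hHH.trans hH1)
  have q2 := h 0 H' le_rfl hH' hH1
  rw [h0] at l1 l2 q1 q2
  simp only [sub_zero] at l1 l2 q1 q2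
  have e : F ε H' ^ 2 - F ε H ^ 2 - a ^ 2 * (H' ^ 2 - H ^ 2) =
      (F ε H' - F ε H - a * (H' - H)) * (F ε H' + F ε H) +
        a * (H' - H) * ((F ε H' - a * H') + (F ε H - a * H)) := by ring
  rw [e]
  refine (abs_add_le _ _).trans ?_
  rw [abs_mul, abs_mul, abs_mul a, abs_of_nonneg hn]
  have p1 : |F ε H' - F ε H - a * (H' - H)| * |F ε H' + F ε H| ≤
      C * ε * (H' - H) * (B * H' + B * H) :=
    mul_le_mul h1 ((abs_add_le _ _).trans (add_le_add l2 l1)) (abs_nonneg _) (by positivity)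
  have p2 : |a| * (H' - H) * |(F ε H' - a * H') + (F ε H - a * H)| ≤
      |a| * (H' - H) * (C * ε * H' + C * ε * H) :=
    mul_le_mul_of_nonneg_left ((abs_add_le _ _).trans (add_le_add q2 q1)) (by positivity)
  refine (add_le_add p1 p2).trans ?_
  have z1 : 0 ≤ C * ε * B * (H' ^ 2 - H ^ 2) :=
    mul_nonneg (by positivity) (by nlinarith)
  have z2 : 0 ≤ |a| * C * ε * (H' ^ 2 - H ^ 2) :=
    mul_nonneg (by positivity) (by nlinarith)
  nlinarith

theorem LipAsymp.bound (hF : LipAsymp H₁ F) : ∃ C, 0 ≤ C ∧ ∀ᶠ ε in 𝓝[>] (0 : ℝ), ∀ H, 0 ≤ H →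
    H ≤ H₁ → |F ε H| ≤ C * H := by
  obtain ⟨h0, C, hC, h⟩ := hF
  refine ⟨C, hC, ?_⟩
  filter_upwards [h0, h] with ε h0 h H hH hH1
  simpa [h0] using h 0 H le_rfl hH hH1

theorem LipAsymp.sub (hF : LipAsymp H₁ F) (hG : LipAsymp H₁ G) :
    LipAsymp H₁ (fun ε H => F ε H - G ε H) := by
  obtain ⟨h0, C, hC, h⟩ := hF
  obtain ⟨g0, D, hD, g⟩ := hG
  refine ⟨by filter_upwards [h0, g0] with ε h g; rw [h, g, sub_zero], C + D, by positivity, ?_⟩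
  filter_upwards [h, g] with ε h g H H' hH hHH hH1
  have h1 := abs_le.1 (h H H' hH hHH hH1)
  have h2 := abs_le.1 (g H H' hH hHH hH1)
  rw [abs_le]
  constructor <;> nlinarith

/-- Both factors vanish at H = 0, so the Lipschitz increment H' - H picks up a factor of order H or
H' and is controlled by H'² - H². -/
theorem LipAsymp.mul (hF : LipAsymp H₁ F) (hG : LipAsymp H₁ G) :
    LipSqAsymp H₁ (fun ε H => F ε H * G ε H) := by
  obtain ⟨B, hB, hFb⟩ := hF.bound
  obtain ⟨D, hD, hGb⟩ := hG.bound
  obtain ⟨h0, C, hC, h⟩ := hF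
  obtain ⟨g0, E, hE, g⟩ := hG
  refine ⟨C * D + B * E + B * D * H₁ ^ 2, by positivity, ?_⟩
  filter_upwards [h, g, hFb, hGb] with ε h g hFb hGb H H' hH hHH hH1
  have hn : 0 ≤ H' - H := by linarith
  have hH' := hH.trans hHH
  have h1 := h H H' hH hHH hH1
  have h2 := g H H' hH hHH hH1
  have b1 := hFb H hH (hHH.trans hH1)
  have b2 := hGb H' hH' hH1
  have b3 := hFb H' hH' hH1
  constructor
  · have e : F ε H' * G ε H' - F ε H * G ε H =
        (F ε H' - F ε H) * G ε H' + F ε H * (G ε H' - G ε H) := by ring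
    rw [e]
    refine (abs_add_le _ _).trans ?_
    rw [abs_mul, abs_mul]
    have p1 : |F ε H' - F ε H| * |G ε H'| ≤ C * (H' - H) * (D * H') :=
      mul_le_mul h1 b2 (abs_nonneg _) (by positivity)
    have p2 : |F ε H| * |G ε H' - G ε H| ≤ B * H * (E * (H' - H)) :=
      mul_le_mul b1 h2 (abs_nonneg _) (by positivity)
    have z1 : 0 ≤ C * D * (H' - H) * H := by positivity
    have z2 : 0 ≤ B * E * (H' - H) * H' := by positivity
    have z3 : 0 ≤ B * D * H₁ ^ 2 * ((H' - H) * (H' + H)) := by positivity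
    nlinarith
  · rw [abs_mul]
    have p : |F ε H'| * |G ε H'| ≤ B * H' * (D * H') := mul_le_mul b3 b2 (abs_nonneg _) (by positivity)
    have : B * D * H' ^ 2 ≤ B * D * H₁ ^ 2 := by gcongr
    have : 0 ≤ C * D + B * E := by positivity
    nlinarith

theorem LipAsymp.mul_lipSq (hF : LipAsymp H₁ F) (hG : LipSqAsymp H₁ G) :
    LipAsymp H₁ (fun ε H => F ε H * G ε H) := by
  obtain ⟨B, hB, hFb⟩ := hF.bound
  obtain ⟨h0, C, hC, h⟩ := hF
  obtain ⟨E, hE, g⟩ := hG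
  refine ⟨by filter_upwards [h0] with ε h; rw [h, zero_mul], C * E + B * E * (2 * H₁ ^ 2),
    by positivity, ?_⟩
  filter_upwards [h, g, hFb] with ε h g hFb H H' hH hHH hH1
  have hn : 0 ≤ H' - H := by linarith
  have hH' := hH.trans hHH
  have h1 := h H H' hH hHH hH1
  obtain ⟨h2, b2⟩ := g H H' hH hHH hH1
  have b1 := hFb H hH (hHH.trans hH1)
  have e : F ε H' * G ε H' - F ε H * G ε H =
      (F ε H' - F ε H) * G ε H' + F ε H * (G ε H' - G ε H) := by ring
  rw [e]
  refine (abs_add_le _ _).trans ?_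
  rw [abs_mul, abs_mul]
  have p1 : |F ε H' - F ε H| * |G ε H'| ≤ C * (H' - H) * E :=
    mul_le_mul h1 b2 (abs_nonneg _) (by positivity)
  have p2 : |F ε H| * |G ε H' - G ε H| ≤ B * H * (E * (H' ^ 2 - H ^ 2)) :=
    mul_le_mul b1 h2 (abs_nonneg _) (by positivity)
  have p3 : H * (H' + H) ≤ 2 * H₁ ^ 2 := by nlinarith
  have p4 : B * E * (H' - H) * (H * (H' + H)) ≤ B * E * (H' - H) * (2 * H₁ ^ 2) :=
    mul_le_mul_of_nonneg_left p3 (by positivity)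
  nlinarith

theorem LipSqAsymp.sub (hF : LipSqAsymp H₁ F) (hG : LipSqAsymp H₁ G) :
    LipSqAsymp H₁ (fun ε H => F ε H - G ε H) := by
  obtain ⟨C, hC, h⟩ := hF
  obtain ⟨E, hE, g⟩ := hG
  refine ⟨C + E, by positivity, ?_⟩
  filter_upwards [h, g] with ε h g H H' hH hHH hH1
  obtain ⟨h1, b1⟩ := h H H' hH hHH hH1
  obtain ⟨h2, b2⟩ := g H H' hH hHH hH1
  rw [abs_le] at h1 h2 b1 b2
  constructor <;> rw [abs_le] <;> constructor <;> nlinarith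

theorem LipSqAsymp.mul (hF : LipSqAsymp H₁ F) (hG : LipSqAsymp H₁ G) :
    LipSqAsymp H₁ (fun ε H => F ε H * G ε H) := by
  obtain ⟨C, hC, h⟩ := hF
  obtain ⟨E, hE, g⟩ := hG
  refine ⟨2 * C * E, by positivity, ?_⟩
  filter_upwards [h, g] with ε h g H H' hH hHH hH1
  have hn : 0 ≤ H' ^ 2 - H ^ 2 := by nlinarith
  obtain ⟨h1, b1⟩ := h H H' hH hHH hH1
  obtain ⟨h2, b2⟩ := g H H' hH hHH hH1
  have b3 := (h H H hH le_rfl (hHH.trans hH1)).2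
  constructor
  · have e : F ε H' * G ε H' - F ε H * G ε H =
        (F ε H' - F ε H) * G ε H' + F ε H * (G ε H' - G ε H) := by ring
    rw [e]
    refine (abs_add_le _ _).trans ?_
    rw [abs_mul, abs_mul]
    have p1 : |F ε H' - F ε H| * |G ε H'| ≤ C * (H' ^ 2 - H ^ 2) * E :=
      mul_le_mul h1 b2 (abs_nonneg _) (by positivity)
    have p2 : |F ε H| * |G ε H' - G ε H| ≤ C * (E * (H' ^ 2 - H ^ 2)) :=
      mul_le_mul b3 h2 (abs_nonneg _) (by positivity)
    nlinarith
  · rw [abs_mul]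
    have := mul_le_mul b1 b2 (abs_nonneg _) hC
    have : 0 ≤ C * E := by positivity
    nlinarith

end DeSitter
end

noncomputable section
namespace DeSitter

/-! ### Logarithmic growth of the upper branch -/

/-- In polar coordinates k⁻³ becomes dy/y: every logarithmic scale of momenta contributes equally.
-/
theorem integral_shell {a b : ℝ} (ha : 0 < a) (hab : a ≤ b) :
    ∫ k : Space, (Ioc a b).indicator (fun y => (y ^ 3)⁻¹) ‖k‖ =
      3 * volume.real (Metric.ball (0 : Space) 1) * Real.log (b / a) := by
  rw [integral_fun_norm_addHaar, show Module.finrank ℝ Space = 3 by simp]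
  have e2 : ∫ y in Ioi (0 : ℝ), y ^ (3 - 1) • (Ioc a b).indicator (fun y => (y ^ 3)⁻¹) y =
      ∫ y in Ioc a b, y⁻¹ := by
    rw [← integral_indicator measurableSet_Ioi, ← integral_indicator measurableSet_Ioc]
    congr 1
    ext y
    by_cases h0 : y ∈ Ioc a b
    · have hy : 0 < y := ha.trans h0.1
      simp only [indicator, mem_Ioi, hy, h0, if_true, smul_eq_mul]
      field_simp
    · simp [indicator, h0]
  rw [e2, ← intervalIntegral.integral_of_le hab, integral_inv_of_pos ha (ha.trans_le hab)]
  simp only [nsmul_eq_mul, smul_eq_mul]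
  push_cast
  ring

theorem integrable_shell {a b : ℝ} (ha : 0 < a) :
    Integrable fun k : Space => (Ioc a b).indicator (fun y => (y ^ 3)⁻¹) ‖k‖ := by
  have hm : MeasurableSet {k : Space | ‖k‖ ∈ Ioc a b} := measurable_norm measurableSet_Ioc
  have e : (fun k : Space => (Ioc a b).indicator (fun y => (y ^ 3)⁻¹) ‖k‖) =
      {k : Space | ‖k‖ ∈ Ioc a b}.indicator fun k => (‖k‖ ^ 3)⁻¹ := by
    ext k; simp [indicator]
  rw [e, integrable_indicator_iff hm]
  have hfin : volume {k : Space | ‖k‖ ∈ Ioc a b} < ⊤ :=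
    (measure_mono (fun k hk => by simpa using hk.2)).trans_lt
      (measure_closedBall_lt_top (x := (0 : Space)) (r := b))
  refine Measure.integrableOn_of_bounded (M := (a ^ 3)⁻¹) hfin.ne
    ((measurable_norm.pow_const 3).inv.aestronglyMeasurable) ?_
  filter_upwards [ae_restrict_mem hm] with k hk
  rw [norm_inv, norm_pow, norm_norm]
  have := hk.1
  gcongr

/-- For κ ≥ e^{-1/(100ε)} the logarithm of H'/κ costs at most 1/(100ε), so ε(1 + log(1 + y)) ≤ 1/50.
The relative error 25/50 then leaves half of the massless increment. -/
theorem uf_incr_lower {ε κ H H' H₁ : ℝ} (h0 : 0 < ε) (hsmall : ε * (1 + Real.log (1 + H₁)) ≤ 1 / 100)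
    (hκ : Real.exp (-(1 / 100 / ε)) ≤ κ) (hκ1 : κ ≤ 1) (h1 : ε ≤ 1 / 4) (hH : 0 ≤ H) (hHH : H ≤ H')
    (hH1 : H' ≤ H₁) :
    1 / 2 * (H' ^ 2 - H ^ 2) * (κ ^ 3)⁻¹ ≤ uf ε (H' / κ) / κ - uf ε (H / κ) / κ := by
  have hκ0 : 0 < κ := (Real.exp_pos _).trans_le hκ
  have hH' := hH.trans hHH
  have h := (abs_le.1 (uf_div_sub_le h0.le h1 hκ0 hH hHH)).1
  have hl : ell (H' / κ) ≤ 1 + Real.log (1 + H₁) + 1 / 100 / ε := by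
    have h2 : 1 + H' / κ ≤ (1 + H₁) * κ⁻¹ := by
      have h3 : 1 ≤ κ⁻¹ := (one_le_inv₀ hκ0).2 hκ1
      have h4 : H' * κ⁻¹ ≤ H₁ * κ⁻¹ := by gcongr
      rw [div_eq_mul_inv]; linarith
    have h5 := Real.log_le_log (by positivity) h2
    have h6 : 0 < 1 + H₁ := by linarith
    rw [Real.log_mul h6.ne' (by positivity), Real.log_inv] at h5
    have h7 := (Real.le_log_iff_exp_le hκ0).2 hκ
    rw [ell]; linarith
  have h8 : ε * ell (H' / κ) ≤ 1 / 50 := by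
    have h9 := mul_le_mul_of_nonneg_left hl h0.le
    have h10 : ε * (1 / 100 / ε) = 1 / 100 := by field_simp
    linarith
  have h11 : 0 ≤ (H' ^ 2 - H ^ 2) / κ ^ 3 := div_nonneg (by nlinarith) (by positivity)
  have h12 : 25 * ε * ell (H' / κ) * ((H' ^ 2 - H ^ 2) / κ ^ 3) ≤
      1 / 2 * ((H' ^ 2 - H ^ 2) / κ ^ 3) := mul_le_mul_of_nonneg_right (by linarith) h11
  rw [mul_assoc, ← div_eq_mul_inv]
  linarith

/-- On the shell e^{-1/(100ε)} < k ≤ ρ the weight exceeds half its value at 0, which is positive as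
f̃(0) ≠ 0, and the increment is at least half the massless one. The shell has logarithmic width at
least 1/(200ε), the source of the rate c/ε. Off the shell the increment is nonnegative by
monotonicity of |G|². -/
theorem entU_wXp_incr {f g : Space → ℝ} (h : Smearing f g) (d : Space) (hf0 : ft f 0 ≠ 0)
    (H₁ : ℝ) (hH1 : 0 ≤ H₁) : ∃ c, 0 < c ∧ ∀ᶠ ε in 𝓝[>] (0 : ℝ), ∀ H H', 0 ≤ H → H ≤ H' → H' ≤ H₁ →
      c / ε * (H' ^ 2 - H ^ 2) ≤ entU ε H' (wXp f d) - entU ε H (wXp f d) := by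
  have hw : 0 < wXp f d 0 := by
    have : 0 < ‖ft f 0‖ := norm_pos_iff.2 hf0
    rw [wXp, pw, inner_zero_left, Real.cos_zero]
    positivity
  obtain ⟨ρ₀, hρ₀, hball⟩ := Metric.eventually_nhds_iff.1
    (((h.continuous_wXp d).tendsto 0).eventually (lt_mem_nhds (half_lt_self hw)))
  set ρ := min 1 (ρ₀ / 2) with hρ
  have hρpos : 0 < ρ := lt_min one_pos (by positivity)
  have hlow : ∀ k : Space, ‖k‖ ≤ ρ → wXp f d 0 / 2 ≤ wXp f d k := fun k hk =>
    (hball (by rw [dist_zero_right]; linarith [hk.trans (min_le_right _ _)])).le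
  set V := volume.real (Metric.ball (0 : Space) 1) with hV
  have hV0 : 0 < V := by
    rw [hV, measureReal_def]
    exact ENNReal.toReal_pos (Metric.measure_ball_pos volume _ one_pos).ne'
      measure_ball_lt_top.ne
  have hlogρ : Real.log ρ ≤ 0 := Real.log_nonpos hρpos.le (min_le_left _ _)
  have hlog1 : 0 ≤ Real.log (1 + H₁) := Real.log_nonneg (by linarith)
  refine ⟨wXp f d 0 / 2 * (1 / 2) * (3 * V * (1 / 200)), by positivity, ?_⟩
  filter_upwards [eventually_pos, eventually_le_of_pos (show (0 : ℝ) < 1 / 4 by norm_num),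
    eventually_le_of_pos (show 0 < 1 / 100 / (1 + Real.log (1 + H₁)) by positivity),
    eventually_le_of_pos (show 0 < 1 / 200 / (1 - Real.log ρ) from
      div_pos (by norm_num) (by linarith))] with ε h0 h14 hs1 hs2 H H' hH hHH hH'1
  have hH' := hH.trans hHH
  have hn : 0 ≤ H' ^ 2 - H ^ 2 := by nlinarith
  rw [le_div_iff₀ (by positivity)] at hs1
  rw [le_div_iff₀ (by linarith)] at hs2
  set a := Real.exp (-(1 / 100 / ε)) with ha
  have ha0 : 0 < a := Real.exp_pos _
  have hlogle : 1 / 200 / ε ≤ Real.log (ρ / a) := by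
    rw [Real.log_div hρpos.ne' ha0.ne', ha, Real.log_exp, div_le_iff₀ h0]
    have : (Real.log ρ - -(1 / 100 / ε)) * ε = Real.log ρ * ε + 1 / 100 := by field_simp; ring
    rw [this]
    nlinarith
  have haρ : a ≤ ρ := by
    have : 0 < Real.log (ρ / a) := lt_of_lt_of_le (by positivity) hlogle
    rw [Real.log_div hρpos.ne' ha0.ne'] at this
    exact ((Real.log_lt_log_iff ha0 hρpos).1 (by linarith)).le
  have i1 := h.integrable_Xp (d := d) h0 h14 hH
  have i2 := h.integrable_Xp (d := d) h0 h14 hH'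
  have i3 : Integrable fun k : Space => wXp f d 0 / 2 * (1 / 2 * (H' ^ 2 - H ^ 2)) *
      (Ioc a ρ).indicator (fun y => (y ^ 3)⁻¹) ‖k‖ := (integrable_shell ha0).const_mul _
  rw [entU, entU, ← integral_sub i2 i1]
  have hmono := integral_mono_ae i3 (i2.sub i1) (by
    filter_upwards [ae_ne_zero] with k hk
    have hk' : 0 < ‖k‖ := norm_pos_iff.2 hk
    have hinc : 0 ≤ uf ε (H' / ‖k‖) / ‖k‖ - uf ε (H / ‖k‖) / ‖k‖ := by
      rw [← sub_div]
      exact div_nonneg (sub_nonneg.2 (uf_mono h0.le (by linarith) (by positivity)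
        (div_le_div_of_nonneg_right hHH hk'.le))) hk'.le
    simp only [Pi.sub_apply, ← mul_sub]
    by_cases hm : ‖k‖ ∈ Ioc a ρ
    · rw [indicator_of_mem hm, mul_assoc]
      refine mul_le_mul (hlow k hm.2) ?_ (by positivity) (wXp_nonneg f d k)
      exact uf_incr_lower h0 hs1 hm.1.le (hm.2.trans (min_le_left _ _)) h14 hH hHH hH'1
    · rw [indicator_of_notMem hm, mul_zero]
      exact mul_nonneg (wXp_nonneg f d k) hinc)
  rw [integral_const_mul, integral_shell ha0 haρ] at hmono
  refine le_trans ?_ hmono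
  have : 0 ≤ wXp f d 0 / 2 * (1 / 2 * (H' ^ 2 - H ^ 2)) * (3 * V) := by positivity
  calc _ = wXp f d 0 / 2 * (1 / 2 * (H' ^ 2 - H ^ 2)) * (3 * V) * (1 / 200 / ε) := by ring
    _ ≤ _ := mul_le_mul_of_nonneg_left hlogle this
    _ = _ := by ring

/-! ### Asymptotics of the mode integrals -/

section entries

variable {f g : Space → ℝ} {H₁ : ℝ}

theorem quadAsymp_Xm (d : Space) (h : Smearing f g) (hH1 : 0 ≤ H₁) :
    QuadAsymp H₁ (fun ε H => entU ε H (wXm f d)) (∫ k, wXm f d k / ‖k‖)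
      (∫ k, wXm f d k / ‖k‖ ^ 3) := by
  obtain ⟨C, hψ, -⟩ := h.exists_weightBound
  have hC := hψ.1
  have h14 := eventually_le_of_pos (show (0 : ℝ) < 1 / 4 by norm_num)
  refine ⟨by filter_upwards [h14] with ε h1; exact entU_zero h1,
    (2 + ‖d‖ ^ 2) * 25 * (1 + H₁) * C, by positivity, ?_⟩
  filter_upwards [h14, eventually_pos] with ε h1 h0 H H' hH hHH hH1
  rw [mul_comm (∫ k, _)]
  exact entU_sub_le hψ (by positivity) (h.continuous_wXm d).measurable (abs_wXm_le f g d)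
    (abs_wXm_le_sq f g d) h0 h1 hH hHH hH1

theorem quadAsymp_Qp (d : Space) (h : Smearing f g) :
    QuadAsymp H₁ (fun ε H => entN ε H (wXp g d)) (∫ k, wXp g d k * ‖k‖) 0 := by
  obtain ⟨C, -, hψ⟩ := h.exists_weightBound
  have hC := hψ.1
  have h14 := eventually_le_of_pos (show (0 : ℝ) < 1 / 4 by norm_num)
  refine ⟨by filter_upwards [h14] with ε h1; exact entN_zero h1,
    (2 + ‖d‖ ^ 2) * 45 * (1 + H₁) ^ 2 * C, by positivity, ?_⟩
  filter_upwards [h14, eventually_pos] with ε h1 h0 H H' hH hHH hH1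
  rw [zero_mul, sub_zero]
  exact abs_entN_sub_le hψ h.integrable_pw_mul (by positivity) (h.continuous_wQp d).measurable
    (abs_wXp_le_pw g d) h0 h1 hH hHH hH1

theorem quadAsymp_Qm (d : Space) (h : Smearing f g) :
    QuadAsymp H₁ (fun ε H => entN ε H (wXm g d)) (∫ k, wXm g d k * ‖k‖) 0 := by
  obtain ⟨C, -, hψ⟩ := h.exists_weightBound
  have hC := hψ.1
  have h14 := eventually_le_of_pos (show (0 : ℝ) < 1 / 4 by norm_num)
  refine ⟨by filter_upwards [h14] with ε h1; exact entN_zero h1,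
    (2 + ‖d‖ ^ 2) * 45 * (1 + H₁) ^ 2 * C, by positivity, ?_⟩
  filter_upwards [h14, eventually_pos] with ε h1 h0 H H' hH hHH hH1
  rw [zero_mul, sub_zero]
  exact abs_entN_sub_le hψ h.integrable_pw_mul (by positivity) (h.continuous_wQm d).measurable
    (abs_wXm_le_pw g d) h0 h1 hH hHH hH1

theorem linAsymp_S (d : Space) (h : Smearing f g) :
    LinAsymp H₁ (fun ε H => entV ε H (wS f g d)) (∫ k, wS f g d k / ‖k‖) := by
  obtain ⟨C, hψ, -⟩ := h.exists_weightBound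
  have hC := hψ.1
  have h14 := eventually_le_of_pos (show (0 : ℝ) < 1 / 4 by norm_num)
  refine ⟨by filter_upwards [h14] with ε h1; exact entV_zero h1,
    (2 + ‖d‖ ^ 2) * 82 * (1 + H₁) ^ 2 * C, by positivity, ?_⟩
  filter_upwards [h14, eventually_pos] with ε h1 h0 H H' hH hHH hH1
  rw [mul_comm (∫ k, _)]
  exact entV_sub_sub_le hψ (by positivity) (h.continuous_wS d).measurable (abs_wS_le f g d)
    (abs_wS_le_norm f g d) h0 h1 hH hHH hH1

theorem linAsymp_T (d : Space) (h : Smearing f g) :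
    LinAsymp H₁ (fun ε H => entV ε H (wT f g d)) (∫ k, wT f g d k / ‖k‖) := by
  obtain ⟨C, hψ, -⟩ := h.exists_weightBound
  have hC := hψ.1
  have h14 := eventually_le_of_pos (show (0 : ℝ) < 1 / 4 by norm_num)
  refine ⟨by filter_upwards [h14] with ε h1; exact entV_zero h1,
    (2 + ‖d‖ ^ 2) * 82 * (1 + H₁) ^ 2 * C, by positivity, ?_⟩
  filter_upwards [h14, eventually_pos] with ε h1 h0 H H' hH hHH hH1
  rw [mul_comm (∫ k, _)]
  exact entV_sub_sub_le hψ (by positivity) (h.continuous_wT d).measurable (abs_wT_le f g d)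
    (abs_wT_le_norm f g d) h0 h1 hH hHH hH1

theorem lipAsymp_W (d : Space) (h : Smearing f g) : LipAsymp H₁ (fun ε H => entV ε H (wW f g d)) := by
  obtain ⟨C, hψ, -⟩ := h.exists_weightBound
  have hC := hψ.1
  have h14 := eventually_le_of_pos (show (0 : ℝ) < 1 / 4 by norm_num)
  refine ⟨by filter_upwards [h14] with ε h1; exact entV_zero h1,
    (2 + ‖d‖ ^ 2) * (6 + 42 * (1 + H₁) ^ 2) * C, by positivity, ?_⟩
  filter_upwards [h14, eventually_pos] with ε h1 h0 H H' hH hHH hH1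
  exact abs_entV_sub_le hψ (by positivity) (h.continuous_wW d).measurable (abs_wW_le f g d)
    h0 h1 hH hHH hH1

theorem abs_Xp_le (d : Space) (h : Smearing f g) : ∃ C, 0 ≤ C ∧ ∀ᶠ ε in 𝓝[>] (0 : ℝ), ∀ H, 0 ≤ H → H ≤ H₁ →
    |entU ε H (wXp f d)| ≤ C / ε := by
  obtain ⟨C, hψ, -⟩ := h.exists_weightBound
  have hC := hψ.1
  refine ⟨(2 + ‖d‖ ^ 2) * (9 * (1 + H₁) ^ 2) * C, by positivity, ?_⟩
  filter_upwards [eventually_le_of_pos (show (0 : ℝ) < 1 / 4 by norm_num), eventually_pos] with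
    ε h1 h0 H hH hH1
  exact abs_entU_le hψ (by positivity) (abs_wXp_le f g d) h0 h1 hH hH1

/-! ### Asymptotics of the branches -/

variable {d : Space}

theorem quadAsymp_ratio (h : Smearing f g) (hd : d ≠ 0) (hg : ∃ k, ft g k ≠ 0) :
    QuadAsymp H₁ (fun ε H => entN ε H (wXp g d) * (entN ε H (wXm g d))⁻¹)
      ((∫ k, wXp g d k * ‖k‖) * (∫ k, wXm g d k * ‖k‖)⁻¹) 0 := by
  simpa using (quadAsymp_Qp (H₁ := H₁) d h).mul
    ((quadAsymp_Qm d h).inv (integral_wXm_momentum_pos h hd hg))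

theorem quadAsymp_beta (h : Smearing f g) (hd : d ≠ 0) (hg : ∃ k, ft g k ≠ 0) (hH1 : 0 ≤ H₁) :
    QuadAsymp H₁ (betaH f g d) ((∫ k, wXm f d k / ‖k‖) * ∫ k, wXp g d k * ‖k‖) (slope f g d) := by
  have := (((quadAsymp_Xm d h hH1).mul (quadAsymp_Qp d h)).sub (linAsymp_S d h).sq).sub
    ((linAsymp_T d h).sq.mul (quadAsymp_ratio h hd hg))
  simp only [sub_zero, zero_mul] at this
  have e : betaH f g d = fun ε H => entU ε H (wXm f d) * entN ε H (wXp g d) -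
      entV ε H (wS f g d) ^ 2 - entV ε H (wT f g d) ^ 2 *
        (entN ε H (wXp g d) * (entN ε H (wXm g d))⁻¹) := by
    ext ε H
    rw [betaH, betaOf]; ring
  rw [e]
  exact this

/-- Infrared singular kernels enter only through the cross correlations, which remain Lipschitz. The
squared factor is built from functions vanishing at H = 0 and hence is Lipschitz in H². -/
theorem lipSqAsymp_rho (h : Smearing f g) (hd : d ≠ 0) (hg : ∃ k, ft g k ≠ 0) (hH1 : 0 ≤ H₁) :
    LipSqAsymp H₁ (rhoH f g d) := by
  have hB := (lipAsymp_W (H₁ := H₁) d h).sub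
    ((linAsymp_T d h).lip.mul_lipSq (quadAsymp_ratio h hd hg).lipSq)
  have := (((quadAsymp_Xm d h hH1).lipSq.mul (quadAsymp_Qm d h).lipSq).sub
    (linAsymp_T d h).sq.lipSq).mul (hB.mul hB)
  have e : rhoH f g d = fun ε H => (entU ε H (wXm f d) * entN ε H (wXm g d) -
      entV ε H (wT f g d) ^ 2) * ((entV ε H (wW f g d) - entV ε H (wT f g d) *
        (entN ε H (wXp g d) * (entN ε H (wXm g d))⁻¹)) * (entV ε H (wW f g d) -
        entV ε H (wT f g d) * (entN ε H (wXp g d) * (entN ε H (wXm g d))⁻¹))) := by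
    ext ε H
    rw [rhoH, rhoOf]; ring
  rw [e]
  exact this

/-- The growth of the field correlator times a momentum correlator bounded below by q/2 gives
(cq/2)/ε. The field correlator itself is O(1/ε) and multiplies momentum increments that are O(ε).
All other terms are Lipschitz in H², so half of the rate survives for small ε. -/
theorem alpha_incr (h : Smearing f g) (hd : d ≠ 0) (hf0 : ft f 0 ≠ 0) (hg : ∃ k, ft g k ≠ 0)
    (hH1 : 0 ≤ H₁) : ∃ c, 0 < c ∧ ∀ᶠ ε in 𝓝[>] (0 : ℝ), ∀ H H', 0 ≤ H → H ≤ H' → H' ≤ H₁ →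
      c / ε * (H' ^ 2 - H ^ 2) ≤ alphaH f g d ε H' - alphaH f g d ε H := by
  have hq := integral_wXm_momentum_pos h hd hg
  set q := ∫ k, wXm g d k * ‖k‖ with hqdef
  have hQ : QuadAsymp H₁ (fun ε H => entN ε H (wXm g d)) q 0 := quadAsymp_Qm d h
  have hQge := hQ.eventually_ge hq
  have hR := ((linAsymp_T (H₁ := H₁) d h).sq.lipSq.mul
    (quadAsymp_ratio h hd hg).lipSq).sub (linAsymp_S d h).sq.lipSq
  have hTW := (linAsymp_T (H₁ := H₁) d h).lip.mul (lipAsymp_W d h)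
  obtain ⟨R, hR0, hR⟩ := hR
  obtain ⟨W, hW0, hW⟩ := hTW
  obtain ⟨c, hc, hX⟩ := entU_wXp_incr h d hf0 H₁ hH1
  obtain ⟨B, hB, hXb⟩ := abs_Xp_le (H₁ := H₁) d h
  obtain ⟨-, D, hD, hQl⟩ := hQ
  refine ⟨c * q / 4, by positivity, ?_⟩
  filter_upwards [hQge, hR, hW, hX, hXb, hQl, eventually_pos, eventually_le_of_pos
    (show 0 < c * q / 4 / (B * D + R + 2 * W + 1) by positivity)] with
    ε hQge hR hW hX hXb hQl hε hεs H H' hH hHH hH'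
  have hn : 0 ≤ H' ^ 2 - H ^ 2 := by nlinarith
  have r1 := (abs_le.1 (hR H H' hH hHH hH').1).1
  have r2 := (abs_le.1 (hW H H' hH hHH hH').1).2
  have r3 := hX H H' hH hHH hH'
  have r4 := hXb H hH (hHH.trans hH')
  have r5 := hQl H H' hH hHH hH'
  have r6 := hQge H' (hH.trans hHH) hH'
  rw [zero_mul, sub_zero] at r5
  have e : alphaH f g d ε H' - alphaH f g d ε H =
      (entU ε H' (wXp f d) - entU ε H (wXp f d)) * entN ε H' (wXm g d) +
      entU ε H (wXp f d) * (entN ε H' (wXm g d) - entN ε H (wXm g d)) +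
      ((entV ε H' (wT f g d) ^ 2 * (entN ε H' (wXp g d) * (entN ε H' (wXm g d))⁻¹) -
        entV ε H' (wS f g d) ^ 2) -
        (entV ε H (wT f g d) ^ 2 * (entN ε H (wXp g d) * (entN ε H (wXm g d))⁻¹) -
        entV ε H (wS f g d) ^ 2)) -
      2 * (entV ε H' (wT f g d) * entV ε H' (wW f g d) -
        entV ε H (wT f g d) * entV ε H (wW f g d)) := by
    rw [alphaH, alphaH, alphaOf, alphaOf]; ring
  rw [e]
  have s1 : c / ε * (H' ^ 2 - H ^ 2) * (q / 2) ≤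
      (entU ε H' (wXp f d) - entU ε H (wXp f d)) * entN ε H' (wXm g d) :=
    mul_le_mul r3 r6 (by positivity) ((by positivity : 0 ≤ c / ε * (H' ^ 2 - H ^ 2)).trans r3)
  have s2 : |entU ε H (wXp f d) * (entN ε H' (wXm g d) - entN ε H (wXm g d))| ≤
      B * D * (H' ^ 2 - H ^ 2) := by
    rw [abs_mul]
    refine (mul_le_mul r4 r5 (abs_nonneg _) (by positivity)).trans_eq ?_
    field_simp
  have s3 := (abs_le.1 s2).1
  rw [le_div_iff₀ (by positivity)] at hεs
  have s4 : B * D + R + 2 * W ≤ c * q / 4 / ε := by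
    rw [le_div_iff₀ hε]
    nlinarith
  have s5 := mul_le_mul_of_nonneg_right s4 hn
  have s6 : c / ε * (H' ^ 2 - H ^ 2) * (q / 2) = 2 * (c * q / 4 / ε * (H' ^ 2 - H ^ 2)) := by ring
  linarith

end entries
end DeSitter
end

noncomputable section
namespace DeSitter

/-! ### The lower eigenvalue for small `ε` -/

/-- Two branches, the upper one growing like `H² / ε` and the lower one like `K H²`, coupled by a
bounded term. -/
structure Branches (α β ρ : ℝ → ℝ → ℝ) (a₀ b₀ K : ℝ) : Prop where
  a_pos : 0 < a₀
  b_pos : 0 < b₀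
  slope_pos : 0 < K
  alpha_zero : ∀ᶠ ε in 𝓝[>] (0 : ℝ), α ε 0 = a₀
  alpha_incr : ∀ H₁, 0 ≤ H₁ → ∃ c, 0 < c ∧ ∀ᶠ ε in 𝓝[>] (0 : ℝ), ∀ H H', 0 ≤ H → H ≤ H' →
    H' ≤ H₁ → c / ε * (H' ^ 2 - H ^ 2) ≤ α ε H' - α ε H
  beta : ∀ H₁, 0 ≤ H₁ → QuadAsymp H₁ β b₀ K
  rho : ∀ H₁, 0 ≤ H₁ → LipSqAsymp H₁ ρ
  rho_zero : ∀ᶠ ε in 𝓝[>] (0 : ℝ), ρ ε 0 = 0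
  rho_nonneg : ∀ᶠ ε in 𝓝[>] (0 : ℝ), ∀ H, 0 ≤ H → 0 ≤ ρ ε H

namespace Branches

variable {α β ρ : ℝ → ℝ → ℝ} {a₀ b₀ K : ℝ}

theorem beta_incr (h : Branches α β ρ a₀ b₀ K) {H₁ : ℝ} (hH1 : 0 ≤ H₁) :
    ∀ᶠ ε in 𝓝[>] (0 : ℝ), ∀ H H', 0 ≤ H → H ≤ H' → H' ≤ H₁ →
      K / 2 * (H' ^ 2 - H ^ 2) ≤ β ε H' - β ε H := by
  obtain ⟨-, C, hC, hβ⟩ := h.beta H₁ hH1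
  have hK := h.slope_pos
  filter_upwards [hβ, eventually_le_of_pos (show 0 < K / 2 / (C + 1) by positivity),
    eventually_pos] with ε hβ hε hε0 H H' hH hHH hH'
  rw [le_div_iff₀ (by positivity)] at hε
  have hn : 0 ≤ H' ^ 2 - H ^ 2 := by nlinarith
  have h1 := (abs_le.1 (hβ H H' hH hHH hH')).1
  have h2 : C * ε * (H' ^ 2 - H ^ 2) ≤ K / 2 * (H' ^ 2 - H ^ 2) :=
    mul_le_mul_of_nonneg_right (by nlinarith) hn
  linarith

theorem lam_zero (h : Branches α β ρ a₀ b₀ K) :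
    ∀ᶠ ε in 𝓝[>] (0 : ℝ), lamMinus (α ε 0) (β ε 0) (ρ ε 0) = min a₀ b₀ := by
  filter_upwards [h.alpha_zero, (h.beta 0 le_rfl).1, h.rho_zero] with ε h1 h2 h3
  rw [h1, h2, h3, lamMinus_zero]

/-- The upper branch rises at rate c/ε in H² while the coupling grows at rate at most C, so by
`lamMinus_sub_le` repulsion lowers λ by at most C/(c/ε). -/
theorem lam_sub_le (h : Branches α β ρ a₀ b₀ K) {H₁ : ℝ} (hH1 : 0 ≤ H₁) :
    ∃ C, 0 ≤ C ∧ ∀ᶠ ε in 𝓝[>] (0 : ℝ), ∀ H H', 0 ≤ H → H ≤ H' → H' ≤ H₁ →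
      lamMinus (α ε H) (β ε H) (ρ ε H) - C * ε ≤ lamMinus (α ε H') (β ε H') (ρ ε H') := by
  obtain ⟨c, hc, hα⟩ := h.alpha_incr H₁ hH1
  obtain ⟨C, hC, hρ⟩ := h.rho H₁ hH1
  have hK := h.slope_pos
  refine ⟨C / c, by positivity, ?_⟩
  filter_upwards [hα, h.beta_incr hH1, hρ, h.rho_nonneg, eventually_pos] with
    ε hα hβ hρ hρ0 hε H H' hH hHH hH'
  have hn : 0 ≤ H' ^ 2 - H ^ 2 := by nlinarith
  have e : C / c * ε = C / (c / ε) := by field_simp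
  rw [e]
  have h1 := hβ H H' hH hHH hH'
  have h2 : 0 ≤ K / 2 * (H' ^ 2 - H ^ 2) := by positivity
  exact lamMinus_sub_le (hρ0 H hH) (by positivity) hn hC (hα H H' hH hHH hH') (by linarith)
    ((le_abs_self _).trans (hρ H H' hH hHH hH').1)

/-- Comparison with H = 0, where the branches decouple. A positive lower bound is needed before
taking logarithms. -/
theorem le_lam (h : Branches α β ρ a₀ b₀ K) {H₁ : ℝ} (hH1 : 0 ≤ H₁) :
    ∀ᶠ ε in 𝓝[>] (0 : ℝ), ∀ H, 0 ≤ H → H ≤ H₁ →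
      min a₀ b₀ / 2 ≤ lamMinus (α ε H) (β ε H) (ρ ε H) := by
  obtain ⟨C, hC, hl⟩ := h.lam_sub_le hH1
  have hm : 0 < min a₀ b₀ := lt_min h.a_pos h.b_pos
  filter_upwards [hl, h.lam_zero, eventually_pos,
    eventually_le_of_pos (show 0 < min a₀ b₀ / 2 / (C + 1) by positivity)] with
    ε hl h0 hε hε1 H hH hHH
  have h1 := hl 0 H le_rfl hH hHH
  rw [h0] at h1
  rw [le_div_iff₀ (by positivity)] at hε1
  nlinarith

theorem alpha_sub_beta (h : Branches α β ρ a₀ b₀ K) {H₀ H₁ : ℝ} (h0 : 0 < H₀) (h01 : H₀ ≤ H₁)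
    (M : ℝ) : ∀ᶠ ε in 𝓝[>] (0 : ℝ), ∀ H, H₀ ≤ H → H ≤ H₁ → M < α ε H - β ε H := by
  have hH1 : 0 ≤ H₁ := h0.le.trans h01
  obtain ⟨c, hc, hα⟩ := h.alpha_incr H₁ hH1
  obtain ⟨B, hB, hβ⟩ := (h.beta H₁ hH1).lipSq
  have ha := h.a_pos
  filter_upwards [hα, hβ, h.alpha_zero, eventually_pos,
    eventually_le_of_pos (show 0 < c * H₀ ^ 2 / (|M| + B + 1) by positivity)] with
    ε hα hβ hα0 hε hε1 H hH0 hH1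
  have hH := h0.le.trans hH0
  have h1 := hα 0 H le_rfl hH hH1
  have h2 := (abs_le.1 (hβ H H hH le_rfl hH1).2).2
  rw [hα0] at h1
  rw [le_div_iff₀ (by positivity)] at hε1
  have h3 : |M| + B + 1 ≤ c / ε * H₀ ^ 2 := by
    rw [div_mul_eq_mul_div, le_div_iff₀ hε]; linarith
  have h4 : c / ε * H₀ ^ 2 ≤ c / ε * (H ^ 2 - 0 ^ 2) := by
    refine mul_le_mul_of_nonneg_left ?_ (by positivity)
    nlinarith
  linarith [le_abs_self M]

/-- For H ≥ H₀ > 0 the gap α - β exceeds any constant once ε is small, so the coupling can no longer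
reverse the growth of β. The argument fails near H = 0, where the two branches may be close or in
the opposite order. -/
theorem lam_lt (h : Branches α β ρ a₀ b₀ K) {H₀ H₁ : ℝ} (h0 : 0 < H₀) (h01 : H₀ ≤ H₁) :
    ∀ᶠ ε in 𝓝[>] (0 : ℝ), ∀ H H', H₀ ≤ H → H < H' → H' ≤ H₁ →
      lamMinus (α ε H) (β ε H) (ρ ε H) < lamMinus (α ε H') (β ε H') (ρ ε H') := by
  have hH1 : 0 ≤ H₁ := h0.le.trans h01
  obtain ⟨c, hc, hα⟩ := h.alpha_incr H₁ hH1
  obtain ⟨C, hC, hρ⟩ := h.rho H₁ hH1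
  have hK := h.slope_pos
  filter_upwards [hα, h.beta_incr hH1, hρ, h.rho_nonneg, h.alpha_sub_beta h0 h01 (C / (K / 2)),
    eventually_pos] with ε hα hβ hρ hρ0 hfar hε H H' hH0 hHH hH'
  have hH := h0.le.trans hH0
  have hn : 0 < H' ^ 2 - H ^ 2 := by nlinarith
  have h1 := hα H H' hH hHH.le hH'
  have h2 : 0 ≤ c / ε * (H' ^ 2 - H ^ 2) := by positivity
  have h3 := hfar H hH0 (hHH.le.trans hH')
  rw [div_lt_iff₀' (by positivity)] at h3
  exact lamMinus_lt (hρ0 H hH) hn (half_pos hK) (by linarith) (hβ H H' hH hHH.le hH')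
    ((le_abs_self _).trans (hρ H H' hH hHH.le hH').1) h3

theorem tendsto_lam (h : Branches α β ρ a₀ b₀ K) {H : ℝ} (hH : 0 < H) :
    Tendsto (fun ε => lamMinus (α ε H) (β ε H) (ρ ε H)) (𝓝[>] 0) (𝓝 (b₀ + K * H ^ 2)) := by
  have hβ : Tendsto (fun ε => β ε H) (𝓝[>] 0) (𝓝 (b₀ + K * H ^ 2)) := by
    obtain ⟨h0, C, hC, hβ⟩ := h.beta H hH.le
    have hz : Tendsto (fun ε : ℝ => C * ε * H ^ 2) (𝓝[>] 0) (𝓝 0) := by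
      have : Continuous fun ε : ℝ => C * ε * H ^ 2 := by fun_prop
      simpa using (this.tendsto 0).mono_left nhdsWithin_le_nhds
    refine tendsto_iff_norm_sub_tendsto_zero.2 (squeeze_zero' (Eventually.of_forall fun _ =>
      norm_nonneg _) ?_ hz)
    filter_upwards [h0, hβ] with ε h0 hβ
    have := hβ 0 H le_rfl hH.le le_rfl
    rw [h0] at this
    rw [Real.norm_eq_abs]
    convert this using 2 <;> ring
  have hd : Tendsto (fun ε => β ε H - lamMinus (α ε H) (β ε H) (ρ ε H)) (𝓝[>] 0) (𝓝 0) := by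
    obtain ⟨C, hC, hρ⟩ := h.rho H hH.le
    rw [Metric.tendsto_nhds]
    intro δ hδ
    filter_upwards [h.rho_nonneg, hρ, h.alpha_sub_beta hH le_rfl (C / (δ / 2))] with ε hρ0 hρ hfar
    have h1 := lamMinus_le_right (α := α ε H) (β := β ε H) (hρ0 H hH.le)
    have h2 := (hρ H H hH.le le_rfl le_rfl).2
    have h3 := hfar H le_rfl le_rfl
    have h5 : 0 ≤ C / (δ / 2) := by positivity
    have h3' := h3
    rw [div_lt_iff₀ (by positivity)] at h3
    -- Test point β - δ/2: the large gap makes (α - β + δ/2)·δ/2 exceed the bound C on ρ.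
    have h4 : β ε H - δ / 2 ≤ lamMinus (α ε H) (β ε H) (ρ ε H) := by
      refine le_lamMinus (by linarith) (by linarith) ?_
      have := le_abs_self (ρ ε H)
      nlinarith
    rw [Real.dist_eq, sub_zero, abs_of_nonneg (by linarith)]
    linarith
  simpa using hβ.sub hd

end Branches

/-! ### The logarithmic negativity as a function of the lower eigenvalue -/

/-- Logarithmic negativity in terms of `ν̃₋²`. -/
def negOf (x : ℝ) : ℝ := max 0 (-Real.logb 2 (Real.sqrt x))

section negOf

variable {x y m δ : ℝ}

theorem negOf_eq (hx : 0 ≤ x) : negOf x = max 0 (-(Real.log x / (2 * Real.log 2))) := by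
  rw [negOf, Real.logb, Real.log_sqrt hx]
  ring_nf

theorem negOf_antitone (hx : 0 < x) (hxy : x ≤ y) : negOf y ≤ negOf x := by
  rw [negOf_eq hx.le, negOf_eq (hx.le.trans hxy)]
  have := Real.log_le_log hx hxy
  have h2 : 0 < Real.log 2 := Real.log_pos one_lt_two
  gcongr

/-- Positivity at the larger argument means that the cutoff at 0 is inactive there, so strictness of
the logarithm passes through the maximum. -/
theorem negOf_strict (hx : 0 < x) (hxy : x < y) (hy : 0 < negOf y) : negOf y < negOf x := by
  rw [negOf_eq (hx.le.trans hxy.le)] at hy ⊢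
  rw [negOf_eq hx.le]
  have := Real.log_lt_log hx hxy
  have h2 : 0 < Real.log 2 := Real.log_pos one_lt_two
  have h3 : 0 < -(Real.log y / (2 * Real.log 2)) := by
    rcases lt_max_iff.1 hy with h | h
    · exact absurd h (lt_irrefl _)
    · exact h
  rw [max_eq_right h3.le]
  refine lt_max_of_lt_right (neg_lt_neg ?_)
  gcongr

theorem negOf_continuousAt (hx : 0 < x) : ContinuousAt negOf x := by
  have h1 : ContinuousAt (fun x => Real.logb 2 (Real.sqrt x)) x := by
    have : Real.sqrt x ≠ 0 := (Real.sqrt_pos.2 hx).ne'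
    exact (Real.continuous_sqrt.continuousAt.log this).div_const _
  exact continuousAt_const.max h1.neg

/-- From log(x/y) ≤ x/y - 1 ≤ δ/m. The cutoff at 0 costs nothing because the added term is
nonnegative. -/
theorem negOf_le_add (hm : 0 < m) (hx : 0 < x) (hy : m ≤ y) (hδ : 0 ≤ δ) (hxy : x - δ ≤ y) :
    negOf y ≤ negOf x + δ / (m * (2 * Real.log 2)) := by
  have h2 : 0 < Real.log 2 := Real.log_pos one_lt_two
  have hy0 := hm.trans_le hy
  rw [negOf_eq hx.le, negOf_eq hy0.le]
  have h3 : Real.log x - Real.log y ≤ δ / m := by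
    rw [← Real.log_div hx.ne' hy0.ne']
    calc _ ≤ x / y - 1 := Real.log_le_sub_one_of_pos (by positivity)
      _ = (x - y) / y := by field_simp
      _ ≤ δ / y := by gcongr; linarith
      _ ≤ δ / m := by gcongr
  have h4 : (Real.log x - Real.log y) / (2 * Real.log 2) ≤ δ / (m * (2 * Real.log 2)) := by
    rw [← div_div δ]
    exact div_le_div_of_nonneg_right h3 (by positivity)
  rw [sub_div] at h4
  refine max_le (by positivity) ?_
  have := le_max_right 0 (-(Real.log x / (2 * Real.log 2)))
  linarith

end negOf

/-! ### Assembly -/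

/-- Convergence through positive values is required, since all estimates in ε are one-sided. The
lower bound r²/3 provides it. -/
theorem tendsto_epsOf : Tendsto epsOf (𝓝[>] 0) (𝓝[>] 0) := by
  have hr : ∀ᶠ r : ℝ in 𝓝[>] 0, 0 < r ∧ r ^ 2 ≤ 9 / 4 := by
    filter_upwards [eventually_pos, eventually_le_of_pos one_pos] with r h0 h1
    exact ⟨h0, by nlinarith⟩
  refine tendsto_nhdsWithin_iff.2 ⟨?_, ?_⟩
  · have hz : Tendsto (fun r : ℝ => 2 / 3 * r ^ 2) (𝓝[>] 0) (𝓝 0) := by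
      have : Continuous fun r : ℝ => 2 / 3 * r ^ 2 := by fun_prop
      simpa using (this.tendsto 0).mono_left nhdsWithin_le_nhds
    refine squeeze_zero' ?_ ?_ hz
    · filter_upwards [hr] with r hr
      exact (by positivity : 0 ≤ r ^ 2 / 3).trans (sq_div_three_le_epsOf hr.2)
    · filter_upwards [hr] with r hr
      exact epsOf_le hr.2
  · filter_upwards [hr] with r hr
    have := hr.1
    exact (by positivity : 0 < r ^ 2 / 3).trans_le (sq_div_three_le_epsOf hr.2)

theorem exists_Ioo_of_eventually {p : ℝ → Prop} (h : ∀ᶠ r in 𝓝[>] (0 : ℝ), p r) :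
    ∃ r₀ > 0, ∀ r ∈ Ioo 0 r₀, p r := by
  obtain ⟨r₀, hr₀, hsub⟩ := mem_nhdsGT_iff_exists_Ioo_subset.1 h
  exact ⟨r₀, hr₀, hsub⟩

section main

variable {f g : Space → ℝ} {d : Space}

theorem branches (h : Smearing f g) (hd : d ≠ 0) (hf0 : ft f 0 ≠ 0) (hg : ∃ k, ft g k ≠ 0) :
    Branches (alphaH f g d) (betaH f g d) (rhoH f g d)
      ((∫ k, wXp f d k / ‖k‖) * ∫ k, wXm g d k * ‖k‖)
      ((∫ k, wXm f d k / ‖k‖) * ∫ k, wXp g d k * ‖k‖) (slope f g d) where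
  a_pos := mul_pos (integral_wXp_field_pos h hd ⟨0, hf0⟩) (integral_wXm_momentum_pos h hd hg)
  b_pos := mul_pos (integral_wXm_field_pos h hd ⟨0, hf0⟩) (integral_wXp_momentum_pos h hd hg)
  slope_pos := slope_pos h hd hf0 hg
  alpha_zero := by
    filter_upwards [eventually_le_of_pos (show (0 : ℝ) < 1 / 4 by norm_num)] with ε h1
    rw [alphaH, alphaOf, entV_zero h1, entV_zero h1, entV_zero h1, entU_zero h1, entN_zero h1]
    ring
  alpha_incr H₁ hH1 := alpha_incr h hd hf0 hg hH1
  beta H₁ hH1 := quadAsymp_beta h hd hg hH1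
  rho H₁ hH1 := lipSqAsymp_rho h hd hg hH1
  rho_zero := by
    filter_upwards [eventually_le_of_pos (show (0 : ℝ) < 1 / 4 by norm_num)] with ε h1
    rw [rhoH, rhoOf, entV_zero h1, entV_zero h1]
    ring
  rho_nonneg := by
    filter_upwards [eventually_pos, eventually_le_of_pos (show (0 : ℝ) < 1 / 4 by norm_num)] with
      ε h0 h1 H hH
    exact rhoH_nonneg h h0 h1 hH

theorem entanglement_eq_negOf (h : Smearing f g) (hd : d ≠ 0) (hg : ∃ k, ft g k ≠ 0) (H₁ : ℝ) :
    ∀ᶠ r in 𝓝[>] (0 : ℝ), ∀ H, 0 ≤ H → H ≤ H₁ →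
      entanglement f g d r H = negOf (lamH f g d (epsOf r) H) := by
  have hQ := (quadAsymp_Qm (H₁ := H₁) d h).eventually_ge (integral_wXm_momentum_pos h hd hg)
  filter_upwards [tendsto_epsOf.eventually hQ, tendsto_epsOf.eventually eventually_pos,
    tendsto_epsOf.eventually (eventually_le_of_pos (show (0 : ℝ) < 1 / 4 by norm_num))] with
    r hQ h0 h1 H hH hH1
  exact entanglement_eq h h0 h1 hH
    ((half_pos (integral_wXm_momentum_pos h hd hg)).trans_le (hQ H hH hH1)).ne'

end main

end DeSitter
end

/-! ### The main theorem -/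

theorem mainTheorem8 (f g : DeSitter.Space → ℝ) (d : DeSitter.Space)
    -- smearing functions: compactly supported, square integrable, `g` of finite order-1/2 norm
    (hf : MemLp f 2 volume) (hg : MemLp g 2 volume)
    (hfc : HasCompactSupport f) (hgc : HasCompactSupport g)
    (hg_half : Integrable (fun k => ‖k‖ * ‖DeSitter.ft g k‖ ^ 2) volume)
    -- `(Φ[f], Π[g])` is a canonical pair
    (hfg : ∫ x, f x * g x = 1)
    -- the two subsystems have disjoint supports on the time slice
    (hdisj : Disjoint (Function.support f ∪ Function.support g)
      (Function.support (DeSitter.translate d f) ∪ Function.support (DeSitter.translate d g)))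
    -- nonvanishing average
    (havg : ∫ x, f x ≠ 0) :
    -- leading order in the light-field limit: monotone for all `H ≥ 0`
    (∃ L : ℝ → ℝ,
      (∀ H, 0 ≤ H →
        Tendsto (fun r => DeSitter.entanglement f g d r H) (𝓝[>] 0) (𝓝 (L H))) ∧
      AntitoneOn L (Ici 0) ∧
      StrictAntiOn L {H | 0 ≤ H ∧ 0 < L H}) ∧
    -- finite small mass: exactly monotone on every compact range of positive `H`
    (∀ H₀ H₁ : ℝ, 0 < H₀ → H₀ ≤ H₁ → ∃ r₀ > 0, ∀ r ∈ Ioo 0 r₀,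
      AntitoneOn (DeSitter.entanglement f g d r) (Icc H₀ H₁) ∧
      StrictAntiOn (DeSitter.entanglement f g d r)
        {H | H ∈ Icc H₀ H₁ ∧ 0 < DeSitter.entanglement f g d r H}) ∧
    -- finite small mass, down to `H = 0`: monotone up to terms of second order in `m / H`
    (∀ H₁ : ℝ, 0 ≤ H₁ → ∃ C : ℝ, ∃ r₀ > 0, ∀ r ∈ Ioo 0 r₀, ∀ H H' : ℝ,
      0 ≤ H → H ≤ H' → H' ≤ H₁ →
        DeSitter.entanglement f g d r H' ≤ DeSitter.entanglement f g d r H + C * r ^ 2) := by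
  open DeSitter in
  have hfi := integrable_of_memLp hf hfc
  have hgi := integrable_of_memLp hg hgc
  have h : Smearing f g := ⟨hfi, hgi, integrable_normSq_ft hfi hf, integrable_normSq_ft hgi hg,
    hg_half⟩
  have hf0 : ft f 0 ≠ 0 := by
    rw [ft_zero]
    exact Complex.ofReal_ne_zero.2 havg
  have hg0 : ∃ k, ft g k ≠ 0 := by
    by_contra! hz
    have hae := ae_eq_zero_of_ft_eq_zero hgi hg hz
    have : ∫ x, f x * g x = 0 := by
      rw [← integral_zero DeSitter.Space ℝ]
      refine integral_congr_ae ?_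
      filter_upwards [hae] with x hx
      rw [hx, Pi.zero_apply, mul_zero]
    rw [this] at hfg
    exact zero_ne_one hfg
  -- Otherwise the two regions coincide, so disjointness makes them empty and f has zero average.
  have hd : d ≠ 0 := by
    rintro rfl
    have e : ∀ a : DeSitter.Space → ℝ, DeSitter.translate 0 a = a := fun a => by
      ext x; simp [DeSitter.translate]
    rw [e, e, disjoint_self, Set.bot_eq_empty, Set.union_empty_iff] at hdisj
    rw [Function.support_eq_empty_iff.1 hdisj.1] at havg
    simp at havg
  have hB := branches h hd hf0 hg0
  set a₀ := (∫ k, wXp f d k / ‖k‖) * ∫ k, wXm g d k * ‖k‖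
  set b₀ := (∫ k, wXm f d k / ‖k‖) * ∫ k, wXp g d k * ‖k‖
  set K := slope f g d
  have hm : 0 < min a₀ b₀ := lt_min hB.a_pos hB.b_pos
  have hK : 0 < K := hB.slope_pos
  refine ⟨?_, ?_, ?_⟩
  -- The limit of λ. At H = 0 the branches decouple and the smaller one counts, whichever it is. For
  -- H > 0 the branch α has escaped to infinity, so l may jump upwards at 0, which is compatible
  -- with strict monotonicity.
  · set l : ℝ → ℝ := fun H => if H = 0 then min a₀ b₀ else b₀ + K * H ^ 2 with hl
    have hlpos : ∀ H, 0 < l H := fun H => by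
      rw [hl]
      dsimp only
      split_ifs
      · exact hm
      · have := hB.b_pos
        positivity
    have hlmono : ∀ H H', 0 ≤ H → H < H' → l H < l H' := fun H H' hH hHH => by
      have hH' : H' ≠ 0 := (hH.trans_lt hHH).ne'
      have h1 : 0 < K * H' ^ 2 := by positivity
      rw [hl]
      dsimp only
      rw [if_neg hH']
      split_ifs
      · exact (min_le_right _ _).trans_lt (by linarith)
      · have : H ^ 2 < H' ^ 2 := by nlinarith
        nlinarith
    refine ⟨fun H => negOf (l H), fun H hH => ?_, fun H hH H' hH' hHH => ?_,
      fun H hH H' hH' hHH => ?_⟩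
    · have hlim : Tendsto (fun ε => lamH f g d ε H) (𝓝[>] 0) (𝓝 (l H)) := by
        rcases hH.eq_or_lt with rfl | hpos
        · refine tendsto_const_nhds.congr' ?_
          filter_upwards [hB.lam_zero] with ε hε
          rw [lamH, hε, hl]
          simp
        · have := hB.tendsto_lam hpos
          rw [hl]
          dsimp only
          rwa [if_neg hpos.ne']
      refine ((negOf_continuousAt (hlpos H)).tendsto.comp (hlim.comp tendsto_epsOf)).congr' ?_
      filter_upwards [entanglement_eq_negOf h hd hg0 H] with r hr
      exact (hr H hH le_rfl).symm
    · rcases hHH.eq_or_lt with rfl | hlt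
      · exact le_rfl
      · exact negOf_antitone (hlpos H) (hlmono H H' hH hlt).le
    · exact negOf_strict (hlpos H) (hlmono H H' hH.1 hHH) hH'.2
  · intro H₀ H₁ h0 h01
    refine exists_Ioo_of_eventually ?_
    filter_upwards [entanglement_eq_negOf h hd hg0 H₁, tendsto_epsOf.eventually (hB.lam_lt h0 h01),
      tendsto_epsOf.eventually (hB.le_lam (h0.le.trans h01))] with r he hlt hpos
    have hp : ∀ H ∈ Icc H₀ H₁, 0 < lamH f g d (epsOf r) H := fun H hH =>
      (half_pos hm).trans_le (hpos H (h0.le.trans hH.1) hH.2)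
    have he' : ∀ H ∈ Icc H₀ H₁, entanglement f g d r H = negOf (lamH f g d (epsOf r) H) :=
      fun H hH => he H (h0.le.trans hH.1) hH.2
    refine ⟨fun H hH H' hH' hHH => ?_, fun H hH H' hH' hHH => ?_⟩
    · rw [he' H hH, he' H' hH']
      rcases hHH.eq_or_lt with rfl | hlt'
      · exact le_rfl
      · exact negOf_antitone (hp H hH) (hlt H H' hH.1 hlt' hH'.2).le
    · have h2 := hH'.2
      rw [he' H' hH'.1] at h2
      rw [he' H hH.1, he' H' hH'.1]
      exact negOf_strict (hp H hH.1) (hlt H H' hH.1.1 hHH hH'.1.2) h2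
  · intro H₁ hH1
    obtain ⟨C, hC, hl⟩ := hB.lam_sub_le hH1
    -- The loss Cε in λ becomes Cε/(m·2 log 2) in the logarithmic negativity, with m = min(a₀, b₀)/2
    -- the lower bound on λ. The factor 2/3 comes from ε ≤ 2r²/3.
    refine ⟨C / (min a₀ b₀ / 2 * (2 * Real.log 2)) * (2 / 3), exists_Ioo_of_eventually ?_⟩
    filter_upwards [entanglement_eq_negOf h hd hg0 H₁, tendsto_epsOf.eventually hl,
      tendsto_epsOf.eventually (hB.le_lam hH1), tendsto_epsOf.eventually eventually_pos,
      eventually_pos, eventually_le_of_pos one_pos] with r he hl hpos hε hr hr1 H H' hH hHH hH'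
    have h2 : 0 < Real.log 2 := Real.log_pos one_lt_two
    rw [he H hH (hHH.trans hH'), he H' (hH.trans hHH) hH']
    have h3 := negOf_le_add (half_pos hm)
      ((half_pos hm).trans_le (hpos H hH (hHH.trans hH'))) (hpos H' (hH.trans hHH) hH')
      (by positivity) (hl H H' hH hHH hH')
    refine h3.trans (add_le_add le_rfl ?_)
    have h4 := epsOf_le (show r ^ 2 ≤ 9 / 4 by nlinarith)
    calc C * epsOf r / (min a₀ b₀ / 2 * (2 * Real.log 2)) =
        C / (min a₀ b₀ / 2 * (2 * Real.log 2)) * epsOf r := by ring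
      _ ≤ C / (min a₀ b₀ / 2 * (2 * Real.log 2)) * (2 / 3 * r ^ 2) :=
          mul_le_mul_of_nonneg_left h4 (by positivity)
      _ = _ := by ring
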